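/- **One-atom maser.** Fix $E,E_0,\tau>0$, $\lambda\in\mathbb R\setminus\{0\}$ and $\beta\in\mathbb R$. Let $\mathfrak h_S=\ell^2(\mathbb N)$ (with $0\in\mathbb N$) be the bosonic Fock space of one field mode, with number states $|n\rangle$, annihilation operator $a$, number operator $N=a^*a$ and Hamiltonian $h_S=EN$, and let $\mathfrak h_{\mathcal E}=\mathbb C^2$ be the space of a two-level atom with lowering operator $b$, Hamiltonian $h_{\mathcal E}=E_0b^*b$ and thermal state $\rho_{\mathcal E,\beta}=e^{-\beta h_{\mathcal E}}/\mathrm{Tr}\,e^{-\beta h_{\mathcal E}}$. Let $$h=h_S\otimes 1+1\otimes h_{\mathcal E}+\tfrac{\lambda}{2}(a^*\otimes b+a\otimes b^*)$$ be the Jaynes–Cummings Hamiltonian and $\mathcal L_\beta(\rho)=\mathrm{Tr}_{\mathfrak h_{\mathcal E}}\big[e^{-i\tau h}(\rho\otimes\rho_{\mathcal E,\beta})e^{i\tau h}\big]$ the reduced dynamics map. *States.* A state is a positive operator $\rho$ on $\mathfrak h_S$ with $\mathrm{Tr}\,\rho=1$; write $\rho(A)=\mathrm{Tr}(\rho A)$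 for bounded $A$, and let $s(\rho)$ be the orthogonal projection onto $\overline{\mathrm{Ran}\,\rho}$. A state $\rho$ is *invariant* if $\mathcal L_\beta(\rho)=\rho$. It is *ergodic* if $\lim_{M\to\infty}\frac1M\sum_{n=1}^M(\mathcal L_\beta^n\mu)(A)=\rho(A)$ for all bounded $A$ and all states $\mu$ with $s(\mu)\le s(\rho)$. It is *exponentially mixing* if there is $\alpha>0$ such that for all such $A,\mu$ there is a constant $C_{A,\mu}$ with $|(\mathcal L_\beta^n\mu)(A)-\rho(A)|\le C_{A,\mu}e^{-\alpha n}$ for all $n\ge 0$. *Resonances.* Let $\eta=\big(\frac{(E-E_0)\tau}{2\pi}\big)^2$, $\xi=\big(\frac{\lambda\tau}{2\pi}\big)^2$ and let $R$ be the set of Rabi resonances, i.e. of the integers $n\ge1$ such that $\xi n+\eta=k^2$ for some $k\in\mathbb N$. The system is *non-resonant*, *simply resonant*, or *fully resonant* if $R$ is empty, has exactly one element, or is infinite, respectively. It is *degenerate* if it is fully resonant and there are $n\in\{0\}\cup R$ and $m\in R$ with $n<m$ and $n+1,m+1\in R$; otherwise it is *non-degenerate*. Let $n_1<n_2<\cdots$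 be the elements of $R$, $n_0=0$, and let $I_k=\{n_{k-1},\dots,n_k-1\}$, $k=1,2,\dots$ (with $n_k=\infty$ if $R$ has exactly $k-1$ elements) be the resulting partition of $\mathbb N$. The $k$-th Rabi sector is $\ell^2(I_k)$, with orthogonal projection $P_k$. Put $\beta^*=\beta E_0/E$ and $$\rho_{\beta^*}=\frac{e^{-\beta^*h_S}}{\mathrm{Tr}\,e^{-\beta^*h_S}},\qquad \rho^{(k)}_{\beta^*}=\frac{e^{-\beta^*h_S}P_k}{\mathrm{Tr}(e^{-\beta^*h_S}P_k)}$$ whenever the trace in question is finite. **Theorem.** 1. If the system is non-resonant and $\beta\le0$, then $\mathcal L_\beta$ has no invariant state. If it is non-resonant and $\beta>0$, then $\rho_{\beta^*}$ is the unique ergodic state, and $\lim_{M\to\infty}\frac1M\sum_{n=1}^M(\mathcal L_\beta^n\rho)(A)=\rho_{\beta^*}(A)$ for every state $\rho$ and every bounded $A$. 2. If the system is simply resonant and $\beta\le0$, then $\rho^{(1)}_{\beta^*}$ is the unique ergodic state. If it is simply resonant and $\beta>0$, then there are exactly two ergodic states, $\rho^{(1)}_{\beta^*}$ and $\rho^{(2)}_{\beta^*}$,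 and for every state $\rho$ and every bounded $A$ $$\lim_{M\to\infty}\frac1M\sum_{n=1}^M(\mathcal L_\beta^n\rho)(A)=\rho(P_1)\,\rho^{(1)}_{\beta^*}(A)+\rho(P_2)\,\rho^{(2)}_{\beta^*}(A).$$ 3. If the system is fully resonant, then for every $\beta\in\mathbb R$ the states $\rho^{(k)}_{\beta^*}$, $k=1,2,\dots$, are pairwise different and ergodic. If moreover it is non-degenerate, then for every state $\rho$ and every bounded $A$ $$\lim_{M\to\infty}\frac1M\sum_{n=1}^M(\mathcal L_\beta^n\rho)(A)=\sum_{k=1}^\infty\rho(P_k)\,\rho^{(k)}_{\beta^*}(A),$$ where the series converges absolutely. 4. If the system is non-degenerate, then every invariant state is diagonal in the basis $(|n\rangle)$ and is a finite or countable convex combination $\sum_k c_k\,\rho^{(k)}_{\beta^*}$ (convergent in operator norm) of ergodic states $\rho^{(k)}_{\beta^*}$. 5. Whenever the state $\rho^{(k)}_{\beta^*}$ is ergodic and the Rabi sector $\ell^2(I_k)$ is finite-dimensional, $\rho^{(k)}_{\beta^*}$ is exponentially mixing. -/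

import Mathlib

open scoped TensorProduct InnerProductSpace ComplexOrder

noncomputable section

namespace OneAtomMaser

/-! ### Hilbert spaces -/

/-- The space `ℓ²(ι)`. -/
abbrev Ell2 (ι : Type) : Type := lp (fun _ : ι => ℂ) 2

/-- The Hilbert space of the cavity field, `ℓ²(ℕ)`; the `n`-th coordinate is the amplitude of
the state with `n` photons. -/
abbrev Field : Type := Ell2 ℕ

/-- The Hilbert space of field and atom, `ℓ²(ℕ) ⊗ ℂ² = ℓ²(ℕ × {0,1})`; the index `(n, σ)` stands
for `|n⟩ ⊗ |σ⟩`, where `σ = 0` is the ground state and `σ = 1` the excited state of the atom. -/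
abbrev Joint : Type := Ell2 (ℕ × Fin 2)

/-- The canonical orthonormal basis vector `|i⟩` of `ℓ²(ι)`. -/
def ket {ι : Type} [DecidableEq ι] (i : ι) : Ell2 ι := lp.single 2 i (1 : ℂ)

theorem inner_ket {ι : Type} [DecidableEq ι] (i j : ι) :
    ⟪ket i, ket j⟫_ℂ = if i = j then 1 else 0 := by
  unfold ket
  rw [lp.inner_single_left]
  by_cases h : i = j
  · subst h; simp
  · simp [lp.single_apply, h]

theorem orthonormal_ket {ι : Type} [DecidableEq ι] : Orthonormal ℂ (ket : ι → Ell2 ι) :=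
  orthonormal_iff_ite.mpr inner_ket

/-- The isometry of `ℓ²(ι)` that maps `|i⟩` to `v i`, for an orthonormal family `v`. -/
def isometryOf {ι : Type} {F : Type} [NormedAddCommGroup F] [InnerProductSpace ℂ F]
    [CompleteSpace F] (v : ι → F) (hv : Orthonormal ℂ v) : Ell2 ι →ₗᵢ[ℂ] F :=
  hv.orthogonalFamily.linearIsometry

theorem isometryOf_ket {ι : Type} [DecidableEq ι] {F : Type} [NormedAddCommGroup F]
    [InnerProductSpace ℂ F] [CompleteSpace F] (v : ι → F) (hv : Orthonormal ℂ v) (i : ι) :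
    isometryOf v hv (ket i) = v i := by
  unfold isometryOf ket
  rw [OrthogonalFamily.linearIsometry_apply_single]
  simp

theorem memlp_mul {ι : Type} {f : ι → ℂ} {C : ℝ} (hC : ∀ i, ‖f i‖ ≤ C) (x : Ell2 ι) :
    Memℓp (fun i => f i * x i) 2 := by
  refine (((lp.memℓp x).norm.const_mul C)).mono (fun i => ?_)
  simp only [norm_mul]
  exact mul_le_mul_of_nonneg_right (hC i) (norm_nonneg _)

/-- The diagonal operator `∑ₙ f(n) |n⟩⟨n|`, i.e. `f(N)`, for a bounded function `f`. -/
def diagOp (f : ℕ → ℂ) (hf : ∃ C : ℝ, ∀ n, ‖f n‖ ≤ C) : Field →L[ℂ] Field :=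
  LinearMap.mkContinuousOfExistsBound
    { toFun := fun x => ⟨fun n => f n * x n, memlp_mul hf.choose_spec x⟩
      map_add' := fun x y => by ext n; exact mul_add (f n) (x n) (y n)
      map_smul' := fun c x => by ext n; exact mul_left_comm (f n) c (x n) }
    (by
      obtain ⟨C, hC⟩ := hf
      refine ⟨‖(C : ℂ)‖, fun x => ?_⟩
      rw [← norm_smul]
      refine lp.norm_mono (by norm_num) (fun n => ?_)
      change ‖f n * x n‖ ≤ ‖(C : ℂ) * x n‖
      rw [norm_mul, norm_mul]
      refine mul_le_mul_of_nonneg_right ((hC n).trans ?_) (norm_nonneg _)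
      simpa using le_abs_self C)

theorem diagOp_apply (f : ℕ → ℂ) (hf : ∃ C : ℝ, ∀ n, ‖f n‖ ≤ C) (x : Field) (n : ℕ) :
    diagOp f hf x n = f n * x n := rfl

/-! ### The Jaynes-Cummings Hamiltonian -/

/-- The parameters of the one-atom maser: frequency `E` of the field mode, energy `E₀` of the
excited state of the atom, coupling constant `coupling` (usually written `λ`), and duration `τ` of
each interaction. -/
structure Maser where
  E : ℝ
  E₀ : ℝ
  coupling : ℝ
  τ : ℝ

/-- The field annihilation operator on finite combinations of number states:
`a|n⟩ = √n |n-1⟩`. -/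
def annihilate : Module.End ℂ (ℕ →₀ ℂ) :=
  Finsupp.linearCombination ℂ (fun n : ℕ => Finsupp.single (n - 1) ((√(n : ℝ) : ℝ) : ℂ))

/-- The field creation operator on finite combinations of number states:
`a*|n⟩ = √(n+1) |n+1⟩`. -/
def create : Module.End ℂ (ℕ →₀ ℂ) :=
  Finsupp.linearCombination ℂ (fun n : ℕ => Finsupp.single (n + 1) ((√((n : ℝ) + 1) : ℝ) : ℂ))

/-- The atomic annihilation operator `b`, with `b|1⟩ = |0⟩` and `b|0⟩ = 0`. -/
def lower : Matrix (Fin 2) (Fin 2) ℂ := !![0, 1; 0, 0]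

/-- The atomic creation operator `b*`. -/
def raise : Matrix (Fin 2) (Fin 2) ℂ := !![0, 0; 1, 0]

/-- The dense subspace of finite combinations of the vectors `|n⟩ ⊗ |σ⟩`. -/
abbrev Core : Type := (ℕ →₀ ℂ) ⊗[ℂ] (Fin 2 → ℂ)

/-- The inclusion of the dense subspace into the Hilbert space of field and atom. -/
def incl : Core →ₗ[ℂ] Joint :=
  TensorProduct.lift (Finsupp.linearCombination ℂ
    (fun n : ℕ => Fintype.linearCombination ℂ (fun σ : Fin 2 => (ket (n, σ) : Joint))))

theorem incl_tmul (n : ℕ) (c : ℂ) (g : Fin 2 → ℂ) :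
    incl (Finsupp.single n c ⊗ₜ[ℂ] g) =
      (c * g 0) • (ket (n, 0) : Joint) + (c * g 1) • (ket (n, 1) : Joint) := by
  simp [incl, Fintype.linearCombination_apply, smul_smul]

namespace Maser

variable (M : Maser)

/-- The Hamiltonian `h_E = E₀ b* b` of the atom. -/
def atomHamiltonian : Matrix (Fin 2) (Fin 2) ℂ := (M.E₀ : ℂ) • (raise * lower)

/-- The Jaynes-Cummings Hamiltonian
`h = E a*a ⊗ 1 + 1 ⊗ h_E + (λ/2) (a* ⊗ b + a ⊗ b*)` on finite combinations of the `|n⟩ ⊗ |σ⟩`. -/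
def hamiltonian : Module.End ℂ Core :=
  (M.E : ℂ) • TensorProduct.map (create ∘ₗ annihilate) LinearMap.id
    + TensorProduct.map LinearMap.id (Matrix.toLin' M.atomHamiltonian)
    + ((M.coupling / 2 : ℝ) : ℂ) •
      (TensorProduct.map create (Matrix.toLin' lower)
        + TensorProduct.map annihilate (Matrix.toLin' raise))

/-- The matrix of the Hamiltonian on its invariant subspace spanned by `|n+1⟩ ⊗ |0⟩` and
`|n⟩ ⊗ |1⟩` (see `incl_hamiltonian_excited` and `incl_hamiltonian_ground`). -/
def block (n : ℕ) : Matrix (Fin 2) (Fin 2) ℂ :=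
  !![((M.E * (n + 1) : ℝ) : ℂ), ((M.coupling / 2 * √((n : ℝ) + 1) : ℝ) : ℂ);
     ((M.coupling / 2 * √((n : ℝ) + 1) : ℝ) : ℂ), ((M.E * n + M.E₀ : ℝ) : ℂ)]

/-- `-i h` on that subspace. -/
def generatorBlock (n : ℕ) : Matrix (Fin 2) (Fin 2) ℂ := (-Complex.I) • M.block n

/-- `exp(-i t h)` on that subspace. -/
def propagatorBlock (t : ℝ) (n : ℕ) : Matrix (Fin 2) (Fin 2) ℂ :=
  NormedSpace.exp (t • M.generatorBlock n)

/-- The images `exp(-i t h) |n⟩ ⊗ |σ⟩` of the basis vectors. -/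
def evolvedKet (t : ℝ) : ℕ × Fin 2 → Joint
  | (0, 0) => ket (0, 0)
  | (n + 1, 0) => M.propagatorBlock t n 0 0 • ket (n + 1, 0)
      + M.propagatorBlock t n 1 0 • ket (n, 1)
  | (n, 1) => M.propagatorBlock t n 0 1 • ket (n + 1, 0)
      + M.propagatorBlock t n 1 1 • ket (n, 1)

theorem incl_hamiltonian_zero :
    incl (M.hamiltonian (Finsupp.single 0 1 ⊗ₜ[ℂ] Pi.single 0 1)) = 0 := by
  simp [hamiltonian, atomHamiltonian, annihilate, create, lower, raise, incl_tmul,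
    Matrix.toLin'_apply]

theorem incl_hamiltonian_ground (n : ℕ) :
    incl (M.hamiltonian (Finsupp.single (n + 1) 1 ⊗ₜ[ℂ] Pi.single 0 1)) =
      M.block n 0 0 • ket (n + 1, 0) + M.block n 1 0 • ket (n, 1) := by
  have hN : create (annihilate (Finsupp.single (n + 1) 1))
      = Finsupp.single (n + 1) ((n : ℂ) + 1) := by
    have h : ((√((n : ℝ) + 1) : ℝ) : ℂ) * ((√((n : ℝ) + 1) : ℝ) : ℂ) = (n : ℂ) + 1 := by
      rw [← Complex.ofReal_mul, Real.mul_self_sqrt (by positivity)]; simp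
    simp [annihilate, create, -Finsupp.single_mul, h]
  have ha : annihilate (Finsupp.single (n + 1) 1)
      = Finsupp.single n ((√((n : ℝ) + 1) : ℝ) : ℂ) := by simp [annihilate]
  simp only [hamiltonian, LinearMap.add_apply, LinearMap.smul_apply, TensorProduct.map_tmul,
    LinearMap.comp_apply, hN, LinearMap.id_apply, map_add, map_smul, Matrix.toLin'_apply,
    incl_tmul]
  rw [ha]
  simp [create, atomHamiltonian, lower, raise, incl_tmul, block]
  module

theorem incl_hamiltonian_excited (n : ℕ) :
    incl (M.hamiltonian (Finsupp.single n 1 ⊗ₜ[ℂ] Pi.single 1 1)) =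
      M.block n 0 1 • ket (n + 1, 0) + M.block n 1 1 • ket (n, 1) := by
  have hN : create (annihilate (Finsupp.single n 1)) = Finsupp.single n (n : ℂ) := by
    cases n with
    | zero => simp [annihilate, create]
    | succ n =>
      have h : ((√((n : ℝ) + 1) : ℝ) : ℂ) * ((√((n : ℝ) + 1) : ℝ) : ℂ) = (n : ℂ) + 1 := by
        rw [← Complex.ofReal_mul, Real.mul_self_sqrt (by positivity)]; simp
      simp [annihilate, create, -Finsupp.single_mul, h]
  have ha : create (Finsupp.single n 1)
      = Finsupp.single (n + 1) ((√((n : ℝ) + 1) : ℝ) : ℂ) := by simp [create]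
  simp only [hamiltonian, LinearMap.add_apply, LinearMap.smul_apply, TensorProduct.map_tmul,
    LinearMap.comp_apply, hN, ha, LinearMap.id_apply, map_add, map_smul, Matrix.toLin'_apply]
  simp [annihilate, atomHamiltonian, lower, raise, incl_tmul, block, smul_smul, add_smul]
  module

theorem block_conjTranspose (n : ℕ) : (M.block n).conjTranspose = M.block n := by
  ext i j
  fin_cases i <;> fin_cases j <;> simp [block]

theorem propagatorBlock_zero (n : ℕ) : M.propagatorBlock 0 n = 1 := by
  simp [propagatorBlock]

theorem propagatorBlock_add (s t : ℝ) (n : ℕ) :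
    M.propagatorBlock (s + t) n = M.propagatorBlock s n * M.propagatorBlock t n := by
  unfold propagatorBlock
  rw [add_smul]
  exact Matrix.exp_add_of_commute _ _ (((Commute.refl _).smul_left s).smul_right t)

theorem propagatorBlock_conjTranspose (t : ℝ) (n : ℕ) :
    (M.propagatorBlock t n).conjTranspose = M.propagatorBlock (-t) n := by
  unfold propagatorBlock generatorBlock
  rw [← Matrix.exp_conjTranspose]
  congr 1
  rw [Matrix.conjTranspose_smul, Matrix.conjTranspose_smul, block_conjTranspose]
  simp

theorem propagatorBlock_unitary (t : ℝ) (n : ℕ) :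
    (M.propagatorBlock t n).conjTranspose * M.propagatorBlock t n = 1 := by
  rw [propagatorBlock_conjTranspose, ← propagatorBlock_add, neg_add_cancel, propagatorBlock_zero]

theorem hasDerivAt_propagatorBlock (t : ℝ) (n : ℕ) (i j : Fin 2) :
    HasDerivAt (fun s : ℝ => M.propagatorBlock s n i j)
      ((M.propagatorBlock t n * M.generatorBlock n) i j) t := by
  let _ : NormedRing (Matrix (Fin 2) (Fin 2) ℂ) := Matrix.linftyOpNormedRing
  let _ : NormedAlgebra ℝ (Matrix (Fin 2) (Fin 2) ℂ) := Matrix.linftyOpNormedAlgebra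
  have h : HasDerivAt (fun s : ℝ => M.propagatorBlock s n)
      (M.propagatorBlock t n * M.generatorBlock n) t :=
    hasDerivAt_exp_smul_const (𝕂 := ℝ) (M.generatorBlock n) t
  have h1 := hasDerivAt_pi.mp h i
  exact hasDerivAt_pi.mp h1 j

theorem orthonormal_evolvedKet (t : ℝ) : Orthonormal ℂ (M.evolvedKet t) := by
  have key : ∀ n i j, starRingEnd ℂ (M.propagatorBlock t n 0 i) * M.propagatorBlock t n 0 j
      + starRingEnd ℂ (M.propagatorBlock t n 1 i) * M.propagatorBlock t n 1 j
      = if i = j then 1 else 0 := by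
    intro n i j
    have := congrFun (congrFun (M.propagatorBlock_unitary t n) i) j
    simpa [Matrix.mul_apply, Fin.sum_univ_two, Matrix.one_apply] using this
  rw [orthonormal_iff_ite]
  have h00 : M.evolvedKet t (0, 0) = ket (0, 0) := rfl
  have hs0 : ∀ n, M.evolvedKet t (n + 1, 0) = M.propagatorBlock t n 0 0 • ket (n + 1, 0)
      + M.propagatorBlock t n 1 0 • ket (n, 1) := fun _ => rfl
  have hs1 : ∀ n, M.evolvedKet t (n, 1) = M.propagatorBlock t n 0 1 • ket (n + 1, 0)
      + M.propagatorBlock t n 1 1 • ket (n, 1) := by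
    intro n; cases n <;> rfl
  have k00 := fun n => key n 0 0
  have k01 := fun n => key n 0 1
  have k10 := fun n => key n 1 0
  have k11 := fun n => key n 1 1
  simp only [Fin.isValue, reduceIte, zero_ne_one, one_ne_zero] at k00 k01 k10 k11
  rintro ⟨n, σ⟩ ⟨m, σ'⟩
  fin_cases σ <;> fin_cases σ'
  · rcases n with _ | n
    · rcases m with _ | m
      · simp [h00, orthonormal_ket.1]
      · simp [h00, hs0, inner_add_right, inner_smul_right, inner_ket]
    rcases m with _ | m
    · simp [h00, hs0, inner_add_left, inner_smul_left, inner_ket]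
    simp [hs0, inner_add_left, inner_add_right, inner_smul_left, inner_smul_right, inner_ket]
    by_cases h : n = m
    · subst h; simpa [mul_comm] using k00 n
    · simp [h]
  · rcases n with _ | n <;>
      simp [h00, hs0, hs1, inner_add_left, inner_add_right, inner_smul_left, inner_smul_right,
        inner_ket]
    by_cases h : n = m
    · subst h; simpa [mul_comm] using k01 n
    · simp [h]
  · rcases m with _ | m <;>
      simp [h00, hs0, hs1, inner_add_left, inner_add_right, inner_smul_left, inner_smul_right,
        inner_ket]
    by_cases h : n = m
    · subst h; simpa [mul_comm] using k10 n
    · simp [h]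
  · simp [hs1, inner_add_left, inner_add_right, inner_smul_left, inner_smul_right,
        inner_ket]
    by_cases h : n = m
    · subst h; simpa [mul_comm] using k11 n
    · simp [h]

/-- The propagator `exp(-i t h)` of the Jaynes-Cummings Hamiltonian, as an isometry of the Hilbert
space. By `propagator_zero`, `propagator_add`, `adjoint_propagator` and `hasDerivAt_propagator`, it
is a unitary group whose generator extends `-i h`. -/
def propagator (t : ℝ) : Joint →L[ℂ] Joint :=
  (isometryOf (M.evolvedKet t) (M.orthonormal_evolvedKet t)).toContinuousLinearMap

theorem propagator_ket (t : ℝ) (p : ℕ × Fin 2) :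
    M.propagator t (ket p) = M.evolvedKet t p :=
  isometryOf_ket (M.evolvedKet t) (M.orthonormal_evolvedKet t) p

theorem evolvedKet_zero_ground (t : ℝ) : M.evolvedKet t (0, 0) = ket (0, 0) := rfl

theorem evolvedKet_ground (t : ℝ) (n : ℕ) :
    M.evolvedKet t (n + 1, 0) = M.propagatorBlock t n 0 0 • ket (n + 1, 0)
      + M.propagatorBlock t n 1 0 • ket (n, 1) := rfl

theorem evolvedKet_excited (t : ℝ) (n : ℕ) :
    M.evolvedKet t (n, 1) = M.propagatorBlock t n 0 1 • ket (n + 1, 0)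
      + M.propagatorBlock t n 1 1 • ket (n, 1) := by
  cases n <;> rfl

theorem clm_ext {F : Type} [NormedAddCommGroup F] [NormedSpace ℂ F] {S T : Joint →L[ℂ] F}
    (h : ∀ p, S (ket p) = T (ket p)) : S = T := by
  refine lp.ext_continuousLinearMap (by norm_num) (fun p => ?_)
  ext
  exact h p

theorem propagator_zero : M.propagator 0 = 1 := by
  refine clm_ext ?_
  rintro ⟨n, σ⟩
  rw [propagator_ket]
  fin_cases σ
  · cases n with
    | zero => rfl
    | succ n => simp [evolvedKet_ground, propagatorBlock_zero]
  · simp [evolvedKet_excited, propagatorBlock_zero]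

theorem propagator_add (s t : ℝ) : M.propagator (s + t) = M.propagator s * M.propagator t := by
  refine clm_ext ?_
  rintro ⟨n, σ⟩
  change _ = M.propagator s (M.propagator t (ket (n, σ)))
  rw [propagator_ket, propagator_ket]
  fin_cases σ
  · cases n with
    | zero => simp [evolvedKet_zero_ground, propagator_ket]
    | succ n =>
      simp only [Fin.zero_eta, evolvedKet_ground, map_add, map_smul, propagator_ket,
        evolvedKet_excited, propagatorBlock_add, Matrix.mul_apply, Fin.sum_univ_two]
      module
  · simp only [Fin.mk_one, evolvedKet_ground, map_add, map_smul, propagator_ket,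
      evolvedKet_excited, propagatorBlock_add, Matrix.mul_apply, Fin.sum_univ_two]
    module

theorem adjoint_propagator (t : ℝ) :
    ContinuousLinearMap.adjoint (M.propagator t) = M.propagator (-t) := by
  have h1 : ContinuousLinearMap.adjoint (M.propagator t) * M.propagator t = 1 :=
    ((M.propagator t).norm_map_iff_adjoint_comp_self).mp
      (isometryOf (M.evolvedKet t) (M.orthonormal_evolvedKet t)).norm_map
  have h2 : M.propagator t * M.propagator (-t) = 1 := by
    rw [← propagator_add, add_neg_cancel, propagator_zero]
  exact left_inv_eq_right_inv h1 h2

/-- On the dense subspace the propagator solves the Schrödinger equation with Hamiltonian `h`. -/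
theorem hasDerivAt_propagator (t : ℝ) (ψ : Core) :
    HasDerivAt (fun s : ℝ => M.propagator s (incl ψ))
      (M.propagator t ((-Complex.I) • incl (M.hamiltonian ψ))) t := by
  have basis : ∀ (n : ℕ) (σ : Fin 2),
      HasDerivAt (fun s : ℝ => M.propagator s (incl (Finsupp.single n 1 ⊗ₜ[ℂ] Pi.single σ 1)))
      (M.propagator t ((-Complex.I) •
        incl (M.hamiltonian (Finsupp.single n 1 ⊗ₜ[ℂ] Pi.single σ 1)))) t := by
    intro n σ
    fin_cases σ
    · cases n with
      | zero =>
        have := M.incl_hamiltonian_zero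
        simp only [Fin.zero_eta, this]
        simpa [incl_tmul, propagator_ket, evolvedKet_zero_ground] using
          hasDerivAt_const t (ket (0, 0) : Joint)
      | succ n =>
        have := M.incl_hamiltonian_ground n
        simp only [Fin.zero_eta, this]
        have h := ((M.hasDerivAt_propagatorBlock t n 0 0).smul_const (ket (n + 1, 0) : Joint)).add
          ((M.hasDerivAt_propagatorBlock t n 1 0).smul_const (ket (n, 1) : Joint))
        refine (h.congr_deriv ?_).congr_of_eventuallyEq (Filter.Eventually.of_forall fun s => ?_)
        · simp only [map_smul, map_add, propagator_ket, evolvedKet_ground, evolvedKet_excited,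
            generatorBlock, Matrix.mul_apply, Fin.sum_univ_two, Matrix.smul_apply, smul_eq_mul]
          module
        · simp [incl_tmul, propagator_ket, evolvedKet_ground]
    · have := M.incl_hamiltonian_excited n
      simp only [Fin.mk_one, this]
      have h := ((M.hasDerivAt_propagatorBlock t n 0 1).smul_const (ket (n + 1, 0) : Joint)).add
          ((M.hasDerivAt_propagatorBlock t n 1 1).smul_const (ket (n, 1) : Joint))
      refine (h.congr_deriv ?_).congr_of_eventuallyEq (Filter.Eventually.of_forall fun s => ?_)
      · simp only [map_smul, map_add, propagator_ket, evolvedKet_ground, evolvedKet_excited,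
          generatorBlock, Matrix.mul_apply, Fin.sum_univ_two, Matrix.smul_apply, smul_eq_mul]
        module
      · simp [incl_tmul, propagator_ket, evolvedKet_excited]
  induction ψ using TensorProduct.induction_on with
  | zero => simpa using hasDerivAt_const t (0 : Joint)
  | add x y hx hy => simpa using hx.fun_add hy
  | tmul f g =>
    induction f using Finsupp.induction_linear with
    | zero => simpa using hasDerivAt_const t (0 : Joint)
    | add x y hx hy => simpa [TensorProduct.add_tmul] using hx.fun_add hy
    | single n c =>
      have hg : Finsupp.single n c ⊗ₜ[ℂ] g
          = (c * g 0) • (Finsupp.single n (1 : ℂ) ⊗ₜ[ℂ] (Pi.single 0 1 : Fin 2 → ℂ))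
            + (c * g 1) • (Finsupp.single n (1 : ℂ) ⊗ₜ[ℂ] (Pi.single 1 1 : Fin 2 → ℂ)) := by
        have h1 : g = g 0 • (Pi.single 0 1 : Fin 2 → ℂ) + g 1 • (Pi.single 1 1 : Fin 2 → ℂ) := by
          ext i; fin_cases i <;> simp
        have h2 : (Finsupp.single n c : ℕ →₀ ℂ) = c • Finsupp.single n (1 : ℂ) := by simp
        conv_lhs => rw [h1, h2]
        simp only [TensorProduct.tmul_add, TensorProduct.tmul_smul, TensorProduct.smul_tmul',
          smul_smul, mul_comm]
      rw [hg]
      have h := ((basis n 0).const_smul (c * g 0)).add ((basis n 1).const_smul (c * g 1))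
      refine (h.congr_deriv ?_).congr_of_eventuallyEq (Filter.Eventually.of_forall fun s => ?_)
      · simp only [map_add, map_smul]
        module
      · simp

/-! ### The reduced dynamics map -/

end Maser

/-- The isometry `J_σ : ψ ↦ ψ ⊗ |σ⟩`. -/
def tensorKet (σ : Fin 2) : Field →L[ℂ] Joint :=
  (isometryOf (fun n : ℕ => (ket (n, σ) : Joint))
    (orthonormal_ket.comp _ (fun _ _ h => congrArg Prod.fst h))).toContinuousLinearMap

/-- The operator `ρ ⊗ m` on the joint space: `∑ m_{σσ'} ρ ⊗ |σ⟩⟨σ'|`. -/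
def tensorOp (ρ : Field →L[ℂ] Field) (m : Matrix (Fin 2) (Fin 2) ℂ) : Joint →L[ℂ] Joint :=
  ∑ σ, ∑ σ', m σ σ' • (tensorKet σ ∘L ρ ∘L ContinuousLinearMap.adjoint (tensorKet σ'))

/-- The partial trace over the atom: `∑_σ ⟨σ| X |σ⟩`. -/
def partialTrace (X : Joint →L[ℂ] Joint) : Field →L[ℂ] Field :=
  ∑ σ, ContinuousLinearMap.adjoint (tensorKet σ) ∘L X ∘L tensorKet σ

namespace Maser

variable (M : Maser)

/-- The thermal state `exp(-β h_E) / Tr exp(-β h_E)` of the atom. -/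
def atomGibbs (β : ℝ) : Matrix (Fin 2) (Fin 2) ℂ :=
  (Matrix.trace (NormedSpace.exp (-(β : ℂ) • M.atomHamiltonian)))⁻¹ •
    NormedSpace.exp (-(β : ℂ) • M.atomHamiltonian)

/-- The reduced dynamics map
`L_β(ρ) = Tr_E [exp(-i τ h) (ρ ⊗ exp(-β h_E)/Tr exp(-β h_E)) exp(i τ h)]`. -/
def rdm (β : ℝ) (ρ : Field →L[ℂ] Field) : Field →L[ℂ] Field :=
  partialTrace (M.propagator M.τ ∘L tensorOp ρ (M.atomGibbs β) ∘L
    ContinuousLinearMap.adjoint (M.propagator M.τ))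

end Maser

/-! ### States -/

/-- A state (density matrix): a positive operator of trace one. -/
def IsState (ρ : Field →L[ℂ] Field) : Prop :=
  ρ.IsPositive ∧ HasSum (fun n : ℕ => ⟪(ket n : Field), ρ (ket n)⟫_ℂ) 1

/-- The expectation `ρ(A) = Tr(ρ A)`. -/
def expect (ρ A : Field →L[ℂ] Field) : ℂ := ∑' n : ℕ, ⟪(ket n : Field), ρ (A (ket n))⟫_ℂ

/-- The support `s(ρ)`: the orthogonal projection onto the closure of the range of `ρ`. -/
def supportProj (ρ : Field →L[ℂ] Field) : Field →L[ℂ] Field :=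
  (LinearMap.range ρ.toLinearMap).topologicalClosure.starProjection

/-- Invariant states of a map `L`. -/
def IsInvariantState (L : (Field →L[ℂ] Field) → (Field →L[ℂ] Field)) (ρ : Field →L[ℂ] Field) :
    Prop :=
  IsState ρ ∧ L ρ = ρ

/-- The Cesàro mean `(1/N) ∑_{n=1}^N (L^n μ)(A)`. -/
def cesaroMean (L : (Field →L[ℂ] Field) → (Field →L[ℂ] Field)) (μ A : Field →L[ℂ] Field)
    (N : ℕ) : ℂ :=
  (1 / (N : ℂ)) * ∑ n ∈ Finset.Icc 1 N, expect (L^[n] μ) A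

/-- A state `ρ` is ergodic for `L` if `(1/N) ∑_{n=1}^N (L^n μ)(A) → ρ(A)` for all bounded `A` and
all states `μ` with `s(μ) ≤ s(ρ)`. -/
def IsErgodicState (L : (Field →L[ℂ] Field) → (Field →L[ℂ] Field)) (ρ : Field →L[ℂ] Field) :
    Prop :=
  IsState ρ ∧ ∀ μ : Field →L[ℂ] Field, IsState μ → supportProj μ ≤ supportProj ρ →
    ∀ A : Field →L[ℂ] Field,
      Filter.Tendsto (cesaroMean L μ A) Filter.atTop (nhds (expect ρ A))

/-- A state `ρ` is exponentially mixing for `L` if `(L^n μ)(A) → ρ(A)` exponentially fast, with a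
rate that does not depend on `A` and `μ`, for all bounded `A` and all states `μ` with
`s(μ) ≤ s(ρ)`. -/
def IsExpMixingState (L : (Field →L[ℂ] Field) → (Field →L[ℂ] Field)) (ρ : Field →L[ℂ] Field) :
    Prop :=
  IsState ρ ∧ ∃ α : ℝ, 0 < α ∧ ∀ μ : Field →L[ℂ] Field, IsState μ →
    supportProj μ ≤ supportProj ρ → ∀ A : Field →L[ℂ] Field, ∃ C : ℝ, ∀ n : ℕ,
      ‖expect (L^[n] μ) A - expect ρ A‖ ≤ C * Real.exp (-α * n)

/-- `ρ` is diagonal in the basis of number states. -/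
def IsDiagonal (ρ : Field →L[ℂ] Field) : Prop :=
  ∀ m n : ℕ, m ≠ n → ⟪(ket m : Field), ρ (ket n)⟫_ℂ = 0

/-- The orthogonal projection onto `ℓ²(I)`. -/
def proj (I : Set ℕ) : Field →L[ℂ] Field :=
  diagOp (I.indicator (fun _ => 1)) ⟨1, fun n => by
    by_cases h : n ∈ I <;> simp [h]⟩

namespace Maser

variable (M : Maser)

/-- The Boltzmann factor `exp(-b E n)` of the field Hamiltonian `h_S = E N`, restricted to `I`. -/
def boltzmann (b : ℝ) (I : Set ℕ) : ℕ → ℝ := I.indicator (fun n => Real.exp (-b * (M.E * n)))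

theorem boltzmann_nonneg (b : ℝ) (I : Set ℕ) (n : ℕ) : 0 ≤ M.boltzmann b I n :=
  Set.indicator_nonneg (fun _ _ => (Real.exp_pos _).le) n

theorem gibbs_bounded (b : ℝ) (I : Set ℕ) :
    ∃ C : ℝ, ∀ n, ‖((M.boltzmann b I n / ∑' m, M.boltzmann b I m : ℝ) : ℂ)‖ ≤ C := by
  refine ⟨1, fun n => ?_⟩
  rw [Complex.norm_real, Real.norm_eq_abs,
    abs_of_nonneg (div_nonneg (M.boltzmann_nonneg b I n) (tsum_nonneg (M.boltzmann_nonneg b I)))]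
  by_cases h : Summable (M.boltzmann b I)
  · exact div_le_one_of_le₀ (h.le_tsum n (fun m _ => M.boltzmann_nonneg b I m))
      (tsum_nonneg (M.boltzmann_nonneg b I))
  · simp [tsum_eq_zero_of_not_summable h]

/-- The operator `exp(-b h_S) P_I / Tr (exp(-b h_S) P_I)`, where `h_S = E N` is the Hamiltonian of
the field and `P_I` is the projection onto `ℓ²(I)`. It is a state exactly when `I` is non-empty
and the trace is finite; it is `0` otherwise. -/
def gibbs (b : ℝ) (I : Set ℕ) : Field →L[ℂ] Field :=
  diagOp (fun n => ((M.boltzmann b I n / ∑' m, M.boltzmann b I m : ℝ) : ℂ)) (M.gibbs_bounded b I)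

/-- The renormalized inverse temperature `β* = β E₀ / E`. -/
def betaStar (β : ℝ) : ℝ := β * M.E₀ / M.E

/-! ### Rabi resonances -/

/-- The dimensionless detuning `η = (Δ τ / 2π)²`, with `Δ = E - E₀`. -/
def eta : ℝ := ((M.E - M.E₀) * M.τ / (2 * Real.pi)) ^ 2

/-- The dimensionless coupling `ξ = (λ τ / 2π)²`. -/
def xi : ℝ := (M.coupling * M.τ / (2 * Real.pi)) ^ 2

/-- The set `R(η, ξ)` of Rabi resonances: the `n ≥ 1` such that `ξ n + η` is the square of an
integer. -/
def resonances : Set ℕ := {n | 1 ≤ n ∧ ∃ k : ℕ, M.xi * n + M.eta = (k : ℝ) ^ 2}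

/-- No Rabi resonance. -/
def IsNonResonant : Prop := M.resonances = ∅

/-- Exactly one Rabi resonance. -/
def IsSimplyResonant : Prop := ∃ n, M.resonances = {n}

/-- Infinitely many Rabi resonances. -/
def IsFullyResonant : Prop := M.resonances.Infinite

/-- A fully resonant system is degenerate if there are two different `n, m ∈ {0} ∪ R(η, ξ)` such
that `n + 1` and `m + 1` are resonances. -/
def IsDegenerate : Prop :=
  M.IsFullyResonant ∧ ∃ n m : ℕ, (n = 0 ∨ n ∈ M.resonances) ∧ m ∈ M.resonances ∧ n < m ∧
    n + 1 ∈ M.resonances ∧ m + 1 ∈ M.resonances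

open Classical in
/-- The `k`-th set `I_k`, `k = 1, 2, …`, of the partition of `ℕ` induced by the resonances
`n₁ < n₂ < ⋯`: `I_k = {n_{k-1}, …, n_k - 1}`, where `n₀ = 0` and, if there are only `k - 1`
resonances, `n_k = ∞`. It consists of the `n` such that exactly `k - 1` resonances are at
most `n`. -/
def rabiIndices (k : ℕ) : Set ℕ := {n | Nat.count (· ∈ M.resonances) (n + 1) + 1 = k}

/-- The projection `P_k` onto the `k`-th Rabi sector `ℓ²(I_k)`. -/
def rabiProj (k : ℕ) : Field →L[ℂ] Field := proj (M.rabiIndices k)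

/-- The `k`-th Rabi sector `ℓ²(I_k)`. -/
def rabiSector (k : ℕ) : Submodule ℂ Field := LinearMap.range (M.rabiProj k).toLinearMap

/-- The operator `ρ^{(k)} = exp(-β* h_S) P_k / Tr (exp(-β* h_S) P_k)`. -/
def rabiGibbs (β : ℝ) (k : ℕ) : Field →L[ℂ] Field := M.gibbs (M.betaStar β) (M.rabiIndices k)

end Maser

end OneAtomMaser

end

/-! The Jaynes–Cummings coupling conserves the number of excitations, so the propagator splits into
2×2 Rabi blocks and each of the four Kraus operators of the reduced dynamics is diagonal or a
weighted shift. Hence the entries along each diagonal `m ↦ ⟨m+d|A|m⟩` evolve among themselves, under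
a tridiagonal operator (`diagHeisenberg`). The link between the levels `n-1` and `n` carries an
amplitude proportional to `sin (π √(ξ n + η))`, which vanishes exactly at the Rabi resonances
(`exchangeAmp_eq_zero_iff`); this is why the sectors decouple. The atom has population ratio `γ =
exp(-β E₀)`, and multiplication by `γ ^ m` turns the Heisenberg coefficients into the Schrödinger
ones (`pow_mul_diagHeisenberg`). Stationary observables and invariant states are therefore governed
by the same eigenvalue problem.

On the main diagonal a stationary sequence has zero flux through every link, so it is constant on
each sector (`eq_of_sectorIndex_eq`). For `d > 0` the key is `tridiagonal_eigenvector`, a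
Perron–Frobenius argument without compactness: an eigenvector that tends to zero, for an eigenvalue
outside the open unit disk, saturates every triangle and Cauchy–Schwarz inequality. Saturation at
level `m` forces the amplitudes at `m` and `m + d` to have equal moduli, so the lower and upper ends
of a sector carrying the eigenvector are shifted by `d` into resonances again. This is impossible
inside one sector (`eq_zero_of_same_sector`). For different sectors and eigenvalue 1 it is excluded
in a non-degenerate system (`eq_zero_of_not_isDegenerate`): by arithmetic of squares if the detuning
vanishes, by comparing Rabi angles if it does not and the sector has at least two levels, and by the
definition of degeneracy if it has only one.

Convergence in mean follows by compactness. Heisenberg Cesàro means are uniformly bounded, their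
limit points along ultrafilters are stationary on every diagonal, and on a sector whose Gibbs state
exists the limit is the Gibbs expectation on the diagonal and zero off it. Weak operator convergence
passes to density matrices through their Hilbert–Schmidt square roots (`tendsto_cesaroMean`).
Invariant states solve the same equations, whence their decomposition (`hasSum_smul_rabiGibbs`), and
an ergodic state must equal any sector Gibbs state that it dominates. In a finite sector the absence
of peripheral eigenvalues, apart from the eigenvalue 1 of the constants, gives exponential decay by
Gelfand's formula. -/

noncomputable section

namespace OneAtomMaser

open Filter Topology

/-! ### Peripheral eigenvectors of tridiagonal operators and decay of matrix powers -/

/-- Eigenvectors `x → 0` of a tridiagonal operator whose columns have absolute sums at most `1`,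
for an eigenvalue outside the open unit disk: wherever `x` does not vanish, all inequalities are
equalities and all phases agree. -/
theorem tridiagonal_eigenvector {w₀ w₁ : ℝ} (h0 : 0 < w₀) (h1 : 0 < w₁) (hw : w₀ + w₁ = 1)
    {a a' k x : ℕ → ℂ} {z : ℂ} (hk : k 0 = 0) (ha : ∀ m, ‖a m‖ + ‖k m‖ ≤ 1)
    (ha' : ∀ m, ‖a' m‖ + ‖k (m + 1)‖ ≤ 1) (hx : Tendsto x atTop (𝓝 0)) (hz : 1 ≤ ‖z‖)
    (heig : ∀ m, (w₀ * a m + w₁ * a' m) * x m + w₀ * k (m + 1) * x (m + 1)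
      + w₁ * k m * x (m - 1) = z * x m) {m : ℕ} (hm : x m ≠ 0) :
    ‖a m‖ + ‖k m‖ = 1 ∧ ‖a' m‖ + ‖k (m + 1)‖ = 1 ∧ (k m ≠ 0 → x (m - 1) ≠ 0) ∧
      (k (m + 1) ≠ 0 → x (m + 1) ≠ 0) ∧ a m = ‖a m‖ * z ∧ a' m = ‖a' m‖ * z := by
  -- Across the link between `m - 1` and `m`, `c m` is the absolute mass sent down from `m` and `e
  -- m` the mass sent up from `m - 1`.
  set c : ℕ → ℝ := fun m => w₀ * ‖k m‖ * ‖x m‖ with hc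
  set e : ℕ → ℝ := fun m => w₁ * ‖k m‖ * ‖x (m - 1)‖ with he
  have hRz : ∀ m, ‖z‖ * ‖x m‖ ≤ (w₀ * ‖a m‖ + w₁ * ‖a' m‖) * ‖x m‖ + c (m + 1) + e m := by
    intro m
    rw [← norm_mul, ← heig m]
    refine (norm_add_le _ _).trans (add_le_add ((norm_add_le _ _).trans (add_le_add ?_ ?_)) ?_)
    · rw [norm_mul]
      gcongr
      refine (norm_add_le _ _).trans_eq ?_
      simp [abs_of_pos h0, abs_of_pos h1]
    · simp [hc, abs_of_pos h0]
    · simp [he, abs_of_pos h1]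
  -- `D` measures the excess over `|x m|` of the absolute sum of row `m`; `G₀` and `G₁` below are
  -- the unused parts of the two column bounds. All three are non-negative, and together they equal
  -- the increment of the net flow `c - e`.
  set D : ℕ → ℝ := fun m => (w₀ * ‖a m‖ + w₁ * ‖a' m‖) * ‖x m‖ + c (m + 1) + e m - ‖x m‖ with hD
  have hDn : ∀ m, 0 ≤ D m := fun m => by
    have := hRz m
    have := mul_le_mul_of_nonneg_right hz (norm_nonneg (x m))
    simp only [hD]; linarith
  set G₀ : ℕ → ℝ := fun m => w₀ * (1 - ‖a m‖ - ‖k m‖) * ‖x m‖ with hG₀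
  set G₁ : ℕ → ℝ := fun m => w₁ * (1 - ‖a' m‖ - ‖k (m + 1)‖) * ‖x m‖ with hG₁
  have hG₀n : ∀ m, 0 ≤ G₀ m := fun m =>
    mul_nonneg (mul_nonneg h0.le (by linarith [ha m])) (norm_nonneg _)
  have hG₁n : ∀ m, 0 ≤ G₁ m := fun m =>
    mul_nonneg (mul_nonneg h1.le (by linarith [ha' m])) (norm_nonneg _)
  have hsum : ∀ m, D m + G₀ m + G₁ m = (c (m + 1) - e (m + 1)) - (c m - e m) := by
    intro m
    simp only [hD, hG₀, hG₁, hc, he, Nat.add_sub_cancel]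
    have : w₀ * ‖x m‖ + w₁ * ‖x m‖ = ‖x m‖ := by rw [← add_mul, hw, one_mul]
    linear_combination this
  -- The net flow is increasing, starts at zero because `k 0 = 0`, and cannot exceed zero because `c
  -- → 0` while `e ≥ 0`. So it vanishes identically and all the deficits vanish with it. Only `x →
  -- 0` is needed, not summability.
  have hmono : Monotone fun m => c m - e m := monotone_nat_of_le_succ fun m => by
    have := hsum m; have := hDn m; have := hG₀n m; have := hG₁n m; linarith
  have hen : ∀ m, 0 ≤ e m := fun m => by simp only [he]; positivity
  have hclim : Tendsto c atTop (𝓝 0) := by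
    have hb : Tendsto (fun m => w₀ * ‖x m‖) atTop (𝓝 0) := by
      simpa using (hx.norm).const_mul w₀
    refine squeeze_zero (fun m => by simp only [hc]; positivity) (fun m => ?_) hb
    have : ‖k m‖ ≤ 1 := by linarith [ha m, norm_nonneg (a m)]
    simp only [hc]
    gcongr
    nlinarith
  have hle : ∀ m, c m - e m ≤ 0 := fun m => by
    refine ge_of_tendsto hclim (eventually_atTop.2 ⟨m, fun n hn => ?_⟩)
    have h := hmono hn
    have := hen n
    simp only at h
    linarith
  have hge : ∀ m, 0 ≤ c m - e m := fun m => by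
    have h := hmono (Nat.zero_le m)
    simpa [hc, he, hk] using h
  have hz0 : ∀ m, D m = 0 ∧ G₀ m = 0 ∧ G₁ m = 0 := fun m => by
    have := hsum m; have := hDn m; have := hG₀n m; have := hG₁n m
    have := hle m; have := hge m; have := hle (m + 1); have := hge (m + 1)
    refine ⟨?_, ?_, ?_⟩ <;> linarith
  have hpos : ∀ m, 0 < c (m + 1) + e m → x m ≠ 0 := by
    intro m hp h
    have := (hz0 m).1
    simp only [hD, h, norm_zero, mul_zero] at this
    linarith
  have hxm : 0 < ‖x m‖ := norm_pos_iff.2 hm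
  have hR : (w₀ * ‖a m‖ + w₁ * ‖a' m‖) * ‖x m‖ + c (m + 1) + e m = ‖z * x m‖ := by
    have e1 := (hz0 m).1
    have e2 := hRz m
    have e3 := mul_le_mul_of_nonneg_right hz (norm_nonneg (x m))
    rw [norm_mul]
    simp only [hD] at e1
    linarith
  have hzn : ‖z * x m‖ = ‖x m‖ := by rw [← hR]; have := (hz0 m).1; simp only [hD] at this; linarith
  -- Equality in the triangle inequality puts each summand of row `m` on the ray of `z * x m`, whose
  -- length is that of `x m`.
  have phase : ∀ y r : ℂ, y * x m + r = z * x m → ‖y * x m‖ + ‖r‖ ≤ ‖z * x m‖ →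
      y = ‖y‖ * z := by
    intro y r h h'
    have hs : SameRay ℝ (y * x m) r := by
      rw [sameRay_iff_norm_add]
      refine le_antisymm (norm_add_le _ _) ?_
      rwa [h]
    have hs' : SameRay ℝ (y * x m) (z * x m) := by
      rw [← h]
      exact (SameRay.refl _).add_right hs
    have := hs'.norm_smul_eq
    rw [hzn, norm_mul, Complex.real_smul, Complex.real_smul] at this
    have hc : ((‖x m‖ : ℝ) : ℂ) * x m ≠ 0 := mul_ne_zero (by exact_mod_cast hxm.ne') hm
    refine mul_right_cancel₀ hc ?_
    push_cast at this
    linear_combination -this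
  refine ⟨?_, ?_, ?_, ?_, ?_, ?_⟩
  · have := (hz0 m).2.1
    simp only [hG₀, mul_eq_zero, h0.ne', hxm.ne', or_false, false_or] at this
    linarith
  · have := (hz0 m).2.2
    simp only [hG₁, mul_eq_zero, h1.ne', hxm.ne', or_false, false_or] at this
    linarith
  · intro hkm
    obtain ⟨n, rfl⟩ : ∃ n, m = n + 1 := ⟨m - 1, by
      rcases m with _ | m
      · exact absurd hk hkm
      · rfl⟩
    refine hpos _ (add_pos_of_pos_of_nonneg ?_ (hen _))
    have := norm_pos_iff.2 hkm
    simp only [hc, Nat.add_sub_cancel]; positivity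
  · intro hkm
    refine hpos _ (add_pos_of_nonneg_of_pos (by simp only [hc]; positivity) ?_)
    have := norm_pos_iff.2 hkm
    simp only [he, Nat.add_sub_cancel]; positivity
  · have := phase (w₀ * a m) (w₁ * a' m * x m + w₀ * k (m + 1) * x (m + 1)
      + w₁ * k m * x (m - 1)) (by rw [← heig m]; ring) (by
        rw [← hR]
        have := norm_add₃_le (a := w₁ * a' m * x m) (b := w₀ * k (m + 1) * x (m + 1))
          (c := w₁ * k m * x (m - 1))
        simp only [norm_mul, Complex.norm_real, Real.norm_eq_abs, abs_of_pos h0,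
          abs_of_pos h1] at this ⊢
        simp only [hc, he]
        linarith)
    have hw0 : (w₀ : ℂ) ≠ 0 := by exact_mod_cast h0.ne'
    refine mul_left_cancel₀ hw0 (this.trans ?_)
    simp [abs_of_pos h0, mul_assoc]
  · have := phase (w₁ * a' m) (w₀ * a m * x m + w₀ * k (m + 1) * x (m + 1)
      + w₁ * k m * x (m - 1)) (by rw [← heig m]; ring) (by
        rw [← hR]
        have := norm_add₃_le (a := w₀ * a m * x m) (b := w₀ * k (m + 1) * x (m + 1))
          (c := w₁ * k m * x (m - 1))
        simp only [norm_mul, Complex.norm_real, Real.norm_eq_abs, abs_of_pos h0,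
          abs_of_pos h1] at this ⊢
        simp only [hc, he]
        linarith)
    have hw0 : (w₁ : ℂ) ≠ 0 := by exact_mod_cast h1.ne'
    refine mul_left_cancel₀ hw0 (this.trans ?_)
    simp [abs_of_pos h1, mul_assoc]

/-- Powers of an endomorphism of a finite-dimensional space all of whose eigenvalues lie in the
open unit disk decay exponentially. -/
theorem exists_norm_pow_le {V : Type} [NormedAddCommGroup V] [NormedSpace ℂ V]
    [FiniteDimensional ℂ V] (T : Module.End ℂ V)
    (hT : ∀ z : ℂ, 1 ≤ ‖z‖ → ∀ v, T v = z • v → v = 0) :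
    ∃ r : ℝ, 0 < r ∧ r < 1 ∧ ∀ v, ∃ C : ℝ, ∀ n : ℕ, ‖(T ^ n) v‖ ≤ C * r ^ n := by
  rcases subsingleton_or_nontrivial V with hV | hV
  · exact ⟨1 / 2, by norm_num, by norm_num, fun v => ⟨0, fun n => by
      simp [Subsingleton.elim ((T ^ n) v) 0]⟩⟩
  have : CompleteSpace V := FiniteDimensional.complete ℂ V
  set T' : V →L[ℂ] V := LinearMap.toContinuousLinearMap T with hT'
  have hpow : ∀ (n : ℕ) v, (T' ^ n) v = (T ^ n) v := by
    intro n
    induction n with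
    | zero => intro v; rfl
    | succ n ih => intro v; rw [pow_succ, pow_succ]; exact ih (T v)
  have hspec : ∀ z ∈ spectrum ℂ T', ‖z‖₊ < 1 := by
    intro z hz
    have hz' : z ∈ spectrum ℂ T := by
      have := AlgEquiv.spectrum_eq (Module.End.toContinuousLinearMap (𝕜 := ℂ) V) T
      rw [← this]; exact hz
    rw [← Module.End.hasEigenvalue_iff_mem_spectrum] at hz'
    obtain ⟨v, hv⟩ := hz'.exists_hasEigenvector
    by_contra hlt
    exact hv.2 (hT z (by exact_mod_cast not_lt.1 hlt) v hv.apply_eq_smul)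
  -- The spectrum consists of eigenvalues, so the spectral radius is below 1 and leaves room for a
  -- rate `r`. Gelfand's formula then bounds all large powers by `r ^ n`.
  have hrad : spectralRadius ℂ T' < (1 : NNReal) := spectrum.spectralRadius_lt_of_forall_lt T' hspec
  obtain ⟨r, hr1, hr2⟩ := ENNReal.lt_iff_exists_nnreal_btwn.1 hrad
  have hr2' : r < 1 := by exact_mod_cast hr2
  have hr0 : 0 < r := by
    rcases eq_or_ne r 0 with h | h
    · subst h; simp at hr1
    · exact pos_iff_ne_zero.2 h
  have hev := (spectrum.pow_nnnorm_pow_one_div_tendsto_nhds_spectralRadius T').eventually_lt_const hr1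
  obtain ⟨N, hN⟩ := eventually_atTop.1 hev
  -- The shift to `N + 1` ensures `n ≠ 0`, so that the `n`-th root can be undone.
  have hbd : ∀ n, N + 1 ≤ n → ‖T' ^ n‖ ≤ (r : ℝ) ^ n := by
    intro n hn
    have h := (hN n (by omega)).le
    have hn0 : (n : ℝ) ≠ 0 := by exact_mod_cast (by omega : n ≠ 0)
    have h2 := ENNReal.rpow_le_rpow h (Nat.cast_nonneg n : (0 : ℝ) ≤ n)
    rw [← ENNReal.rpow_mul, one_div, inv_mul_cancel₀ hn0, ENNReal.rpow_one,
      ENNReal.rpow_natCast] at h2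
    exact_mod_cast h2
  refine ⟨r, hr0, hr2', fun v => ?_⟩
  have hrn : ∀ n, (0 : ℝ) < (r : ℝ) ^ n := fun n => pow_pos hr0 n
  -- The sum takes care of the finitely many small exponents, the term `‖v‖` of the large ones.
  refine ⟨∑ i ∈ Finset.range (N + 1), ‖(T ^ i) v‖ / (r : ℝ) ^ i + ‖v‖, fun n => ?_⟩
  have hs : 0 ≤ ∑ i ∈ Finset.range (N + 1), ‖(T ^ i) v‖ / (r : ℝ) ^ i :=
    Finset.sum_nonneg fun i _ => div_nonneg (norm_nonneg _) (hrn i).le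
  rcases lt_or_ge n (N + 1) with h | h
  · have := Finset.single_le_sum (f := fun i => ‖(T ^ i) v‖ / (r : ℝ) ^ i)
      (fun i _ => div_nonneg (norm_nonneg _) (hrn i).le) (Finset.mem_range.2 h)
    rw [← div_le_iff₀ (hrn n)]
    have := norm_nonneg v
    linarith
  · rw [← hpow, mul_comm]
    refine ((T' ^ n).le_opNorm v).trans (mul_le_mul (hbd n h) ?_ (norm_nonneg _) (hrn n).le)
    linarith

/-! ### Hilbert-Schmidt factorizations of states -/

theorem inner_ket_left {ι : Type} [DecidableEq ι] (i : ι) (x : Ell2 ι) :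
    ⟪ket i, x⟫_ℂ = x i := by
  unfold ket
  rw [lp.inner_single_left]
  simp

theorem inner_ket_right {ι : Type} [DecidableEq ι] (i : ι) (x : Ell2 ι) :
    ⟪x, ket i⟫_ℂ = starRingEnd ℂ (x i) := by
  rw [← inner_conj_symm, inner_ket_left]

theorem ket_apply {ι : Type} [DecidableEq ι] (i j : ι) :
    (ket i : Ell2 ι) j = if j = i then 1 else 0 := by
  rw [← inner_ket_left, inner_ket]

theorem norm_ket {ι : Type} [DecidableEq ι] (i : ι) : ‖(ket i : Ell2 ι)‖ = 1 :=
  orthonormal_ket.1 i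

theorem clm_ext_ket {ι : Type} [DecidableEq ι] {F : Type} [NormedAddCommGroup F]
    [NormedSpace ℂ F] {S T : Ell2 ι →L[ℂ] F} (h : ∀ p, S (ket p) = T (ket p)) : S = T := by
  refine lp.ext_continuousLinearMap (by norm_num) (fun p => ?_)
  ext
  exact h p

theorem clm_ext_entry {S T : Field →L[ℂ] Field} (h : ∀ m n, S (ket n) m = T (ket n) m) :
    S = T :=
  clm_ext_ket fun n => by ext m; exact h m n

theorem hasSum_norm_sq {ι : Type} (x : Ell2 ι) : HasSum (fun i => ‖x i‖ ^ 2) (‖x‖ ^ 2) := by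
  have := lp.hasSum_norm (by norm_num : 0 < (2 : ENNReal).toReal) x
  simpa using this

theorem adjoint_apply_ket (T : Field →L[ℂ] Field) (m n : ℕ) :
    ContinuousLinearMap.adjoint T (ket n) m = starRingEnd ℂ (T (ket m) n) := by
  rw [← inner_ket_left, ContinuousLinearMap.adjoint_inner_right, inner_ket_right]

/-- Fubini for an absolutely summable double series; this is what makes the trace cyclic below. -/
theorem hasSum_columns {F : ℕ → ℕ → ℂ} {r c : ℕ → ℂ} (hF : Summable fun p : ℕ × ℕ => F p.1 p.2)
    (hr : ∀ m, HasSum (fun n => F m n) (r m)) (hc : ∀ n, HasSum (fun m => F m n) (c n)) :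
    Summable r ∧ HasSum c (∑' m, r m) := by
  have h1 := hF.hasSum.prod_fiberwise hr
  have h2 : HasSum (fun p : ℕ × ℕ => F p.2 p.1) (∑' p : ℕ × ℕ, F p.1 p.2) :=
    (Equiv.prodComm ℕ ℕ).hasSum_iff.2 hF.hasSum
  exact ⟨h1.summable, h1.tsum_eq ▸ h2.prod_fiberwise hc⟩

theorem summable_norm_entries_sq {x : ℕ → Field} (hx : Summable fun m => ‖x m‖ ^ 2) :
    Summable fun p : ℕ × ℕ => ‖x p.1 p.2‖ ^ 2 := by
  rw [summable_prod_of_nonneg (fun _ => by positivity)]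
  exact ⟨fun m => (hasSum_norm_sq (x m)).summable,
    hx.congr fun m => (hasSum_norm_sq (x m)).tsum_eq.symm⟩

theorem summable_conj_mul_entries {x y : ℕ → Field} (hx : Summable fun m => ‖x m‖ ^ 2)
    (hy : Summable fun m => ‖y m‖ ^ 2) :
    Summable fun p : ℕ × ℕ => starRingEnd ℂ (x p.1 p.2) * y p.1 p.2 := by
  refine Summable.of_norm_bounded
    ((summable_norm_entries_sq hx).add (summable_norm_entries_sq hy)) fun p => ?_
  rw [norm_mul, RCLike.norm_conj]
  nlinarith [sq_nonneg (‖x p.1 p.2‖ - ‖y p.1 p.2‖), sq_nonneg (‖x p.1 p.2‖ + ‖y p.1 p.2‖)]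

theorem hasSum_conj_mul (x y : Field) :
    HasSum (fun n => starRingEnd ℂ (x n) * y n) ⟪x, y⟫_ℂ := by
  simpa [mul_comm] using lp.hasSum_inner (𝕜 := ℂ) x y

/-- `Tr(T T* A) = ∑ₘ ⟨T m, A T m⟩` for a Hilbert-Schmidt operator `T`. -/
theorem hasSum_trace_mul_adjoint {T : Field →L[ℂ] Field}
    (hT : Summable fun n : ℕ => ‖T (ket n)‖ ^ 2) (A : Field →L[ℂ] Field) :
    Summable (fun m : ℕ => ⟪T (ket m), A (T (ket m))⟫_ℂ) ∧
    HasSum (fun n : ℕ => ⟪(ket n : Field), T (ContinuousLinearMap.adjoint T (A (ket n)))⟫_ℂ)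
      (∑' m : ℕ, ⟪T (ket m), A (T (ket m))⟫_ℂ) := by
  have hx : Summable fun m : ℕ => ‖ContinuousLinearMap.adjoint A (T (ket m))‖ ^ 2 := by
    refine Summable.of_nonneg_of_le (fun _ => by positivity) (fun m => ?_)
      (hT.mul_left (‖ContinuousLinearMap.adjoint A‖ ^ 2))
    rw [← mul_pow]
    exact pow_le_pow_left₀ (norm_nonneg _) (ContinuousLinearMap.le_opNorm _ _) 2
  have hF := summable_conj_mul_entries (x := fun m => ContinuousLinearMap.adjoint A (T (ket m)))
    (y := fun m => T (ket m)) hx hT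
  refine hasSum_columns (F := fun m n => starRingEnd ℂ
    (ContinuousLinearMap.adjoint A (T (ket m)) n) * T (ket m) n) hF (fun m => ?_) (fun n => ?_)
  · have := hasSum_conj_mul (ContinuousLinearMap.adjoint A (T (ket m))) (T (ket m))
    rwa [ContinuousLinearMap.adjoint_inner_left] at this
  · have h := hasSum_conj_mul (ContinuousLinearMap.adjoint T (ket n))
      (ContinuousLinearMap.adjoint T (A (ket n)))
    rw [ContinuousLinearMap.adjoint_inner_left] at h
    refine h.congr_fun fun m => ?_
    have h1 : starRingEnd ℂ (ContinuousLinearMap.adjoint T (ket n) m) = T (ket m) n := by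
      rw [adjoint_apply_ket, Complex.conj_conj]
    have h2 : starRingEnd ℂ (ContinuousLinearMap.adjoint A (T (ket m)) n)
        = ContinuousLinearMap.adjoint T (A (ket n)) m := by
      rw [← inner_ket_left m, ContinuousLinearMap.adjoint_inner_right, ← inner_ket_right,
        ContinuousLinearMap.adjoint_inner_left]
    rw [h1, mul_comm, ← h2]

theorem exists_sqrt_of_isPositive {H : Type} [NormedAddCommGroup H] [InnerProductSpace ℂ H]
    [CompleteSpace H] {ρ : H →L[ℂ] H} (h : ρ.IsPositive) :
    ∃ S : H →L[ℂ] H, ContinuousLinearMap.adjoint S = S ∧ S ∘L S = ρ := by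
  have h0 : 0 ≤ ρ := (ContinuousLinearMap.nonneg_iff_isPositive ρ).2 h
  exact ⟨CFC.sqrt ρ, IsSelfAdjoint.of_nonneg (CFC.sqrt_nonneg ρ), CFC.sqrt_mul_sqrt_self ρ h0⟩

theorem entry_self_eq_norm_sq {ρ S : Field →L[ℂ] Field} (hS : ContinuousLinearMap.adjoint S = S)
    (hSS : S ∘L S = ρ) (n : ℕ) : ρ (ket n) n = ((‖S (ket n)‖ ^ 2 : ℝ) : ℂ) := by
  rw [← inner_ket_left, ← hSS, ContinuousLinearMap.comp_apply,
    ← ContinuousLinearMap.adjoint_inner_left, hS, inner_self_eq_norm_sq_to_K]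
  simp

/-- The square root is Hilbert–Schmidt of norm one. Every trace in the proof is reduced to `∑ ⟨S m,
A S m⟩`, so no general theory of trace class operators enters. -/
theorem IsState.exists_sqrt {ρ : Field →L[ℂ] Field} (h : IsState ρ) :
    ∃ S : Field →L[ℂ] Field, ContinuousLinearMap.adjoint S = S ∧ S ∘L S = ρ ∧
      HasSum (fun n : ℕ => ‖S (ket n)‖ ^ 2) 1 := by
  obtain ⟨S, hS, hSS⟩ := exists_sqrt_of_isPositive h.1
  refine ⟨S, hS, hSS, ?_⟩
  have h2 : HasSum (fun n : ℕ => ((‖S (ket n)‖ ^ 2 : ℝ) : ℂ)) ((1 : ℝ) : ℂ) := by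
    rw [Complex.ofReal_one]
    refine h.2.congr_fun fun n => ?_
    rw [inner_ket_left, entry_self_eq_norm_sq hS hSS]
  exact Complex.hasSum_ofReal.1 h2

theorem hasSum_expect_of_sqrt {ρ S : Field →L[ℂ] Field} (hS : ContinuousLinearMap.adjoint S = S)
    (hSS : S ∘L S = ρ) (hs : Summable fun n : ℕ => ‖S (ket n)‖ ^ 2) (A : Field →L[ℂ] Field) :
    HasSum (fun m : ℕ => ⟪S (ket m), A (S (ket m))⟫_ℂ) (expect ρ A) := by
  obtain ⟨h1, h2⟩ := hasSum_trace_mul_adjoint hs A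
  have : expect ρ A = ∑' m : ℕ, ⟪S (ket m), A (S (ket m))⟫_ℂ := by
    rw [← h2.tsum_eq, hS, ← hSS]
    simp only [expect, ContinuousLinearMap.comp_apply]
  rw [this]
  exact h1.hasSum

theorem IsState.hasSum_expect {ρ : Field →L[ℂ] Field} (h : IsState ρ) (A : Field →L[ℂ] Field) :
    HasSum (fun n : ℕ => ⟪(ket n : Field), ρ (A (ket n))⟫_ℂ) (expect ρ A) := by
  obtain ⟨S, hS, hSS, hs⟩ := h.exists_sqrt
  obtain ⟨h1, h2⟩ := hasSum_trace_mul_adjoint hs.summable A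
  rw [hS, (hasSum_expect_of_sqrt hS hSS hs.summable A).tsum_eq] at h2
  refine h2.congr_fun fun n => ?_
  rw [← hSS, ContinuousLinearMap.comp_apply]

/-- The expectation functional `ρ(·)` determines `ρ`. -/
theorem eq_of_expect_eq {ρ σ : Field →L[ℂ] Field} (h : ∀ A, expect ρ A = expect σ A) :
    ρ = σ := by
  refine clm_ext_entry fun m n => ?_
  have key : ∀ X : Field →L[ℂ] Field,
      expect X (InnerProductSpace.rankOne ℂ (ket n : Field) (ket m : Field)) = X (ket n) m := by
    intro X
    unfold expect
    rw [tsum_eq_single m]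
    · rw [InnerProductSpace.rankOne_apply, inner_ket, if_pos rfl, one_smul, inner_ket_left]
    · intro k hk
      rw [InnerProductSpace.rankOne_apply, inner_ket, if_neg (Ne.symm hk), zero_smul, map_zero,
        inner_zero_right]
  rw [← key, ← key, h]

/-! ### Populations -/

/-- The population `⟨n|ρ|n⟩` of the level `n`. -/
def population (ρ : Field →L[ℂ] Field) (n : ℕ) : ℝ := (ρ (ket n) n).re

theorem IsState.entry_self {ρ : Field →L[ℂ] Field} (h : IsState ρ) (n : ℕ) :
    ρ (ket n) n = population ρ n := by
  have := h.1.inner_nonneg_right (ket n)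
  rw [inner_ket_left] at this
  exact Complex.ext rfl (by simp [(Complex.nonneg_iff.1 this).2.symm])

theorem IsState.population_nonneg {ρ : Field →L[ℂ] Field} (h : IsState ρ) (n : ℕ) :
    0 ≤ population ρ n := by
  have := h.1.inner_nonneg_right (ket n)
  rw [inner_ket_left] at this
  exact (Complex.nonneg_iff.1 this).1

theorem IsState.hasSum_population {ρ : Field →L[ℂ] Field} (h : IsState ρ) :
    HasSum (population ρ) 1 := by
  have := h.2
  simp only [inner_ket_left, h.entry_self] at this
  rw [← Complex.ofReal_one] at this
  exact Complex.hasSum_ofReal.1 this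

theorem population_eq_norm_sq {ρ S : Field →L[ℂ] Field} (hS : ContinuousLinearMap.adjoint S = S)
    (hSS : S ∘L S = ρ) (n : ℕ) : population ρ n = ‖S (ket n)‖ ^ 2 := by
  rw [population, entry_self_eq_norm_sq hS hSS, Complex.ofReal_re]

theorem IsState.entry_conj {ρ : Field →L[ℂ] Field} (h : IsState ρ) (m n : ℕ) :
    ρ (ket m) n = starRingEnd ℂ (ρ (ket n) m) := by
  rw [← adjoint_apply_ket, h.1.isSelfAdjoint.adjoint_eq]

/-- Off-diagonal entries of a state vanish at infinity along each diagonal. -/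
theorem IsState.tendsto_entry {ρ : Field →L[ℂ] Field} (h : IsState ρ) (d : ℕ) :
    Tendsto (fun m => ρ (ket (m + d)) m) atTop (𝓝 0) := by
  obtain ⟨S, hS, hSS, hs⟩ := h.exists_sqrt
  have h1 : Tendsto (fun m : ℕ => ‖S (ket m)‖) atTop (𝓝 0) := by
    have := hs.summable.tendsto_atTop_zero.sqrt
    simpa using this
  refine squeeze_zero_norm (fun m => ?_) (by simpa using h1.mul_const ‖S‖)
  -- Cauchy–Schwarz gives `|⟨m|S S|m+d⟩| ≤ ‖S|m⟩‖ ‖S‖`, and `‖S|m⟩‖ → 0` because its squares are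
  -- summable.
  rw [← inner_ket_left, ← hSS]
  change ‖⟪(ket m : Field), S (S (ket (m + d)))⟫_ℂ‖ ≤ _
  rw [← ContinuousLinearMap.adjoint_inner_left, hS]
  refine (norm_inner_le_norm _ _).trans ?_
  gcongr
  simpa [norm_ket] using S.le_opNorm (ket (m + d))

/-! ### Rabi oscillations -/

/-- The exponential of `-i (c + K)` for a real symmetric traceless `2 × 2` matrix `K`. -/
theorem exp_rabi (c δ g θ : ℝ) (hg : g ≠ 0) (hθ0 : θ ≠ 0) (hθ : θ ^ 2 = δ ^ 2 + g ^ 2) :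
    NormedSpace.exp (!![-Complex.I * (c + δ), -Complex.I * g;
      -Complex.I * g, -Complex.I * (c - δ)] : Matrix (Fin 2) (Fin 2) ℂ) =
    Complex.exp (-Complex.I * c) •
      !![Complex.cos θ - Complex.I * δ * (Complex.sin θ / θ), -Complex.I * g * (Complex.sin θ / θ);
        -Complex.I * g * (Complex.sin θ / θ),
        Complex.cos θ + Complex.I * δ * (Complex.sin θ / θ)] := by
  have hg' : (g : ℂ) ≠ 0 := by exact_mod_cast hg
  have hθ' : (θ : ℂ) ≠ 0 := by exact_mod_cast hθ0
  have hsq : (θ : ℂ) ^ 2 = (δ : ℂ) ^ 2 + (g : ℂ) ^ 2 := by exact_mod_cast hθ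
  set A : Matrix (Fin 2) (Fin 2) ℂ := !![-Complex.I * (c + δ), -Complex.I * g;
      -Complex.I * g, -Complex.I * (c - δ)] with hA
  -- The columns are eigenvectors of the matrix with rows `(δ, g)` and `(g, -δ)` for the eigenvalues
  -- `θ` and `-θ`; they are independent because `g` and `θ` are non-zero.
  set S : Matrix (Fin 2) (Fin 2) ℂ := !![(g : ℂ), g; θ - δ, -θ - δ] with hS
  set v : Fin 2 → ℂ := ![-Complex.I * (c + θ), -Complex.I * (c - θ)] with hv
  have hdet : IsUnit S.det := by
    rw [hS, Matrix.det_fin_two_of, isUnit_iff_ne_zero]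
    have : (g : ℂ) * (-θ - δ) - g * (θ - δ) = -2 * g * θ := by ring
    rw [this]
    exact mul_ne_zero (mul_ne_zero (by norm_num) hg') hθ'
  have hAS : A * S = S * Matrix.diagonal v := by
    ext i j
    fin_cases i <;> fin_cases j <;>
      simp [hA, hS, hv, Matrix.mul_apply, Fin.sum_univ_two, Matrix.diagonal]
    · ring
    · ring
    · linear_combination Complex.I * hsq
    · linear_combination Complex.I * hsq
  have hAe : A = S * Matrix.diagonal v * S⁻¹ := by
    rw [← hAS, Matrix.mul_nonsing_inv_cancel_right _ _ hdet]
  have e1 : Complex.exp (-(Complex.I * (c + θ))) =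
      Complex.exp (-(Complex.I * c)) * (Complex.cos θ - Complex.I * Complex.sin θ) := by
    rw [mul_add, neg_add, Complex.exp_add]
    congr 1
    rw [show -(Complex.I * (θ : ℂ)) = (-θ : ℂ) * Complex.I by ring, Complex.exp_mul_I]
    simp; ring
  have e2 : Complex.exp (-(Complex.I * (c - θ))) =
      Complex.exp (-(Complex.I * c)) * (Complex.cos θ + Complex.I * Complex.sin θ) := by
    rw [mul_sub, neg_sub, sub_eq_add_neg, add_comm, Complex.exp_add]
    congr 1
    rw [mul_comm Complex.I (θ : ℂ), Complex.exp_mul_I]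
    ring
  rw [hAe, Matrix.exp_conj _ _ ((Matrix.isUnit_iff_isUnit_det _).2 hdet), Matrix.exp_diagonal]
  set W : Matrix (Fin 2) (Fin 2) ℂ := Complex.exp (-Complex.I * c) •
      !![Complex.cos θ - Complex.I * δ * (Complex.sin θ / θ), -Complex.I * g * (Complex.sin θ / θ);
        -Complex.I * g * (Complex.sin θ / θ),
        Complex.cos θ + Complex.I * δ * (Complex.sin θ / θ)] with hW
  have hWS : W * S = S * Matrix.diagonal (NormedSpace.exp v) := by
    ext i j
    fin_cases i <;> fin_cases j <;>
      simp [hW, hS, hv, Matrix.mul_apply, Fin.sum_univ_two, Matrix.diagonal,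
        ← Complex.exp_eq_exp_ℂ, e1, e2] <;> field_simp
    · ring
    · ring
    · linear_combination Complex.I * Complex.sin θ * hsq
    · linear_combination Complex.I * Complex.sin θ * hsq
  rw [← hWS, Matrix.mul_nonsing_inv_cancel_right _ _ hdet]

namespace Maser

variable (M : Maser)

/-- Half the detuning phase `(E - E₀) τ / 2`. -/
def detuningPhase : ℝ := (M.E - M.E₀) * M.τ / 2

/-- The Rabi angle `π √(ξ n + η)` of the transition between `|n⟩ ⊗ |0⟩` and `|n-1⟩ ⊗ |1⟩`. -/
def rabiAngle (n : ℕ) : ℝ := Real.pi * √(M.xi * n + M.eta)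

/-- The amplitude of `|n⟩ ⊗ |0⟩ → |n⟩ ⊗ |0⟩`. -/
def groundAmp : ℕ → ℂ
  | 0 => 1
  | n + 1 => M.propagatorBlock M.τ n 0 0

/-- The amplitude of `|n⟩ ⊗ |0⟩ → |n-1⟩ ⊗ |1⟩`. -/
def exchangeAmp : ℕ → ℂ
  | 0 => 0
  | n + 1 => M.propagatorBlock M.τ n 0 1

/-- The amplitude of `|n⟩ ⊗ |1⟩ → |n⟩ ⊗ |1⟩`. -/
def excitedAmp (n : ℕ) : ℂ := M.propagatorBlock M.τ n 1 1

variable {M}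

theorem xi_pos (hc : M.coupling ≠ 0) (hτ : 0 < M.τ) : 0 < M.xi := by
  have : M.coupling * M.τ / (2 * Real.pi) ≠ 0 :=
    div_ne_zero (mul_ne_zero hc hτ.ne') (by positivity)
  unfold xi; positivity

theorem eta_nonneg : 0 ≤ M.eta := sq_nonneg _

theorem rabiAngle_sq (hc : M.coupling ≠ 0) (hτ : 0 < M.τ) (n : ℕ) :
    M.rabiAngle n ^ 2 = Real.pi ^ 2 * (M.xi * n + M.eta) := by
  have := M.eta_nonneg
  have := xi_pos hc hτ
  rw [rabiAngle, mul_pow, Real.sq_sqrt (by positivity)]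

theorem eta_eq : Real.pi ^ 2 * M.eta = M.detuningPhase ^ 2 := by
  have := Real.pi_ne_zero
  unfold eta detuningPhase
  field_simp

theorem rabiAngle_pos (hc : M.coupling ≠ 0) (hτ : 0 < M.τ) (n : ℕ) : 0 < M.rabiAngle (n + 1) := by
  have := M.eta_nonneg
  have := xi_pos hc hτ
  unfold rabiAngle
  positivity

/-- The trace part of the block only contributes a phase `u`. The traceless part has half detuning
`δ` and coupling `g` with `θ ^ 2 = δ ^ 2 + g ^ 2`, which is the Rabi formula. The phase depends on
the level, so later comparisons of blocks pass to norms. -/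
theorem propagatorBlock_eq (hc : M.coupling ≠ 0) (hτ : 0 < M.τ) (n : ℕ) :
    ∃ u : ℂ, ‖u‖ = 1 ∧ ∃ g : ℝ, g ≠ 0 ∧ M.propagatorBlock M.τ n = u •
      !![Complex.cos (M.rabiAngle (n + 1)) - Complex.I * M.detuningPhase *
          (Complex.sin (M.rabiAngle (n + 1)) / M.rabiAngle (n + 1)),
        -Complex.I * g * (Complex.sin (M.rabiAngle (n + 1)) / M.rabiAngle (n + 1));
        -Complex.I * g * (Complex.sin (M.rabiAngle (n + 1)) / M.rabiAngle (n + 1)),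
        Complex.cos (M.rabiAngle (n + 1)) + Complex.I * M.detuningPhase *
          (Complex.sin (M.rabiAngle (n + 1)) / M.rabiAngle (n + 1))] := by
  set g : ℝ := M.τ * (M.coupling / 2 * √((n : ℝ) + 1)) with hg
  set c : ℝ := M.τ * (M.E * n + (M.E + M.E₀) / 2) with hcc
  have hg0 : g ≠ 0 := by
    have : √((n : ℝ) + 1) ≠ 0 := by positivity
    exact mul_ne_zero hτ.ne' (mul_ne_zero (div_ne_zero hc two_ne_zero) this)
  have hθ : M.rabiAngle (n + 1) ^ 2 = M.detuningPhase ^ 2 + g ^ 2 := by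
    have h1 : √((n : ℝ) + 1) ^ 2 = n + 1 := Real.sq_sqrt (by positivity)
    have h2 : g ^ 2 = M.τ ^ 2 * (M.coupling ^ 2 / 4 * (n + 1)) := by
      rw [hg, mul_pow, mul_pow, h1]; ring
    have h3 : Real.pi ^ 2 * M.xi = M.τ ^ 2 * M.coupling ^ 2 / 4 := by
      have := Real.pi_ne_zero
      unfold xi
      field_simp
      ring
    rw [rabiAngle_sq hc hτ, mul_add, eta_eq, h2, ← mul_assoc, h3]
    push_cast
    ring
  refine ⟨Complex.exp (-Complex.I * c), ?_, g, hg0, ?_⟩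
  · rw [show -Complex.I * (c : ℂ) = ((-c : ℝ) : ℂ) * Complex.I by push_cast; ring]
    exact Complex.norm_exp_ofReal_mul_I _
  · rw [← exp_rabi c M.detuningPhase g _ hg0 (rabiAngle_pos hc hτ n).ne' hθ, propagatorBlock]
    congr 1
    ext i j
    fin_cases i <;> fin_cases j <;>
      simp [generatorBlock, block, hg, hcc, detuningPhase] <;> ring

/-- Emission and absorption have the same amplitude, so a single function `exchangeAmp` serves for
both directions of a link. -/
theorem propagatorBlock_symm (hc : M.coupling ≠ 0) (hτ : 0 < M.τ) (n : ℕ) :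
    M.propagatorBlock M.τ n 1 0 = M.propagatorBlock M.τ n 0 1 := by
  obtain ⟨u, -, g, -, h⟩ := propagatorBlock_eq hc hτ n
  rw [h]
  simp

theorem norm_sq_groundAmp_add (hc : M.coupling ≠ 0) (hτ : 0 < M.τ) (n : ℕ) :
    ‖M.groundAmp n‖ ^ 2 + ‖M.exchangeAmp n‖ ^ 2 = 1 := by
  cases n with
  | zero => simp [groundAmp, exchangeAmp]
  | succ n =>
    have := congrFun (congrFun (M.propagatorBlock_unitary M.τ n) 0) 0
    simp only [Matrix.mul_apply, Fin.sum_univ_two, Matrix.conjTranspose_apply,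
      Matrix.one_apply_eq, propagatorBlock_symm hc hτ, RCLike.star_def, Complex.conj_mul'] at this
    exact_mod_cast this

theorem norm_sq_excitedAmp_add (n : ℕ) :
    ‖M.excitedAmp n‖ ^ 2 + ‖M.exchangeAmp (n + 1)‖ ^ 2 = 1 := by
  have := congrFun (congrFun (M.propagatorBlock_unitary M.τ n) 1) 1
  simp only [Matrix.mul_apply, Fin.sum_univ_two, Matrix.conjTranspose_apply,
    Matrix.one_apply_eq, RCLike.star_def, Complex.conj_mul'] at this
  rw [add_comm]
  exact_mod_cast this

theorem sin_rabiAngle_eq_zero_iff (hc : M.coupling ≠ 0) (hτ : 0 < M.τ) (n : ℕ) :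
    Real.sin (M.rabiAngle (n + 1)) = 0 ↔ n + 1 ∈ M.resonances := by
  have h0 := M.eta_nonneg
  have h1 := xi_pos hc hτ
  have h2 : 0 ≤ M.xi * (n + 1 : ℕ) + M.eta := by positivity
  rw [Real.sin_eq_zero_iff]
  constructor
  · rintro ⟨k, hk⟩
    refine ⟨by omega, k.toNat, ?_⟩
    have h3 : (k : ℝ) = √(M.xi * (n + 1 : ℕ) + M.eta) := by
      rw [rabiAngle, mul_comm] at hk
      exact mul_left_cancel₀ Real.pi_ne_zero hk
    have hk0 : 0 ≤ k := by
      have : (0 : ℝ) ≤ k := h3 ▸ Real.sqrt_nonneg _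
      exact_mod_cast this
    have h4 : ((k.toNat : ℕ) : ℝ) = k := by exact_mod_cast Int.toNat_of_nonneg hk0
    rw [h4, h3, Real.sq_sqrt h2]
  · rintro ⟨-, k, hk⟩
    refine ⟨k, ?_⟩
    rw [rabiAngle, hk, Real.sqrt_sq (by positivity), mul_comm]
    simp

/-- The exchange amplitude is a non-zero multiple of `sin θ`, and the Rabi angle `π √(ξ n + η)` is a
multiple of `π` exactly when `ξ n + η` is a square of an integer. The level 0 is a broken link as
well, since the ground state emits nothing. -/
theorem exchangeAmp_eq_zero_iff (hc : M.coupling ≠ 0) (hτ : 0 < M.τ) (n : ℕ) :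
    M.exchangeAmp n = 0 ↔ n = 0 ∨ n ∈ M.resonances := by
  cases n with
  | zero => simp [exchangeAmp]
  | succ n =>
    obtain ⟨u, hu, g, hg, h⟩ := propagatorBlock_eq hc hτ n
    have hu0 : u ≠ 0 := by rintro rfl; simp at hu
    have hg' : (g : ℂ) ≠ 0 := by exact_mod_cast hg
    have hθ : ((M.rabiAngle (n + 1) : ℝ) : ℂ) ≠ 0 := by
      exact_mod_cast (rabiAngle_pos hc hτ n).ne'
    rw [← sin_rabiAngle_eq_zero_iff hc hτ]
    simp only [exchangeAmp, h]
    simp [hu0, hg', hθ, ← Complex.ofReal_sin]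

/-- Two Rabi transitions off resonance with equal amplitudes coincide, unless the detuning
vanishes. -/
theorem eq_of_amp_eq (hc : M.coupling ≠ 0) (hτ : 0 < M.τ) (hη : M.eta ≠ 0) {m n : ℕ}
    (hm : m + 1 ∉ M.resonances) (h0 : M.groundAmp (m + 1) = M.groundAmp (n + 1))
    (h1 : M.excitedAmp m = M.excitedAmp n) : m = n := by
  obtain ⟨u, hu, g, -, h⟩ := propagatorBlock_eq hc hτ m
  obtain ⟨u', hu', g', -, h'⟩ := propagatorBlock_eq hc hτ n
  set θ := M.rabiAngle (m + 1) with hθ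
  set θ' := M.rabiAngle (n + 1) with hθ'
  have hs : Real.sin θ ≠ 0 := fun h => hm ((sin_rabiAngle_eq_zero_iff hc hτ m).1 h)
  have hp := rabiAngle_pos hc hτ m
  have hp' := rabiAngle_pos hc hτ n
  rw [← hθ] at hp
  rw [← hθ'] at hp'
  simp only [groundAmp, excitedAmp, h, h', Matrix.smul_apply, Matrix.of_apply, Matrix.cons_val',
    Matrix.cons_val_zero, Matrix.cons_val_one, Matrix.cons_val_fin_one, smul_eq_mul] at h0 h1
  have hδ : M.detuningPhase ≠ 0 := by
    intro h
    have := M.eta_eq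
    rw [h] at this
    have := Real.pi_ne_zero
    simp_all
  -- The sum of the two amplitudes isolates `u cos θ`, their difference isolates `u δ sin θ / θ`;
  -- taking norms removes the unknown phases. With non-zero detuning both survive, and `sin θ ≠ 0`
  -- then yields `θ ^ 2 = θ' ^ 2`.
  have hcos : Real.cos θ ^ 2 = Real.cos θ' ^ 2 := by
    have : u * Complex.cos θ = u' * Complex.cos θ' := by linear_combination (h0 + h1) / 2
    have := congrArg norm this
    rw [norm_mul, norm_mul, hu, hu', ← Complex.ofReal_cos, ← Complex.ofReal_cos,
      Complex.norm_real, Complex.norm_real, one_mul, one_mul] at this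
    rw [← sq_abs, ← sq_abs (Real.cos θ')]
    exact congrArg (· ^ 2) this
  have hsin : (Real.sin θ / θ) ^ 2 = (Real.sin θ' / θ') ^ 2 := by
    have hIδ : Complex.I * M.detuningPhase ≠ 0 :=
      mul_ne_zero Complex.I_ne_zero (by exact_mod_cast hδ)
    have : u * (Complex.sin θ / θ) = u' * (Complex.sin θ' / θ') := by
      refine mul_left_cancel₀ hIδ ?_
      linear_combination (h1 - h0) / 2
    have := congrArg norm this
    rw [norm_mul, norm_mul, hu, hu', ← Complex.ofReal_sin, ← Complex.ofReal_sin,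
      ← Complex.ofReal_div, ← Complex.ofReal_div,
      Complex.norm_real, Complex.norm_real, one_mul, one_mul] at this
    rw [← sq_abs, ← sq_abs (Real.sin θ' / θ')]
    exact congrArg (· ^ 2) this
  have hss : Real.sin θ' ^ 2 = Real.sin θ ^ 2 := by rw [Real.sin_sq, Real.sin_sq, hcos]
  rw [div_pow, div_pow, hss, div_eq_div_iff (by positivity) (by positivity)] at hsin
  have hsq := mul_left_cancel₀ (pow_ne_zero 2 hs) hsin
  rw [hθ, hθ', rabiAngle_sq hc hτ, rabiAngle_sq hc hτ] at hsq
  have := xi_pos hc hτ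
  have h3 := mul_left_cancel₀ (pow_ne_zero 2 Real.pi_ne_zero) hsq
  have h4 := mul_left_cancel₀ this.ne' (add_right_cancel h3)
  have : n + 1 = m + 1 := by exact_mod_cast h4
  omega

end Maser

/-! ### Kraus form of the reduced dynamics -/

theorem tensorKet_ket (σ : Fin 2) (n : ℕ) : tensorKet σ (ket n) = ket (n, σ) :=
  isometryOf_ket _ (orthonormal_ket.comp _ (fun _ _ h => congrArg Prod.fst h)) n

theorem adjoint_tensorKet_ket (σ σ' : Fin 2) (n : ℕ) :
    ContinuousLinearMap.adjoint (tensorKet σ') (ket (n, σ)) = if σ = σ' then ket n else 0 := by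
  ext m
  rw [← inner_ket_left, ContinuousLinearMap.adjoint_inner_right, tensorKet_ket, inner_ket]
  by_cases h : σ = σ'
  · subst h; simp [ket_apply]
  · simp [h, Ne.symm h]

namespace Maser

variable {M : Maser}

variable (M) in
/-- The Kraus operators `⟨σ'| exp(-i τ h) |σ⟩`. -/
def kraus (σ' σ : Fin 2) : Field →L[ℂ] Field :=
  ContinuousLinearMap.adjoint (tensorKet σ') ∘L M.propagator M.τ ∘L tensorKet σ

theorem kraus_apply_ket (σ' σ : Fin 2) (n : ℕ) : M.kraus σ' σ (ket n) =
    ContinuousLinearMap.adjoint (tensorKet σ') (M.evolvedKet M.τ (n, σ)) := by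
  simp only [kraus, ContinuousLinearMap.comp_apply, tensorKet_ket, propagator_ket]

theorem kraus_ground_ground (n : ℕ) : M.kraus 0 0 (ket n) = M.groundAmp n • ket n := by
  rw [kraus_apply_ket]
  cases n with
  | zero => simp [evolvedKet_zero_ground, adjoint_tensorKet_ket, groundAmp]
  | succ n => simp [evolvedKet_ground, adjoint_tensorKet_ket, groundAmp]

theorem kraus_excited_excited (n : ℕ) : M.kraus 1 1 (ket n) = M.excitedAmp n • ket n := by
  rw [kraus_apply_ket]
  simp [evolvedKet_excited, adjoint_tensorKet_ket, excitedAmp]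

theorem kraus_ground_excited (n : ℕ) :
    M.kraus 0 1 (ket n) = M.exchangeAmp (n + 1) • ket (n + 1) := by
  rw [kraus_apply_ket]
  simp [evolvedKet_excited, adjoint_tensorKet_ket, exchangeAmp]

theorem kraus_excited_ground (hc : M.coupling ≠ 0) (hτ : 0 < M.τ) (n : ℕ) :
    M.kraus 1 0 (ket n) = M.exchangeAmp n • ket (n - 1) := by
  rw [kraus_apply_ket]
  cases n with
  | zero => simp [evolvedKet_zero_ground, adjoint_tensorKet_ket, exchangeAmp]
  | succ n => simp [evolvedKet_ground, adjoint_tensorKet_ket, exchangeAmp,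
      propagatorBlock_symm hc hτ]

variable (M) in
/-- The ratio `exp(-β E₀)` of the populations of the atom. -/
def atomRatio (β : ℝ) : ℝ := Real.exp (-β * M.E₀)

variable (M) in
/-- The populations of the atom in its thermal state. -/
def atomPopulation (β : ℝ) (σ : Fin 2) : ℝ := M.atomRatio β ^ (σ : ℕ) / (1 + M.atomRatio β)

theorem atomRatio_pos (β : ℝ) : 0 < M.atomRatio β := Real.exp_pos _

theorem atomPopulation_pos (β : ℝ) (σ : Fin 2) : 0 < M.atomPopulation β σ := by
  have := M.atomRatio_pos β
  unfold atomPopulation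
  positivity

theorem atomPopulation_sum (β : ℝ) : M.atomPopulation β 0 + M.atomPopulation β 1 = 1 := by
  have := M.atomRatio_pos β
  simp only [atomPopulation, Fin.val_zero, Fin.val_one, pow_zero, pow_one]
  field_simp

theorem atomPopulation_one (β : ℝ) :
    M.atomPopulation β 1 = M.atomPopulation β 0 * M.atomRatio β := by
  simp only [atomPopulation, Fin.val_zero, Fin.val_one, pow_zero, pow_one]
  ring

theorem atomGibbs_eq (β : ℝ) :
    M.atomGibbs β = Matrix.diagonal fun σ => (M.atomPopulation β σ : ℂ) := by
  have h : -(β : ℂ) • M.atomHamiltonian = Matrix.diagonal ![0, ((-β * M.E₀ : ℝ) : ℂ)] := by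
    ext i j
    fin_cases i <;> fin_cases j <;>
      simp [atomHamiltonian, raise, lower, Matrix.diagonal]
  have he : NormedSpace.exp (-(β : ℂ) • M.atomHamiltonian)
      = Matrix.diagonal ![1, (M.atomRatio β : ℂ)] := by
    rw [h, Matrix.exp_diagonal]
    congr 1
    ext i
    fin_cases i <;> simp [← Complex.exp_eq_exp_ℂ, atomRatio]
  rw [atomGibbs, he, Matrix.trace_diagonal]
  ext i j
  fin_cases i <;> fin_cases j <;>
    simp [Matrix.diagonal, atomPopulation, Fin.sum_univ_two, div_eq_inv_mul]

/-- The thermal state of the atom is diagonal, so only its two populations survive and the dynamics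
is a mixture of four Kraus terms. -/
theorem rdm_eq (β : ℝ) (ρ : Field →L[ℂ] Field) : M.rdm β ρ =
    ∑ σ, ∑ σ', (M.atomPopulation β σ : ℂ) •
      (M.kraus σ' σ ∘L ρ ∘L ContinuousLinearMap.adjoint (M.kraus σ' σ)) := by
  ext x : 1
  simp only [rdm, partialTrace, tensorOp, atomGibbs_eq, kraus, ContinuousLinearMap.adjoint_comp,
    ContinuousLinearMap.adjoint_adjoint, Fin.sum_univ_two, Matrix.diagonal_apply_eq,
    Matrix.diagonal_apply_ne _ (zero_ne_one : (0 : Fin 2) ≠ 1),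
    Matrix.diagonal_apply_ne _ (one_ne_zero : (1 : Fin 2) ≠ 0), zero_smul, add_zero, zero_add,
    ContinuousLinearMap.comp_apply, _root_.add_apply, _root_.smul_apply, map_add, map_smul]
  abel

/-! ### Heisenberg picture and evolution of matrix entries -/

variable (M) in
/-- The reduced dynamics in the Heisenberg picture. -/
def heisenberg (β : ℝ) (A : Field →L[ℂ] Field) : Field →L[ℂ] Field :=
  ∑ σ, ∑ σ', (M.atomPopulation β σ : ℂ) •
    (ContinuousLinearMap.adjoint (M.kraus σ' σ) ∘L A ∘L M.kraus σ' σ)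

theorem adjoint_kraus_ground_ground (n : ℕ) :
    ContinuousLinearMap.adjoint (M.kraus 0 0) (ket n) = starRingEnd ℂ (M.groundAmp n) • ket n := by
  ext m
  rw [adjoint_apply_ket, kraus_ground_ground]
  by_cases h : n = m
  · subst h; simp [ket_apply]
  · simp [ket_apply, h, Ne.symm h]

theorem adjoint_kraus_excited_excited (n : ℕ) :
    ContinuousLinearMap.adjoint (M.kraus 1 1) (ket n)
      = starRingEnd ℂ (M.excitedAmp n) • ket n := by
  ext m
  rw [adjoint_apply_ket, kraus_excited_excited]
  by_cases h : n = m
  · subst h; simp [ket_apply]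
  · simp [ket_apply, h, Ne.symm h]

theorem adjoint_kraus_ground_excited (n : ℕ) :
    ContinuousLinearMap.adjoint (M.kraus 0 1) (ket n)
      = starRingEnd ℂ (M.exchangeAmp n) • ket (n - 1) := by
  ext m
  rw [adjoint_apply_ket, kraus_ground_excited]
  rcases n with _ | n
  · simp [ket_apply, exchangeAmp]
  · by_cases h : n = m
    · subst h; simp [ket_apply]
    · simp [ket_apply, h, Ne.symm h]

theorem adjoint_kraus_excited_ground (hc : M.coupling ≠ 0) (hτ : 0 < M.τ) (n : ℕ) :
    ContinuousLinearMap.adjoint (M.kraus 1 0) (ket n)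
      = starRingEnd ℂ (M.exchangeAmp (n + 1)) • ket (n + 1) := by
  ext m
  rw [adjoint_apply_ket, kraus_excited_ground hc hτ]
  rcases m with _ | m
  · simp [ket_apply, exchangeAmp]
  · by_cases h : n = m
    · subst h; simp [ket_apply]
    · simp [ket_apply, h, Ne.symm h]

theorem rdm_entry (hc : M.coupling ≠ 0) (hτ : 0 < M.τ) (β : ℝ) (ρ : Field →L[ℂ] Field)
    (m n : ℕ) : M.rdm β ρ (ket n) m =
    (M.atomPopulation β 0 * (M.groundAmp m * starRingEnd ℂ (M.groundAmp n)) +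
      M.atomPopulation β 1 * (M.excitedAmp m * starRingEnd ℂ (M.excitedAmp n))) * ρ (ket n) m +
    M.atomPopulation β 0 * (M.exchangeAmp (m + 1) * starRingEnd ℂ (M.exchangeAmp (n + 1))) *
      ρ (ket (n + 1)) (m + 1) +
    M.atomPopulation β 1 * (M.exchangeAmp m * starRingEnd ℂ (M.exchangeAmp n)) *
      ρ (ket (n - 1)) (m - 1) := by
  rw [← inner_ket_left, rdm_eq]
  simp only [Fin.sum_univ_two, _root_.add_apply, _root_.smul_apply,
    ContinuousLinearMap.comp_apply, inner_add_right, inner_smul_right]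
  simp only [← ContinuousLinearMap.adjoint_inner_left (M.kraus _ _)]
  simp only [adjoint_kraus_ground_ground, adjoint_kraus_excited_excited,
    adjoint_kraus_ground_excited, adjoint_kraus_excited_ground hc hτ, map_smul, inner_smul_left,
    inner_smul_right, inner_ket_left, Complex.conj_conj]
  ring

theorem heisenberg_entry (hc : M.coupling ≠ 0) (hτ : 0 < M.τ) (β : ℝ) (A : Field →L[ℂ] Field)
    (m n : ℕ) : M.heisenberg β A (ket m) n =
    (M.atomPopulation β 0 * (M.groundAmp m * starRingEnd ℂ (M.groundAmp n)) +
      M.atomPopulation β 1 * (M.excitedAmp m * starRingEnd ℂ (M.excitedAmp n))) * A (ket m) n +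
    M.atomPopulation β 0 * (M.exchangeAmp m * starRingEnd ℂ (M.exchangeAmp n)) *
      A (ket (m - 1)) (n - 1) +
    M.atomPopulation β 1 * (M.exchangeAmp (m + 1) * starRingEnd ℂ (M.exchangeAmp (n + 1))) *
      A (ket (m + 1)) (n + 1) := by
  rw [← inner_ket_left, heisenberg]
  simp only [Fin.sum_univ_two, _root_.add_apply, _root_.smul_apply,
    ContinuousLinearMap.comp_apply, inner_add_right, inner_smul_right]
  simp only [ContinuousLinearMap.adjoint_inner_right]
  simp only [kraus_ground_ground, kraus_excited_excited,
    kraus_ground_excited, kraus_excited_ground hc hτ, map_smul, inner_smul_left,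
    inner_smul_right, inner_ket_left]
  ring

/-- Thanks to this symmetry only the diagonals `⟨m+d|A|m⟩` with `d ≥ 0` have to be studied. -/
theorem heisenberg_adjoint (hc : M.coupling ≠ 0) (hτ : 0 < M.τ) (β : ℝ) (A : Field →L[ℂ] Field) :
    M.heisenberg β (ContinuousLinearMap.adjoint A)
      = ContinuousLinearMap.adjoint (M.heisenberg β A) := by
  refine clm_ext_entry fun n m => ?_
  rw [heisenberg_entry hc hτ, adjoint_apply_ket (M.heisenberg β A), heisenberg_entry hc hτ]
  simp only [adjoint_apply_ket, map_add, map_mul, Complex.conj_ofReal, Complex.conj_conj]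
  ring

theorem mul_conj_add_mul_conj (hc : M.coupling ≠ 0) (hτ : 0 < M.τ) (n : ℕ) :
    M.groundAmp n * starRingEnd ℂ (M.groundAmp n)
      + M.exchangeAmp n * starRingEnd ℂ (M.exchangeAmp n) = 1 := by
  rw [Complex.mul_conj', Complex.mul_conj']
  exact_mod_cast norm_sq_groundAmp_add hc hτ n

theorem mul_conj_add_mul_conj' (n : ℕ) :
    M.excitedAmp n * starRingEnd ℂ (M.excitedAmp n)
      + M.exchangeAmp (n + 1) * starRingEnd ℂ (M.exchangeAmp (n + 1)) = 1 := by
  rw [Complex.mul_conj', Complex.mul_conj']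
  exact_mod_cast M.norm_sq_excitedAmp_add n

theorem heisenberg_one (hc : M.coupling ≠ 0) (hτ : 0 < M.τ) (β : ℝ) : M.heisenberg β 1 = 1 := by
  refine clm_ext_entry fun n m => ?_
  rw [heisenberg_entry hc hτ]
  simp only [one_apply_eq_self, ket_apply]
  by_cases h : n = m
  · subst h
    have h3 : (M.atomPopulation β 0 : ℂ) + M.atomPopulation β 1 = 1 := by
      exact_mod_cast M.atomPopulation_sum β
    simp only [if_true]
    linear_combination (M.atomPopulation β 0 : ℂ) * mul_conj_add_mul_conj hc hτ n
      + (M.atomPopulation β 1 : ℂ) * M.mul_conj_add_mul_conj' n + h3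
  · rcases m with _ | m
    · simp [h, exchangeAmp]
    · rcases n with _ | n
      · simp [exchangeAmp]
      · have h' : ¬ n = m := fun h' => h (by rw [h'])
        simp [h']

/-- With `T = K S` and `ρ = S S` one has `K ρ K* = T T*`, so cyclicity of the trace is the
Hilbert–Schmidt identity `hasSum_trace_mul_adjoint`. -/
theorem hasSum_expect_kraus {ρ : Field →L[ℂ] Field} (h : IsState ρ) (K A : Field →L[ℂ] Field) :
    HasSum (fun n : ℕ => ⟪(ket n : Field), (K ∘L ρ ∘L ContinuousLinearMap.adjoint K) (A (ket n))⟫_ℂ)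
      (expect ρ (ContinuousLinearMap.adjoint K ∘L A ∘L K)) := by
  obtain ⟨S, hS, hSS, hs⟩ := h.exists_sqrt
  have hT : Summable fun n : ℕ => ‖(K ∘L S) (ket n)‖ ^ 2 := by
    refine Summable.of_nonneg_of_le (fun _ => by positivity) (fun m => ?_)
      (hs.summable.mul_left (‖K‖ ^ 2))
    rw [← mul_pow]
    exact pow_le_pow_left₀ (norm_nonneg _) (K.le_opNorm _) 2
  have h1 := (hasSum_trace_mul_adjoint hT A).2
  have h2 := (hasSum_expect_of_sqrt hS hSS hs.summable
    (ContinuousLinearMap.adjoint K ∘L A ∘L K)).tsum_eq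
  simp only [ContinuousLinearMap.comp_apply, ContinuousLinearMap.adjoint_inner_right] at h2
  simp only [ContinuousLinearMap.comp_apply] at h1
  rw [h2] at h1
  refine h1.congr_fun fun n => ?_
  simp only [ContinuousLinearMap.comp_apply, ContinuousLinearMap.adjoint_comp, hS, ← hSS]

theorem hasSum_expect_rdm {ρ : Field →L[ℂ] Field} (h : IsState ρ) (β : ℝ)
    (A : Field →L[ℂ] Field) :
    HasSum (fun n : ℕ => ⟪(ket n : Field), M.rdm β ρ (A (ket n))⟫_ℂ)
      (expect ρ (M.heisenberg β A)) := by
  have h1 : HasSum (fun n : ℕ => ∑ σ, ∑ σ', (M.atomPopulation β σ : ℂ) *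
      ⟪(ket n : Field), (M.kraus σ' σ ∘L ρ ∘L ContinuousLinearMap.adjoint (M.kraus σ' σ))
        (A (ket n))⟫_ℂ) (∑ σ, ∑ σ', (M.atomPopulation β σ : ℂ) *
      expect ρ (ContinuousLinearMap.adjoint (M.kraus σ' σ) ∘L A ∘L M.kraus σ' σ)) :=
    hasSum_sum fun σ _ => hasSum_sum fun σ' _ => (hasSum_expect_kraus h _ A).mul_left _
  have h2 : HasSum (fun n : ℕ => ∑ σ, ∑ σ', (M.atomPopulation β σ : ℂ) *
      ⟪(ket n : Field), ρ ((ContinuousLinearMap.adjoint (M.kraus σ' σ) ∘L A ∘L M.kraus σ' σ)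
        (ket n))⟫_ℂ) (∑ σ, ∑ σ', (M.atomPopulation β σ : ℂ) *
      expect ρ (ContinuousLinearMap.adjoint (M.kraus σ' σ) ∘L A ∘L M.kraus σ' σ)) :=
    hasSum_sum fun σ _ => hasSum_sum fun σ' _ => (h.hasSum_expect _).mul_left _
  have h3 : expect ρ (M.heisenberg β A) = ∑ σ, ∑ σ', (M.atomPopulation β σ : ℂ) *
      expect ρ (ContinuousLinearMap.adjoint (M.kraus σ' σ) ∘L A ∘L M.kraus σ' σ) := by
    rw [← h2.tsum_eq, expect]
    refine tsum_congr fun n => ?_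
    simp only [heisenberg, Fin.sum_univ_two, _root_.add_apply, _root_.smul_apply, map_add,
      map_smul, inner_add_right, inner_smul_right]
  rw [h3]
  refine h1.congr_fun fun n => ?_
  simp only [rdm_eq, Fin.sum_univ_two, _root_.add_apply, _root_.smul_apply,
      inner_add_right, inner_smul_right]

theorem expect_rdm {ρ : Field →L[ℂ] Field} (h : IsState ρ) (β : ℝ) (A : Field →L[ℂ] Field) :
    expect (M.rdm β ρ) A = expect ρ (M.heisenberg β A) :=
  (hasSum_expect_rdm h β A).tsum_eq

theorem expect_one {ρ : Field →L[ℂ] Field} (h : IsState ρ) : expect ρ 1 = 1 := h.2.tsum_eq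

theorem isState_rdm (hc : M.coupling ≠ 0) (hτ : 0 < M.τ) (β : ℝ) {ρ : Field →L[ℂ] Field}
    (h : IsState ρ) : IsState (M.rdm β ρ) := by
  constructor
  · rw [rdm_eq]
    have h1 : ∀ σ σ', ((M.atomPopulation β σ : ℂ) • (M.kraus σ' σ ∘L ρ ∘L
        ContinuousLinearMap.adjoint (M.kraus σ' σ))).IsPositive := fun σ σ' =>
      (h.1.conj_adjoint _).smul_of_nonneg (by exact_mod_cast (M.atomPopulation_pos β σ).le)
    simp only [Fin.sum_univ_two]
    exact ((h1 _ _).add (h1 _ _)).add ((h1 _ _).add (h1 _ _))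
  · have := hasSum_expect_rdm (M := M) h β 1
    rw [heisenberg_one hc hτ, expect_one h] at this
    exact this

theorem isState_rdm_iterate (hc : M.coupling ≠ 0) (hτ : 0 < M.τ) (β : ℝ) {ρ : Field →L[ℂ] Field}
    (h : IsState ρ) (n : ℕ) : IsState ((M.rdm β)^[n] ρ) := by
  induction n with
  | zero => exact h
  | succ n ih => rw [Function.iterate_succ_apply']; exact isState_rdm hc hτ β ih

theorem expect_rdm_iterate (hc : M.coupling ≠ 0) (hτ : 0 < M.τ) (β : ℝ)
    {ρ : Field →L[ℂ] Field} (h : IsState ρ) (n : ℕ) (A : Field →L[ℂ] Field) :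
    expect ((M.rdm β)^[n] ρ) A = expect ρ ((M.heisenberg β)^[n] A) := by
  induction n generalizing A with
  | zero => rfl
  | succ n ih =>
    rw [Function.iterate_succ_apply', expect_rdm (isState_rdm_iterate hc hτ β h n), ih,
      ← Function.iterate_succ_apply]

/-! ### Rabi sectors -/

variable (M) in
open Classical in
/-- The number of resonances that are at most `n`, which labels the Rabi sector of `n`. -/
def sectorIndex (n : ℕ) : ℕ := Nat.count (· ∈ M.resonances) (n + 1)

theorem mem_rabiIndices {n k : ℕ} : n ∈ M.rabiIndices k ↔ M.sectorIndex n + 1 = k := Iff.rfl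

theorem zero_notMem_resonances : 0 ∉ M.resonances := fun h => by simpa using h.1

theorem sectorIndex_zero : M.sectorIndex 0 = 0 := by
  classical
  simp [sectorIndex, Nat.count_succ, zero_notMem_resonances]

open Classical in
theorem sectorIndex_succ (n : ℕ) :
    M.sectorIndex (n + 1) = M.sectorIndex n + if n + 1 ∈ M.resonances then 1 else 0 := by
  unfold sectorIndex
  rw [Nat.count_succ]

theorem sectorIndex_succ_of_mem {n : ℕ} (h : n + 1 ∈ M.resonances) :
    M.sectorIndex (n + 1) = M.sectorIndex n + 1 := by
  classical
  rw [sectorIndex_succ, if_pos h]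

theorem sectorIndex_succ_of_notMem {n : ℕ} (h : n + 1 ∉ M.resonances) :
    M.sectorIndex (n + 1) = M.sectorIndex n := by
  classical
  rw [sectorIndex_succ, if_neg h, add_zero]

theorem sectorIndex_mono : Monotone M.sectorIndex := monotone_nat_of_le_succ fun n => by
  classical
  rw [sectorIndex_succ]; omega

theorem sectorIndex_lt_of_mem {i j p : ℕ} (hp : p ∈ M.resonances) (hi : i < p) (hj : p ≤ j) :
    M.sectorIndex i < M.sectorIndex j := by
  obtain ⟨q, rfl⟩ : ∃ q, p = q + 1 := ⟨p - 1, by omega⟩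
  have h1 := M.sectorIndex_mono (show i ≤ q by omega)
  have h2 := M.sectorIndex_mono hj
  rw [sectorIndex_succ_of_mem hp] at h2
  omega

theorem sectorIndex_eq_of_forall {i j : ℕ} (hij : i ≤ j)
    (h : ∀ p, i < p → p ≤ j → p ∉ M.resonances) : M.sectorIndex i = M.sectorIndex j := by
  induction j, hij using Nat.le_induction with
  | base => rfl
  | succ j hj ih =>
    rw [sectorIndex_succ_of_notMem (h _ (by omega) le_rfl)]
    exact ih fun p h1 h2 => h p h1 (by omega)

/-! ### Arithmetic of the resonances -/

/-- A system with two resonances is fully resonant. -/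
theorem isFullyResonant_of_lt (hc : M.coupling ≠ 0) (hτ : 0 < M.τ) {m n : ℕ}
    (hm : m ∈ M.resonances) (hn : n ∈ M.resonances) (hmn : m < n) : M.IsFullyResonant := by
  obtain ⟨hm1, k, hk⟩ := hm
  obtain ⟨hn1, l, hl⟩ := hn
  have hξ := xi_pos hc hτ
  obtain ⟨s, rfl⟩ : ∃ s, n = m + s := ⟨n - m, by omega⟩
  have hs : (1 : ℝ) ≤ s := by exact_mod_cast (by omega : 1 ≤ s)
  have h1 : M.xi * s = (l : ℝ) ^ 2 - k ^ 2 := by push_cast at hl; linarith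
  have hkl : k ^ 2 < l ^ 2 := by
    have : (0 : ℝ) < (l : ℝ) ^ 2 - k ^ 2 := by rw [← h1]; positivity
    have : (k : ℝ) ^ 2 < (l : ℝ) ^ 2 := by linarith
    exact_mod_cast this
  obtain ⟨D, hD⟩ : ∃ D, l ^ 2 = k ^ 2 + D := ⟨l ^ 2 - k ^ 2, by omega⟩
  have hD' : (D : ℝ) = M.xi * s := by
    have : (l : ℝ) ^ 2 = k ^ 2 + D := by exact_mod_cast hD
    linarith
  have hDpos : 1 ≤ D := by omega
  refine Set.infinite_of_forall_exists_gt fun N => ?_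
  -- With `D = l² - k² = ξ s`, the square `(k + t D)²` equals `k² + ξ s (2 k t + t² D)` for every
  -- `t`; the choice `t = N + 1` gives a resonance beyond `N`.
  refine ⟨m + s * (2 * k * (N + 1) + (N + 1) ^ 2 * D), ⟨by omega, k + (N + 1) * D, ?_⟩, ?_⟩
  · push_cast
    rw [hD']
    linear_combination hk
  · have h2 : 1 ≤ s := by omega
    have h3 : N + 1 ≤ (N + 1) ^ 2 * D := by nlinarith
    have h4 : 1 * (N + 1) ≤ s * (2 * k * (N + 1) + (N + 1) ^ 2 * D) :=
      Nat.mul_le_mul h2 (by omega)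
    omega

/-- If `ξ a = k²`, `ξ b = l²`, then `k l / ξ` is an integer. -/
theorem exists_xi_mul_eq (hc : M.coupling ≠ 0) (hτ : 0 < M.τ) {a b k l n₀ k₀ : ℕ}
    (h0 : M.xi * n₀ = (k₀ : ℝ) ^ 2) (hn₀ : 0 < n₀)
    (ha : M.xi * a = (k : ℝ) ^ 2) (hb : M.xi * b = (l : ℝ) ^ 2) :
    ∃ t : ℕ, M.xi * t = (k : ℝ) * l := by
  have hξ := xi_pos hc hτ
  have hk₀ : (k₀ : ℝ) ^ 2 ≠ 0 := by rw [← h0]; positivity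
  have h1 : (k * l * n₀) ^ 2 = a * b * (k₀ ^ 2) ^ 2 := by
    have : ((k : ℝ) * l * n₀) ^ 2 = a * b * ((k₀ : ℝ) ^ 2) ^ 2 := by
      rw [mul_pow, mul_pow, ← ha, ← hb, ← h0]; ring
    exact_mod_cast this
  -- Here `ξ = k₀² / n₀`, so `k l / ξ = k l n₀ / k₀²`. This rational number is an integer because
  -- its square is the integer `a b`.
  have h2 : k₀ ^ 2 ∣ k * l * n₀ := by
    rw [← Nat.pow_dvd_pow_iff two_ne_zero, h1]
    exact Dvd.intro_left _ rfl
  obtain ⟨t, ht⟩ := h2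
  refine ⟨t, ?_⟩
  have h3 : (k : ℝ) * l * n₀ = k₀ ^ 2 * t := by exact_mod_cast ht
  rw [← h0] at h3
  have hn₀' : (n₀ : ℝ) ≠ 0 := by positivity
  refine mul_right_cancel₀ hn₀' ?_
  linear_combination -h3

/-- Without detuning, the lengths of the Rabi sectors are strictly increasing. -/
theorem false_of_eta_eq_zero (hc : M.coupling ≠ 0) (hτ : 0 < M.τ) (hη : M.eta = 0) {m n d : ℕ}
    (hd : 0 < d) (hm : m = 0 ∨ m ∈ M.resonances) (hn : n ∈ M.resonances) (hmn : m < n)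
    (hmd : m + d ∈ M.resonances) (hnd : n + d ∈ M.resonances)
    (hgap : ∀ p, m < p → p < n → p ∉ M.resonances) : False := by
  have hξ := xi_pos hc hτ
  have key : ∀ p, p ∈ M.resonances ↔ 1 ≤ p ∧ ∃ k : ℕ, M.xi * p = (k : ℝ) ^ 2 := fun p => by
    rw [resonances, hη]; simp
  obtain ⟨k0, hk0⟩ : ∃ k : ℕ, M.xi * m = (k : ℝ) ^ 2 := by
    rcases hm with rfl | hm
    · exact ⟨0, by simp⟩
    · exact ((key _).1 hm).2
  obtain ⟨hn1, k2, hk2⟩ := (key _).1 hn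
  obtain ⟨-, k1, hk1⟩ := (key _).1 hmd
  obtain ⟨-, k3, hk3⟩ := (key _).1 hnd
  have lt_of : ∀ {a b k l : ℕ}, a < b → M.xi * a = (k : ℝ) ^ 2 → M.xi * b = (l : ℝ) ^ 2 →
      k < l := by
    intro a b k l hab ha hb
    have : (k : ℝ) ^ 2 < (l : ℝ) ^ 2 := by
      rw [← ha, ← hb]
      have : (a : ℝ) < b := by exact_mod_cast hab
      gcongr
    exact_mod_cast lt_of_pow_lt_pow_left₀ 2 (by positivity) this
  have h01 : k0 < k1 := lt_of (by omega) hk0 hk1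
  have h02 : k0 < k2 := lt_of hmn hk0 hk2
  have h13 : k1 < k3 := lt_of (by omega) hk1 hk3
  have h23 : k2 < k3 := lt_of (by omega) hk2 hk3
  obtain ⟨t03, h03⟩ := exists_xi_mul_eq hc hτ hk2 hn1 hk0 hk3
  obtain ⟨t01, ht01⟩ := exists_xi_mul_eq hc hτ hk2 hn1 hk0 hk1
  obtain ⟨t13, ht13⟩ := exists_xi_mul_eq hc hτ hk2 hn1 hk1 hk3
  obtain ⟨g, rfl⟩ : ∃ g, k3 = k1 + g := ⟨k3 - k1, by omega⟩
  have hg : 0 < g := by omega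
  -- The two differences of squares agree, `(k2 - k0)(k2 + k0) = (k3 - k1)(k3 + k1)`, and the second
  -- sum is larger; so `g = k3 - k1` is smaller than `k2 - k0`.
  have hgap' : k0 + g < k2 := by
    have e : (k2 : ℝ) ^ 2 - k0 ^ 2 = ((k1 + g : ℕ) : ℝ) ^ 2 - k1 ^ 2 := by
      rw [← hk0, ← hk1, ← hk2, ← hk3]; push_cast; ring
    have e' : k2 ^ 2 + k1 ^ 2 = (k1 + g) ^ 2 + k0 ^ 2 := by
      have : (k2 : ℝ) ^ 2 + k1 ^ 2 = ((k1 + g : ℕ) : ℝ) ^ 2 + k0 ^ 2 := by linarith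
      exact_mod_cast this
    by_contra hlt
    nlinarith
  -- `N` is `(k0 + k3 - k1)² / ξ` expanded: each square and each cross product is an integer
  -- multiple of `ξ`. It is a resonance strictly between `m` and `n`, contrary to `hgap`.
  set N : ℤ := m + 2 * t03 - 2 * t01 + (n + d) - 2 * t13 + (m + d) with hN
  have hNξ : M.xi * (N : ℝ) = ((k0 + g : ℕ) : ℝ) ^ 2 := by
    rw [hN]
    push_cast at *
    linear_combination hk0 + 2 * h03 - 2 * ht01 + hk3 - 2 * ht13 + hk1
  have hNm : (m : ℝ) < N := by
    have : M.xi * m < M.xi * N := by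
      rw [hk0, hNξ]
      have : (k0 : ℝ) < (k0 + g : ℕ) := by exact_mod_cast (by omega)
      gcongr
    exact lt_of_mul_lt_mul_left this hξ.le
  have hNn : (N : ℝ) < n := by
    have : M.xi * N < M.xi * n := by
      rw [hk2, hNξ]
      have : ((k0 + g : ℕ) : ℝ) < k2 := by exact_mod_cast hgap'
      gcongr
    exact lt_of_mul_lt_mul_left this hξ.le
  have h1 : (m : ℤ) < N := by exact_mod_cast hNm
  have h2 : N < n := by exact_mod_cast hNn
  have h3 : ((N.toNat : ℕ) : ℤ) = N := Int.toNat_of_nonneg (by omega)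
  refine hgap N.toNat (by omega) (by omega) ((key _).2 ⟨by omega, k0 + g, ?_⟩)
  rw [← hNξ]
  congr 1
  exact_mod_cast h3

/-! ### The dynamics on a diagonal -/

variable (M) in
/-- The Heisenberg dynamics of the entries `⟨m+d|A|m⟩`, `m = 0, 1, …`. -/
def diagHeisenberg (β : ℝ) (d : ℕ) : (ℕ → ℂ) →ₗ[ℂ] (ℕ → ℂ) where
  toFun f m := (M.atomPopulation β 0 * (M.groundAmp m * starRingEnd ℂ (M.groundAmp (m + d))) +
      M.atomPopulation β 1 * (M.excitedAmp m * starRingEnd ℂ (M.excitedAmp (m + d)))) * f m +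
    M.atomPopulation β 0 * (M.exchangeAmp m * starRingEnd ℂ (M.exchangeAmp (m + d))) *
      f (m - 1) +
    M.atomPopulation β 1 * (M.exchangeAmp (m + 1) * starRingEnd ℂ (M.exchangeAmp (m + 1 + d))) *
      f (m + 1)
  map_add' f g := by ext m; simp only [Pi.add_apply]; ring
  map_smul' c f := by ext m; simp only [Pi.smul_apply, smul_eq_mul, RingHom.id_apply]; ring

theorem diagHeisenberg_apply (β : ℝ) (d : ℕ) (f : ℕ → ℂ) (m : ℕ) : M.diagHeisenberg β d f m =
    (M.atomPopulation β 0 * (M.groundAmp m * starRingEnd ℂ (M.groundAmp (m + d))) +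
      M.atomPopulation β 1 * (M.excitedAmp m * starRingEnd ℂ (M.excitedAmp (m + d)))) * f m +
    M.atomPopulation β 0 * (M.exchangeAmp m * starRingEnd ℂ (M.exchangeAmp (m + d))) *
      f (m - 1) +
    M.atomPopulation β 1 * (M.exchangeAmp (m + 1) * starRingEnd ℂ (M.exchangeAmp (m + 1 + d))) *
      f (m + 1) := rfl

theorem exchangeAmp_zero : M.exchangeAmp 0 = 0 := rfl

theorem diagHeisenberg_entry (hc : M.coupling ≠ 0) (hτ : 0 < M.τ) (β : ℝ) (d : ℕ)
    (A : Field →L[ℂ] Field) :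
    M.diagHeisenberg β d (fun m => A (ket m) (m + d)) =
      fun m => M.heisenberg β A (ket m) (m + d) := by
  ext m
  rw [diagHeisenberg_apply, heisenberg_entry hc hτ, Nat.add_right_comm m 1 d]
  rcases m with _ | m
  · simp [exchangeAmp_zero]
  · rw [Nat.add_sub_cancel, Nat.add_right_comm m 1 d, Nat.add_sub_cancel]

theorem diagHeisenberg_iterate (hc : M.coupling ≠ 0) (hτ : 0 < M.τ) (β : ℝ) (d : ℕ)
    (A : Field →L[ℂ] Field) (n : ℕ) :
    (M.diagHeisenberg β d)^[n] (fun m => A (ket m) (m + d)) =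
      fun m => (M.heisenberg β)^[n] A (ket m) (m + d) := by
  induction n with
  | zero => rfl
  | succ n ih => rw [Function.iterate_succ_apply', ih, diagHeisenberg_entry hc hτ,
      Function.iterate_succ_apply']

/-- Detailed balance. -/
theorem pow_mul_diagHeisenberg (β : ℝ) (d : ℕ) (f : ℕ → ℂ) (m : ℕ) :
    (M.atomRatio β : ℂ) ^ m * M.diagHeisenberg β d f m =
    (M.atomPopulation β 0 * (M.groundAmp m * starRingEnd ℂ (M.groundAmp (m + d))) +
      M.atomPopulation β 1 * (M.excitedAmp m * starRingEnd ℂ (M.excitedAmp (m + d)))) *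
      ((M.atomRatio β : ℂ) ^ m * f m) +
    M.atomPopulation β 0 * (M.exchangeAmp (m + 1) * starRingEnd ℂ (M.exchangeAmp (m + 1 + d))) *
      ((M.atomRatio β : ℂ) ^ (m + 1) * f (m + 1)) +
    M.atomPopulation β 1 * (M.exchangeAmp m * starRingEnd ℂ (M.exchangeAmp (m + d))) *
      ((M.atomRatio β : ℂ) ^ (m - 1) * f (m - 1)) := by
  -- Since the upper population is `γ` times the lower one, shifting the weight `γ ^ m` by one level
  -- exchanges the two populations in the coupling terms.
  have h : (M.atomPopulation β 1 : ℂ) = M.atomPopulation β 0 * M.atomRatio β := by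
    exact_mod_cast M.atomPopulation_one β
  rw [diagHeisenberg_apply, h]
  -- At `m = 0` the truncated `m - 1` is harmless, because `exchangeAmp 0 = 0`.
  rcases m with _ | m
  · simp only [exchangeAmp_zero]; ring
  · rw [Nat.add_sub_cancel]; ring

/-- The weighted diagonal `γ^{-m} ⟨m|ρ|m+d⟩` of an invariant `ρ` is fixed in the Heisenberg
picture. -/
theorem diagHeisenberg_of_invariant (hc : M.coupling ≠ 0) (hτ : 0 < M.τ) {β : ℝ}
    {ρ : Field →L[ℂ] Field} (h : M.rdm β ρ = ρ) (d : ℕ) :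
    M.diagHeisenberg β d (fun m => ((M.atomRatio β : ℂ) ^ m)⁻¹ * ρ (ket (m + d)) m) =
      fun m => ((M.atomRatio β : ℂ) ^ m)⁻¹ * ρ (ket (m + d)) m := by
  have hγ : (M.atomRatio β : ℂ) ≠ 0 := by exact_mod_cast (M.atomRatio_pos β).ne'
  ext m
  refine mul_left_cancel₀ (pow_ne_zero m hγ) ?_
  rw [pow_mul_diagHeisenberg]
  simp only [mul_inv_cancel_left₀ (pow_ne_zero _ hγ)]
  conv_rhs => rw [← h, rdm_entry hc hτ]
  rw [Nat.add_right_comm m 1 d]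
  rcases m with _ | m
  · simp [exchangeAmp_zero]
  · rw [Nat.add_sub_cancel, Nat.add_right_comm m 1 d, Nat.add_sub_cancel]

/-! ### Peripheral eigenvectors on the diagonals -/

theorem norm_mul_conj_add_le (hc : M.coupling ≠ 0) (hτ : 0 < M.τ) (m n : ℕ) :
    ‖M.groundAmp m * starRingEnd ℂ (M.groundAmp n)‖
      + ‖M.exchangeAmp m * starRingEnd ℂ (M.exchangeAmp n)‖ ≤ 1 := by
  simp only [norm_mul, RCLike.norm_conj]
  have h1 := norm_sq_groundAmp_add hc hτ m
  have h2 := norm_sq_groundAmp_add hc hτ n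
  nlinarith [sq_nonneg (‖M.groundAmp m‖ - ‖M.groundAmp n‖),
    sq_nonneg (‖M.exchangeAmp m‖ - ‖M.exchangeAmp n‖)]

theorem norm_mul_conj_add_le' (m n : ℕ) :
    ‖M.excitedAmp m * starRingEnd ℂ (M.excitedAmp n)‖
      + ‖M.exchangeAmp (m + 1) * starRingEnd ℂ (M.exchangeAmp (n + 1))‖ ≤ 1 := by
  simp only [norm_mul, RCLike.norm_conj]
  have h1 := M.norm_sq_excitedAmp_add m
  have h2 := M.norm_sq_excitedAmp_add n
  nlinarith [sq_nonneg (‖M.excitedAmp m‖ - ‖M.excitedAmp n‖),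
    sq_nonneg (‖M.exchangeAmp (m + 1)‖ - ‖M.exchangeAmp (n + 1)‖)]

/-- Equality in Cauchy–Schwarz for two unit vectors of moduli. -/
theorem eq_and_eq_of_norm_add_eq_one {a b c d : ℂ} (h1 : ‖a‖ ^ 2 + ‖b‖ ^ 2 = 1)
    (h2 : ‖c‖ ^ 2 + ‖d‖ ^ 2 = 1)
    (h : ‖a * starRingEnd ℂ c‖ + ‖b * starRingEnd ℂ d‖ = 1) : ‖a‖ = ‖c‖ ∧ ‖b‖ = ‖d‖ := by
  simp only [norm_mul, RCLike.norm_conj] at h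
  constructor
  · have : (‖a‖ - ‖c‖) ^ 2 = 0 := by
      nlinarith [sq_nonneg (‖a‖ - ‖c‖), sq_nonneg (‖b‖ - ‖d‖)]
    exact sub_eq_zero.1 (pow_eq_zero_iff two_ne_zero |>.1 this)
  · have : (‖b‖ - ‖d‖) ^ 2 = 0 := by
      nlinarith [sq_nonneg (‖a‖ - ‖c‖), sq_nonneg (‖b‖ - ‖d‖)]
    exact sub_eq_zero.1 (pow_eq_zero_iff two_ne_zero |>.1 this)

theorem eq_of_mul_conj_eq_norm {a b : ℂ} (h : ‖a‖ = ‖b‖)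
    (h' : a * starRingEnd ℂ b = ‖a * starRingEnd ℂ b‖) : a = b := by
  rw [norm_mul, RCLike.norm_conj, ← h] at h'
  rcases eq_or_ne b 0 with rfl | hb
  · simpa using h
  · refine mul_right_cancel₀ ((map_ne_zero (starRingEnd ℂ)).2 hb) ?_
    rw [h', Complex.mul_conj', ← h]
    push_cast
    ring

/-- What an eigenvector to a peripheral eigenvalue implies where it does not vanish. -/
structure PeripheralAt (M : Maser) (d : ℕ) (f : ℕ → ℂ) (z : ℂ) (m : ℕ) : Prop where
  norm_ground : ‖M.groundAmp m‖ = ‖M.groundAmp (m + d)‖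
  norm_exchange : ‖M.exchangeAmp m‖ = ‖M.exchangeAmp (m + d)‖
  norm_excited : ‖M.excitedAmp m‖ = ‖M.excitedAmp (m + d)‖
  norm_exchange_succ : ‖M.exchangeAmp (m + 1)‖ = ‖M.exchangeAmp (m + 1 + d)‖
  down : M.exchangeAmp m ≠ 0 → f (m - 1) ≠ 0
  up : M.exchangeAmp (m + 1) ≠ 0 → f (m + 1) ≠ 0
  phase_ground : M.groundAmp m * starRingEnd ℂ (M.groundAmp (m + d)) =
    ‖M.groundAmp m * starRingEnd ℂ (M.groundAmp (m + d))‖ * z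
  phase_excited : M.excitedAmp m * starRingEnd ℂ (M.excitedAmp (m + d)) =
    ‖M.excitedAmp m * starRingEnd ℂ (M.excitedAmp (m + d))‖ * z

/-- By detailed balance `γ ^ m * f m` is an eigenvector of an operator with absolute column sums at
most 1, to which `tridiagonal_eigenvector` applies. Unitarity of the blocks turns each saturated
column bound into equality of moduli at distance `d`. -/
theorem peripheralAt (hc : M.coupling ≠ 0) (hτ : 0 < M.τ) {β : ℝ} {d : ℕ} {f : ℕ → ℂ} {z : ℂ}
    (hz : 1 ≤ ‖z‖) (hf : M.diagHeisenberg β d f = z • f)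
    (hlim : Tendsto (fun m => (M.atomRatio β : ℂ) ^ m * f m) atTop (𝓝 0)) {m : ℕ}
    (hm : f m ≠ 0) : PeripheralAt M d f z m := by
  have hγ : (M.atomRatio β : ℂ) ≠ 0 := by exact_mod_cast (M.atomRatio_pos β).ne'
  have hne : ∀ n, (M.atomRatio β : ℂ) ^ n * f n ≠ 0 ↔ f n ≠ 0 := fun n => by simp [hγ]
  obtain ⟨e1, e2, e3, e4, e5, e6⟩ := tridiagonal_eigenvector
    (a := fun m => M.groundAmp m * starRingEnd ℂ (M.groundAmp (m + d)))
    (a' := fun m => M.excitedAmp m * starRingEnd ℂ (M.excitedAmp (m + d)))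
    (k := fun m => M.exchangeAmp m * starRingEnd ℂ (M.exchangeAmp (m + d)))
    (M.atomPopulation_pos β 0) (M.atomPopulation_pos β 1) (M.atomPopulation_sum β)
    (by simp [exchangeAmp_zero]) (fun m => norm_mul_conj_add_le hc hτ _ _)
    (fun m => by
      rw [Nat.add_right_comm]
      exact M.norm_mul_conj_add_le' m (m + d))
    hlim hz (fun m => by
      rw [← pow_mul_diagHeisenberg, hf, Pi.smul_apply, smul_eq_mul]
      ring) ((hne m).2 hm)
  obtain ⟨g1, g2⟩ := eq_and_eq_of_norm_add_eq_one (norm_sq_groundAmp_add hc hτ m)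
    (norm_sq_groundAmp_add hc hτ (m + d)) e1
  have e2' := e2
  rw [Nat.add_right_comm] at e2'
  obtain ⟨g3, g4⟩ := eq_and_eq_of_norm_add_eq_one (M.norm_sq_excitedAmp_add m)
    (M.norm_sq_excitedAmp_add (m + d)) e2'
  rw [Nat.add_right_comm] at g4
  refine ⟨g1, g2, g3, g4, fun h => (hne _).1 (e3 ?_), fun h => (hne _).1 (e4 ?_), e5, e6⟩
  · have : M.exchangeAmp (m + d) ≠ 0 := by rw [← norm_ne_zero_iff, ← g2]; exact norm_ne_zero_iff.2 h
    simp [h, this]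
  · have : M.exchangeAmp (m + 1 + d) ≠ 0 := by
      rw [← norm_ne_zero_iff, ← g4]; exact norm_ne_zero_iff.2 h
    simp [h, this]

/-- The support of `f` propagates downwards through unbroken links, hence reaches the lowest level
of its sector. -/
theorem exists_bottom (hc : M.coupling ≠ 0) (hτ : 0 < M.τ) {f : ℕ → ℂ}
    (hf : ∀ m, f m ≠ 0 → M.exchangeAmp m ≠ 0 → f (m - 1) ≠ 0) {m : ℕ} (hm : f m ≠ 0) :
    ∃ m₀ ≤ m, f m₀ ≠ 0 ∧ M.exchangeAmp m₀ = 0 ∧ M.sectorIndex m₀ = M.sectorIndex m := by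
  induction m with
  | zero => exact ⟨0, le_rfl, hm, rfl, rfl⟩
  | succ m ih =>
    by_cases h : M.exchangeAmp (m + 1) = 0
    · exact ⟨m + 1, le_rfl, hm, h, rfl⟩
    · obtain ⟨m₀, h1, h2, h3, h4⟩ := ih (hf _ hm h)
      refine ⟨m₀, by omega, h2, h3, ?_⟩
      rw [exchangeAmp_eq_zero_iff hc hτ] at h
      rw [h4, sectorIndex_succ_of_notMem (by tauto)]

/-- There is no coherence between different levels of the same Rabi sector. -/
theorem eq_zero_of_same_sector (hc : M.coupling ≠ 0) (hτ : 0 < M.τ) {β : ℝ} {d : ℕ} (hd : 0 < d)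
    {f : ℕ → ℂ} {z : ℂ} (hz : 1 ≤ ‖z‖) (hf : M.diagHeisenberg β d f = z • f)
    (hlim : Tendsto (fun m => (M.atomRatio β : ℂ) ^ m * f m) atTop (𝓝 0))
    (hsec : ∀ m, f m ≠ 0 → M.sectorIndex m = M.sectorIndex (m + d)) : f = 0 := by
  ext m
  by_contra hm
  obtain ⟨m₀, -, h1, h2, -⟩ :=
    exists_bottom hc hτ (fun m hm => (peripheralAt hc hτ hz hf hlim hm).down) hm
  -- The broken link at the bottom `m₀` is copied to `m₀ + d`, which is then a resonance separating
  -- the sectors of `m₀` and `m₀ + d`.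
  have h3 := (peripheralAt hc hτ hz hf hlim h1).norm_exchange
  rw [h2, norm_zero, eq_comm, norm_eq_zero, exchangeAmp_eq_zero_iff hc hτ] at h3
  exact (sectorIndex_lt_of_mem (i := m₀) (h3.resolve_left (by omega)) (by omega) le_rfl).ne
    (hsec _ h1)

/-- In a non-degenerate system no coherences between different levels are stationary. -/
theorem eq_zero_of_not_isDegenerate (hc : M.coupling ≠ 0) (hτ : 0 < M.τ) (hM : ¬ M.IsDegenerate)
    {β : ℝ} {d : ℕ} (hd : 0 < d) {f : ℕ → ℂ} (hf : M.diagHeisenberg β d f = f)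
    (hlim : Tendsto (fun m => (M.atomRatio β : ℂ) ^ m * f m) atTop (𝓝 0)) : f = 0 := by
  ext m
  by_contra hm
  have hp : ∀ {m}, f m ≠ 0 → PeripheralAt M d f 1 m := fun hm =>
    peripheralAt hc hτ (by simp) (by rwa [one_smul]) hlim hm
  obtain ⟨m₀, -, h1, h2, -⟩ := exists_bottom hc hτ (fun m hm => (hp hm).down) hm
  have h3 := (hp h1).norm_exchange
  rw [h2, norm_zero, eq_comm, norm_eq_zero, exchangeAmp_eq_zero_iff hc hτ] at h3
  rw [exchangeAmp_eq_zero_iff hc hτ] at h2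
  have h3' : m₀ + d ∈ M.resonances := h3.resolve_left (by omega)
  classical
  -- The first resonance `n` above `m₀` ends the sector of `m₀`. The function is non-zero on all of
  -- this sector, so the upper end is copied to a resonance `n + d`.
  have hex : ∃ n, m₀ < n ∧ n ∈ M.resonances := ⟨m₀ + d, by omega, h3'⟩
  set n := Nat.find hex with hn
  obtain ⟨hmn, hnR⟩ := Nat.find_spec hex
  rw [← hn] at hmn hnR
  have hgap : ∀ p, m₀ < p → p < n → p ∉ M.resonances := fun p h h' hR =>
    Nat.find_min hex h' ⟨h, hR⟩
  have hup : ∀ p, m₀ ≤ p → p < n → f p ≠ 0 := by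
    intro p hp0
    induction p, hp0 using Nat.le_induction with
    | base => exact fun _ => h1
    | succ p hp0 ih =>
      intro hpn
      refine (hp (ih (by omega))).up ?_
      rw [Ne, exchangeAmp_eq_zero_iff hc hτ]
      have := hgap (p + 1) (by omega) hpn
      simp [this]
  have hnd : n + d ∈ M.resonances := by
    obtain ⟨p, hp'⟩ : ∃ p, n = p + 1 := ⟨n - 1, by omega⟩
    have h4 := (hp (hup p (by omega) (by omega))).norm_exchange_succ
    rw [← hp', (exchangeAmp_eq_zero_iff hc hτ n).2 (Or.inr hnR), norm_zero, eq_comm, norm_eq_zero,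
      exchangeAmp_eq_zero_iff hc hτ] at h4
    exact h4.resolve_left (by omega)
  by_cases hη : M.eta = 0
  · exact false_of_eta_eq_zero hc hτ hη hd h2 hnR hmn h3' hnd hgap
  -- If the sector has two levels, the excited amplitude at `m₀` and the ground amplitude at `m₀ +
  -- 1` are the two diagonal entries of one Rabi block. For eigenvalue 1 they agree in phase as well
  -- as modulus with those of the block shifted by `d`, which detuning forbids.
  rcases Nat.lt_or_ge (m₀ + 1) n with hlt | hge
  · have g1 := hp h1
    have g2 := hp (hup (m₀ + 1) (by omega) hlt)
    have a1 := eq_of_mul_conj_eq_norm g1.norm_excited (by simpa using g1.phase_excited)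
    have a2 := eq_of_mul_conj_eq_norm g2.norm_ground (by simpa using g2.phase_ground)
    rw [Nat.add_right_comm] at a2
    have := eq_of_amp_eq hc hτ hη (hgap _ (by omega) hlt) a2 a1
    omega
  -- A sector of one level leaves only the pattern that defines degeneracy, with the pair `m₀`, `m₀
  -- + d`.
  · have hn1 : n = m₀ + 1 := by omega
    rw [hn1] at hnR hnd
    refine hM ⟨isFullyResonant_of_lt hc hτ hnR hnd (by omega), m₀, m₀ + d, h2, h3', by omega,
      hnR, by rwa [Nat.add_right_comm] at hnd⟩

/-- Stationary functions on the levels are constant on each Rabi sector. -/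
theorem eq_of_sectorIndex_eq (hc : M.coupling ≠ 0) (hτ : 0 < M.τ) {β : ℝ} {f : ℕ → ℂ}
    (hf : M.diagHeisenberg β 0 f = f) {i j : ℕ} (h : M.sectorIndex i = M.sectorIndex j) :
    f i = f j := by
  -- Stationarity at `m` equates the weighted fluxes through the links below and above `m`. The
  -- lowest link is broken, so by induction every flux is zero; no boundedness of `f` is required.
  have hflux : ∀ m, M.exchangeAmp m * starRingEnd ℂ (M.exchangeAmp m) * (f m - f (m - 1)) = 0 := by
    have h1 : (M.atomPopulation β 1 : ℂ) ≠ 0 := by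
      exact_mod_cast (M.atomPopulation_pos β 1).ne'
    have h3 : (M.atomPopulation β 0 : ℂ) + M.atomPopulation β 1 = 1 := by
      exact_mod_cast M.atomPopulation_sum β
    intro m
    induction m with
    | zero => simp
    | succ m ih =>
      have h2 := congrFun hf m
      rw [diagHeisenberg_apply] at h2
      simp only [add_zero, Nat.add_sub_cancel] at h2 ⊢
      refine (mul_eq_zero.1 (?_ : (M.atomPopulation β 1 : ℂ) * _ = 0)).resolve_left h1
      linear_combination h2 + (M.atomPopulation β 0 : ℂ) * ih
        - f m * ((M.atomPopulation β 0 : ℂ) * mul_conj_add_mul_conj hc hτ m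
          + (M.atomPopulation β 1 : ℂ) * M.mul_conj_add_mul_conj' m + h3)
  have main : ∀ i j, i ≤ j → M.sectorIndex i = M.sectorIndex j → f i = f j := by
    intro i j hij
    induction j, hij using Nat.le_induction with
    | base => exact fun _ => rfl
    | succ j hj ih =>
      intro h
      have h1 : j + 1 ∉ M.resonances := fun hR =>
        (sectorIndex_lt_of_mem (i := i) hR (by omega) le_rfl).ne h
      rw [ih (by rw [h, sectorIndex_succ_of_notMem h1])]
      have h2 : M.exchangeAmp (j + 1) ≠ 0 := by
        rw [Ne, exchangeAmp_eq_zero_iff hc hτ]; simp [h1]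
      have h4 := hflux (j + 1)
      rw [mul_eq_zero, mul_eq_zero, map_eq_zero, or_self, or_iff_right h2, sub_eq_zero] at h4
      exact h4.symm
  rcases le_total i j with hij | hij
  · exact main i j hij h
  · exact (main j i hij h.symm).symm

/-- The dynamics on a diagonal preserves pairs of Rabi sectors. -/
theorem diagHeisenberg_indicator (hc : M.coupling ≠ 0) (hτ : 0 < M.τ) (β : ℝ) (d a b : ℕ)
    (f : ℕ → ℂ) :
    M.diagHeisenberg β d
        ({m | M.sectorIndex m = a ∧ M.sectorIndex (m + d) = b}.indicator f) =
      {m | M.sectorIndex m = a ∧ M.sectorIndex (m + d) = b}.indicator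
        (M.diagHeisenberg β d f) := by
  classical
  set S := {m | M.sectorIndex m = a ∧ M.sectorIndex (m + d) = b} with hS
  -- A product of two non-zero exchange amplitudes means that neither `m + 1` nor `m + 1 + d` is a
  -- resonance, so the step crosses no sector boundary.
  have hstep : ∀ m, M.exchangeAmp (m + 1) * starRingEnd ℂ (M.exchangeAmp (m + 1 + d)) ≠ 0 →
      (m ∈ S ↔ m + 1 ∈ S) := by
    intro m hm
    rw [Ne, mul_eq_zero, map_eq_zero, exchangeAmp_eq_zero_iff hc hτ,
      exchangeAmp_eq_zero_iff hc hτ] at hm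
    push Not at hm
    rw [Nat.add_right_comm] at hm
    simp only [hS, Set.mem_ofPred_eq]
    rw [sectorIndex_succ_of_notMem hm.1.2, Nat.add_right_comm, sectorIndex_succ_of_notMem hm.2.2]
  have hterm : ∀ m, ∀ n, (m ∈ S ↔ n ∈ S) →
      S.indicator f n = if m ∈ S then f n else 0 := by
    intro m n h
    rw [Set.indicator_apply]
    simp only [h]
  have hup : ∀ m, M.exchangeAmp (m + 1) * starRingEnd ℂ (M.exchangeAmp (m + 1 + d)) *
      S.indicator f (m + 1) = M.exchangeAmp (m + 1) * starRingEnd ℂ (M.exchangeAmp (m + 1 + d)) *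
      (if m ∈ S then f (m + 1) else 0) := by
    intro m
    by_cases h : M.exchangeAmp (m + 1) * starRingEnd ℂ (M.exchangeAmp (m + 1 + d)) = 0
    · rw [h, zero_mul, zero_mul]
    · rw [hterm m _ (hstep m h)]
  have hdown : ∀ m, M.exchangeAmp m * starRingEnd ℂ (M.exchangeAmp (m + d)) *
      S.indicator f (m - 1) = M.exchangeAmp m * starRingEnd ℂ (M.exchangeAmp (m + d)) *
      (if m ∈ S then f (m - 1) else 0) := by
    intro m
    by_cases h : M.exchangeAmp m * starRingEnd ℂ (M.exchangeAmp (m + d)) = 0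
    · rw [h, zero_mul, zero_mul]
    · rcases m with _ | m
      · simp [exchangeAmp_zero]
      · rw [Nat.add_sub_cancel, hterm (m + 1) m (hstep m h).symm]
  ext m
  rw [diagHeisenberg_apply, Set.indicator_apply S (M.diagHeisenberg β d f), diagHeisenberg_apply,
    mul_assoc (M.atomPopulation β 0 : ℂ) _ (S.indicator f (m - 1)),
    mul_assoc (M.atomPopulation β 1 : ℂ) _ (S.indicator f (m + 1)), hup, hdown,
    Set.indicator_apply]
  split_ifs <;> ring

end Maser

/-! ### Weak operator convergence and expectations -/

theorem hasSum_smul_ket (x : Field) : HasSum (fun i => x i • (ket i : Field)) x := by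
  refine (lp.hasSum_single (by norm_num) x).congr_fun fun i => ?_
  rw [ket, ← lp.single_smul, smul_eq_mul, mul_one]

/-- Equibounded functionals need to be tested only on a total set: a vector is replaced by a finite
truncation up to an error controlled by `C`. -/
theorem tendsto_zero_of_ket {φ : ℕ → Field →ₗ[ℂ] ℂ} {C : ℝ} (hφ : ∀ N x, ‖φ N x‖ ≤ C * ‖x‖)
    {J : Set ℕ} (hJ : ∀ i ∈ J, Tendsto (fun N => φ N (ket i)) atTop (𝓝 0)) {x : Field}
    (hx : ∀ i ∉ J, x i = 0) : Tendsto (fun N => φ N x) atTop (𝓝 0) := by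
  have hC : 0 ≤ C := by
    have := (norm_nonneg _).trans (hφ 0 (ket 0))
    rwa [norm_ket, mul_one] at this
  rw [Metric.tendsto_atTop]
  intro ε hε
  obtain ⟨F, hF⟩ := (Metric.tendsto_nhds.1 (hasSum_smul_ket x) (ε / (2 * (C + 1)))
    (by positivity)).exists
  have h1 : Tendsto (fun N => φ N (∑ i ∈ F, x i • (ket i : Field))) atTop (𝓝 0) := by
    simp only [map_sum, map_smul, smul_eq_mul]
    rw [← Finset.sum_const_zero (s := F)]
    refine tendsto_finsetSum _ fun i _ => ?_
    by_cases h : i ∈ J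
    · simpa using (hJ i h).const_mul (x i)
    · simp [hx i h]
  obtain ⟨N₀, hN₀⟩ := Metric.tendsto_atTop.1 h1 (ε / 2) (by positivity)
  refine ⟨N₀, fun N hN => ?_⟩
  have h2 := hN₀ N hN
  rw [dist_zero_right] at h2 ⊢
  have h3 : ‖φ N (x - ∑ i ∈ F, x i • (ket i : Field))‖ ≤ ε / 2 := by
    refine (hφ N _).trans ?_
    rw [dist_eq_norm, norm_sub_rev] at hF
    calc C * _ ≤ (C + 1) * (ε / (2 * (C + 1))) := by gcongr; linarith
      _ = ε / 2 := by field_simp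
  have h4 : φ N x = φ N (x - ∑ i ∈ F, x i • (ket i : Field)) +
      φ N (∑ i ∈ F, x i • (ket i : Field)) := by rw [map_sub]; ring
  rw [h4]
  exact (norm_add_le _ _).trans_lt (by linarith)

theorem sqrt_ket_eq_zero {ρ S : Field →L[ℂ] Field} (hS : ContinuousLinearMap.adjoint S = S)
    (hSS : S ∘L S = ρ) {i : ℕ} (hi : population ρ i = 0) (m : ℕ) : S (ket m) i = 0 := by
  rw [population_eq_norm_sq hS hSS, sq_eq_zero_iff, norm_eq_zero] at hi
  rw [← hS, adjoint_apply_ket, hi]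
  simp

theorem norm_expect_le {ρ : Field →L[ℂ] Field} (h : IsState ρ) (A : Field →L[ℂ] Field) :
    ‖expect ρ A‖ ≤ ‖A‖ := by
  obtain ⟨S, hS, hSS, hs⟩ := h.exists_sqrt
  rw [← (hasSum_expect_of_sqrt hS hSS hs.summable A).tsum_eq]
  refine tsum_of_norm_bounded (by simpa using hs.mul_left ‖A‖) fun m => ?_
  refine (norm_inner_le_norm _ _).trans ?_
  have := A.le_opNorm (S (ket m))
  nlinarith [norm_nonneg (S (ket m))]

theorem IsState.expect_sub {ρ : Field →L[ℂ] Field} (h : IsState ρ) (A B : Field →L[ℂ] Field) :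
    expect ρ (A - B) = expect ρ A - expect ρ B := by
  rw [← ((h.hasSum_expect A).sub (h.hasSum_expect B)).tsum_eq]
  exact tsum_congr fun n => by rw [_root_.sub_apply, map_sub, inner_sub_right]

theorem expect_smul (ρ : Field →L[ℂ] Field) (c : ℂ) (A : Field →L[ℂ] Field) :
    expect ρ (c • A) = c * expect ρ A := by
  unfold expect
  rw [← tsum_mul_left]
  exact tsum_congr fun n => by rw [_root_.smul_apply, map_smul, inner_smul_right]

theorem IsState.expect_sum {ρ : Field →L[ℂ] Field} (h : IsState ρ) {ι : Type} (s : Finset ι)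
    (A : ι → Field →L[ℂ] Field) :
    expect ρ (∑ i ∈ s, A i) = ∑ i ∈ s, expect ρ (A i) := by
  rw [← (hasSum_sum fun i _ => h.hasSum_expect (A i)).tsum_eq]
  exact tsum_congr fun n => by rw [_root_.sum_apply, map_sum, inner_sum]

/-- For bounded operators, convergence of entries implies weak convergence on vectors living on `J`.
Dominated convergence over the columns of the Hilbert–Schmidt root then carries it to the state,
whose columns live on `J` by the hypothesis on populations. -/
theorem tendsto_expect_zero {D : ℕ → Field →L[ℂ] Field} {C : ℝ} (hD : ∀ N, ‖D N‖ ≤ C) {J : Set ℕ}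
    (hJ : ∀ i ∈ J, ∀ j ∈ J, Tendsto (fun N => D N (ket i) j) atTop (𝓝 0))
    {ρ : Field →L[ℂ] Field} (hρ : IsState ρ) (hρJ : ∀ i ∉ J, population ρ i = 0) :
    Tendsto (fun N => expect ρ (D N)) atTop (𝓝 0) := by
  obtain ⟨S, hS, hSS, hs⟩ := hρ.exists_sqrt
  have hbound : ∀ N (x y : Field), ‖⟪D N x, y⟫_ℂ‖ ≤ C * ‖x‖ * ‖y‖ := fun N x y =>
    (norm_inner_le_norm _ _).trans (by gcongr; exact (D N).le_of_opNorm_le (hD N) x)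
  have h1 : ∀ x : Field, (∀ i ∉ J, x i = 0) → ∀ j ∈ J,
      Tendsto (fun N => D N x j) atTop (𝓝 0) := by
    intro x hx j hj
    refine tendsto_zero_of_ket (C := C)
      (φ := fun N => (innerSL ℂ (ket j : Field)).toLinearMap ∘ₗ (D N).toLinearMap)
      (fun N y => ?_) (fun i hi => ?_) hx |>.congr fun N => ?_
    · change ‖⟪(ket j : Field), D N y⟫_ℂ‖ ≤ _
      rw [norm_inner_symm]
      simpa [norm_ket] using hbound N y (ket j)
    · refine (hJ i hi j hj).congr fun N => ?_
      exact (inner_ket_left j (D N (ket i))).symm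
    · exact inner_ket_left j (D N x)
  have h2 : ∀ x y : Field, (∀ i ∉ J, x i = 0) → (∀ i ∉ J, y i = 0) →
      Tendsto (fun N => ⟪D N x, y⟫_ℂ) atTop (𝓝 0) := by
    intro x y hx hy
    refine tendsto_zero_of_ket (C := C * ‖x‖) (φ := fun N => (innerSL ℂ (D N x)).toLinearMap)
      (fun N y => hbound N x y) (fun i hi => ?_) hy
    have := (h1 x hx i hi).star
    rw [star_zero] at this
    refine this.congr fun N => ?_
    exact (inner_ket_right i (D N x)).symm
  have h3 : Tendsto (fun N => ∑' m : ℕ, ⟪S (ket m), D N (S (ket m))⟫_ℂ) atTop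
      (𝓝 (∑' _ : ℕ, (0 : ℂ))) := by
    refine tendsto_tsum_of_dominated_convergence (hs.summable.mul_left C) (fun m => ?_)
      (Eventually.of_forall fun N m => ?_)
    · have := (h2 (S (ket m)) (S (ket m)) (fun i hi => sqrt_ket_eq_zero hS hSS (hρJ i hi) m)
        (fun i hi => sqrt_ket_eq_zero hS hSS (hρJ i hi) m)).star
      rw [star_zero] at this
      refine this.congr fun N => ?_
      exact inner_conj_symm _ _
    · rw [norm_inner_symm]
      refine (hbound N _ _).trans_eq ?_
      ring
  rw [tsum_zero] at h3
  refine h3.congr fun N => ?_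
  exact (hasSum_expect_of_sqrt hS hSS hs.summable (D N)).tsum_eq

theorem diagOp_ket (f : ℕ → ℂ) (hf : ∃ C : ℝ, ∀ n, ‖f n‖ ≤ C) (n : ℕ) :
    diagOp f hf (ket n) = f n • ket n := by
  ext m
  rw [diagOp_apply]
  by_cases h : m = n
  · subst h; simp
  · simp [ket_apply, h]

theorem IsState.hasSum_expect_diagOp {ρ : Field →L[ℂ] Field} (h : IsState ρ) (f : ℕ → ℂ)
    (hf : ∃ C : ℝ, ∀ n, ‖f n‖ ≤ C) :
    HasSum (fun n => population ρ n * f n) (expect ρ (diagOp f hf)) := by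
  refine (h.hasSum_expect _).congr_fun fun n => ?_
  rw [diagOp_ket, map_smul, inner_smul_right, inner_ket_left, h.entry_self, mul_comm]

theorem tendsto_expect {B : ℕ → Field →L[ℂ] Field} {C : ℝ} (hB : ∀ N, ‖B N‖ ≤ C) {J : Set ℕ}
    {t : ℕ → ℂ} (ht : ∃ C : ℝ, ∀ n, ‖t n‖ ≤ C)
    (hdiag : ∀ i ∈ J, Tendsto (fun N => B N (ket i) i) atTop (𝓝 (t i)))
    (hoff : ∀ i ∈ J, ∀ j ∈ J, i ≠ j → Tendsto (fun N => B N (ket i) j) atTop (𝓝 0))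
    {ρ : Field →L[ℂ] Field} (hρ : IsState ρ) (hρJ : ∀ i ∉ J, population ρ i = 0) :
    Tendsto (fun N => expect ρ (B N)) atTop (𝓝 (∑' n, population ρ n * t n)) := by
  have h : Tendsto (fun N => expect ρ (B N - diagOp t ht)) atTop (𝓝 0) := by
    refine tendsto_expect_zero (C := C + ‖diagOp t ht‖) (fun N => ?_) (fun i hi j hj => ?_) hρ hρJ
    · exact (norm_sub_le _ _).trans (by gcongr; exact hB N)
    · have e : ∀ N, (B N - diagOp t ht) (ket i) j = B N (ket i) j - if j = i then t i else 0 := by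
        intro N
        rw [_root_.sub_apply, diagOp_ket]
        change B N (ket i) j - t i * (ket i : Field) j = _
        rw [ket_apply, mul_ite, mul_one, mul_zero]
      simp only [e]
      by_cases hij : j = i
      · subst hij
        simpa using (hdiag j hi).sub_const (t j)
      · simpa [hij] using hoff i hi j hj (Ne.symm hij)
  have h' := h.add_const (expect ρ (diagOp t ht))
  rw [zero_add, (hρ.hasSum_expect_diagOp t ht).tsum_eq.symm] at h'
  refine h'.congr fun N => ?_
  rw [(hρ.hasSum_expect_diagOp t ht).tsum_eq, hρ.expect_sub]
  ring

namespace Maser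

variable {M : Maser}

/-! ### Contractivity and Cesàro means -/

theorem sum_norm_kraus_sq (hc : M.coupling ≠ 0) (hτ : 0 < M.τ) (β : ℝ) (x : Field) :
    ∑ p : Fin 2 × Fin 2, M.atomPopulation β p.1 * ‖M.kraus p.2 p.1 x‖ ^ 2 = ‖x‖ ^ 2 := by
  have h := congrArg (fun T : Field →L[ℂ] Field => ⟪x, T x⟫_ℂ) (heisenberg_one hc hτ β)
  simp only [heisenberg, Fin.sum_univ_two, _root_.add_apply, _root_.smul_apply,
    ContinuousLinearMap.comp_apply, inner_add_right, inner_smul_right,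
    ContinuousLinearMap.adjoint_inner_right, one_apply_eq_self,
    inner_self_eq_norm_sq_to_K] at h
  rw [Fintype.sum_prod_type]
  simp only [Fin.sum_univ_two]
  apply Complex.ofReal_injective
  push_cast
  exact h

/-- Weighted Cauchy–Schwarz over the four Kraus terms; unitality, in the form `sum_norm_kraus_sq`,
makes the constant equal to 1. The resulting uniform bounds supply the compactness used for Cesàro
means. -/
theorem norm_heisenberg_le (hc : M.coupling ≠ 0) (hτ : 0 < M.τ) (β : ℝ) (A : Field →L[ℂ] Field) :
    ‖M.heisenberg β A‖ ≤ ‖A‖ := by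
  have key : ∀ x y : Field, ‖⟪y, M.heisenberg β A x⟫_ℂ‖ ≤ ‖A‖ * (‖y‖ * ‖x‖) := by
    intro x y
    have e : ⟪y, M.heisenberg β A x⟫_ℂ = ∑ p : Fin 2 × Fin 2, (M.atomPopulation β p.1 : ℂ) *
        ⟪M.kraus p.2 p.1 y, A (M.kraus p.2 p.1 x)⟫_ℂ := by
      rw [Fintype.sum_prod_type]
      simp only [heisenberg, Fin.sum_univ_two, _root_.add_apply, _root_.smul_apply,
        ContinuousLinearMap.comp_apply, inner_add_right, inner_smul_right,
        ContinuousLinearMap.adjoint_inner_right]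
    have hw : ∀ p : Fin 2 × Fin 2, 0 ≤ M.atomPopulation β p.1 := fun p =>
      (M.atomPopulation_pos β p.1).le
    have h1 : ‖⟪y, M.heisenberg β A x⟫_ℂ‖ ≤ ‖A‖ * ∑ p : Fin 2 × Fin 2,
        (√(M.atomPopulation β p.1) * ‖M.kraus p.2 p.1 y‖) *
          (√(M.atomPopulation β p.1) * ‖M.kraus p.2 p.1 x‖) := by
      rw [e, Finset.mul_sum]
      refine (norm_sum_le _ _).trans (Finset.sum_le_sum fun p _ => ?_)
      rw [norm_mul, Complex.norm_real, Real.norm_eq_abs, abs_of_nonneg (hw p)]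
      have h2 : ‖⟪M.kraus p.2 p.1 y, A (M.kraus p.2 p.1 x)⟫_ℂ‖ ≤
          ‖M.kraus p.2 p.1 y‖ * (‖A‖ * ‖M.kraus p.2 p.1 x‖) :=
        (norm_inner_le_norm _ _).trans (by gcongr; exact A.le_opNorm _)
      refine (mul_le_mul_of_nonneg_left h2 (hw p)).trans_eq ?_
      have h3 := Real.mul_self_sqrt (hw p)
      linear_combination (-‖A‖ * ‖M.kraus p.2 p.1 y‖ * ‖M.kraus p.2 p.1 x‖) * h3
    refine h1.trans (mul_le_mul_of_nonneg_left ?_ (norm_nonneg _))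
    refine abs_le_of_sq_le_sq' ?_ (by positivity) |>.2
    refine (Finset.sum_mul_sq_le_sq_mul_sq _ _ _).trans_eq ?_
    simp only [mul_pow, Real.sq_sqrt (hw _)]
    rw [sum_norm_kraus_sq hc hτ, sum_norm_kraus_sq hc hτ]
  refine ContinuousLinearMap.opNorm_le_bound _ (norm_nonneg _) fun x => ?_
  have h := key x (M.heisenberg β A x)
  rw [inner_self_eq_norm_sq_to_K, norm_pow, RCLike.norm_ofReal, abs_norm] at h
  rcases (norm_nonneg (M.heisenberg β A x)).eq_or_lt with h0 | h0
  · rw [← h0]; positivity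
  · refine le_of_mul_le_mul_left ?_ h0
    linarith

theorem norm_heisenberg_iterate_le (hc : M.coupling ≠ 0) (hτ : 0 < M.τ) (β : ℝ)
    (A : Field →L[ℂ] Field) (n : ℕ) : ‖(M.heisenberg β)^[n] A‖ ≤ ‖A‖ := by
  induction n with
  | zero => rfl
  | succ n ih => rw [Function.iterate_succ_apply']; exact (norm_heisenberg_le hc hτ β _).trans ih

variable (M) in
/-- The Cesàro mean of the dynamics in the Heisenberg picture. -/
def heisenbergMean (β : ℝ) (A : Field →L[ℂ] Field) (N : ℕ) : Field →L[ℂ] Field :=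
  (1 / (N : ℂ)) • ∑ n ∈ Finset.Icc 1 N, (M.heisenberg β)^[n] A

theorem norm_mean_le {V : Type} [NormedAddCommGroup V] [NormedSpace ℂ V] {f : ℕ → V} {C : ℝ}
    (hC : 0 ≤ C) (hf : ∀ n, ‖f n‖ ≤ C) (N : ℕ) :
    ‖(1 / (N : ℂ)) • ∑ n ∈ Finset.Icc 1 N, f n‖ ≤ C := by
  -- For `N = 0` the convention `1 / 0 = 0` makes the mean vanish.
  rcases Nat.eq_zero_or_pos N with rfl | hN
  · simpa using hC
  have h1 : ‖∑ n ∈ Finset.Icc 1 N, f n‖ ≤ N * C := by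
    refine (norm_sum_le _ _).trans ((Finset.sum_le_sum fun n _ => hf n).trans_eq ?_)
    simp
  rw [norm_smul, norm_div, norm_one, Complex.norm_natCast]
  have hN' : (0 : ℝ) < N := by exact_mod_cast hN
  rw [one_div, inv_mul_le_iff₀ hN']
  exact h1

theorem norm_heisenbergMean_le (hc : M.coupling ≠ 0) (hτ : 0 < M.τ) (β : ℝ)
    (A : Field →L[ℂ] Field) (N : ℕ) : ‖M.heisenbergMean β A N‖ ≤ ‖A‖ :=
  norm_mean_le (norm_nonneg _) (norm_heisenberg_iterate_le hc hτ β A) N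

theorem cesaroMean_eq (hc : M.coupling ≠ 0) (hτ : 0 < M.τ) (β : ℝ) {ρ : Field →L[ℂ] Field}
    (h : IsState ρ) (A : Field →L[ℂ] Field) (N : ℕ) :
    cesaroMean (M.rdm β) ρ A N = expect ρ (M.heisenbergMean β A N) := by
  rw [cesaroMean, heisenbergMean, expect_smul, h.expect_sum]
  simp only [expect_rdm_iterate hc hτ β h]

theorem heisenbergMean_entry (β : ℝ) (A : Field →L[ℂ] Field) (N i j : ℕ) :
    M.heisenbergMean β A N (ket i) j =
      (1 / (N : ℂ)) • ∑ n ∈ Finset.Icc 1 N, (M.heisenberg β)^[n] A (ket i) j := by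
  rw [← inner_ket_left, heisenbergMean, _root_.smul_apply, _root_.sum_apply, inner_smul_right,
    inner_sum, smul_eq_mul]
  simp only [inner_ket_left]

/-- The difference telescopes to two boundary terms, of size at most `2 C / N`. -/
theorem tendsto_mean_succ_sub {f : ℕ → ℂ} {C : ℝ} (hf : ∀ n, ‖f n‖ ≤ C) :
    Tendsto (fun N : ℕ => (1 / (N : ℂ)) • ∑ n ∈ Finset.Icc 1 N, f (n + 1) -
      (1 / (N : ℂ)) • ∑ n ∈ Finset.Icc 1 N, f n) atTop (𝓝 0) := by
  have h1 : ∀ N : ℕ, ∑ n ∈ Finset.Icc 1 N, f (n + 1) - ∑ n ∈ Finset.Icc 1 N, f n =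
      f (N + 1) - f 1 := by
    intro N
    induction N with
    | zero => simp
    | succ N ih =>
      rw [Finset.sum_Icc_succ_top (by omega), Finset.sum_Icc_succ_top (by omega)]
      linear_combination ih
  have h2 : Tendsto (fun N : ℕ => 2 * C * ((N : ℝ))⁻¹) atTop (𝓝 0) := by
    simpa using (tendsto_inv_atTop_zero.comp tendsto_natCast_atTop_atTop).const_mul (2 * C)
  refine squeeze_zero_norm (fun N => ?_) h2
  rw [← smul_sub, h1, norm_smul, norm_div, norm_one, Complex.norm_natCast, one_div, mul_comm]
  gcongr
  exact (norm_sub_le _ _).trans (by linarith [hf (N + 1), hf 1])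

/-- Limit points of the Cesàro means on a diagonal are stationary. -/
theorem exists_stationary_limit (hc : M.coupling ≠ 0) (hτ : 0 < M.τ) (β : ℝ) (d : ℕ)
    (A : Field →L[ℂ] Field) {U : Ultrafilter ℕ} (hU : (U : Filter ℕ) ≤ atTop) :
    ∃ g : ℕ → ℂ, (∀ m, Tendsto (fun N => M.heisenbergMean β A N (ket m) (m + d)) U (𝓝 (g m))) ∧
      M.diagHeisenberg β d g = g ∧ ∀ m, ‖g m‖ ≤ ‖A‖ := by
  have hb : ∀ (T : Field →L[ℂ] Field) i j, ‖T (ket i) j‖ ≤ ‖T‖ := by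
    intro T i j
    rw [← inner_ket_left]
    refine (norm_inner_le_norm _ _).trans ?_
    have := T.le_opNorm (ket i)
    rw [norm_ket, mul_one] at this
    rwa [norm_ket, one_mul]
  have hcl : ∀ m, ∃ y ∈ Metric.closedBall (0 : ℂ) ‖A‖,
      Tendsto (fun N => M.heisenbergMean β A N (ket m) (m + d)) U (𝓝 y) := by
    intro m
    refine (isCompact_closedBall (0 : ℂ) ‖A‖).ultrafilter_le_nhds
      (U.map fun N => M.heisenbergMean β A N (ket m) (m + d)) ?_
    rw [Ultrafilter.coe_map, le_principal_iff, mem_map]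
    refine univ_mem' fun N => ?_
    rw [Set.mem_preimage, mem_closedBall_zero_iff]
    exact (hb _ _ _).trans (norm_heisenbergMean_le hc hτ β A N)
  choose g hg1 hg2 using hcl
  refine ⟨g, hg2, ?_, fun m => by simpa using hg1 m⟩
  ext m
  have h1 : Tendsto (fun N => M.diagHeisenberg β d
      (fun m => M.heisenbergMean β A N (ket m) (m + d)) m) U (𝓝 (M.diagHeisenberg β d g m)) := by
    simp only [diagHeisenberg_apply]
    exact (((hg2 m).const_mul _).add ((hg2 (m - 1)).const_mul _)).add ((hg2 (m + 1)).const_mul _)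
  -- One step of the dynamics shifts the sum by one index, and each row of `diagHeisenberg` involves
  -- only three entries, so stationarity survives the entrywise limit.
  have h2 : Tendsto (fun N => M.diagHeisenberg β d
      (fun m => M.heisenbergMean β A N (ket m) (m + d)) m -
      M.heisenbergMean β A N (ket m) (m + d)) U (𝓝 0) := by
    have h3 := (tendsto_mean_succ_sub (f := fun n => (M.heisenberg β)^[n] A (ket m) (m + d))
      (C := ‖A‖) fun n => (hb _ _ _).trans (norm_heisenberg_iterate_le hc hτ β A n)).mono_left hU
    refine h3.congr fun N => ?_
    rw [heisenbergMean_entry]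
    congr 1
    have e : (fun m => M.heisenbergMean β A N (ket m) (m + d)) = (1 / (N : ℂ)) •
        ∑ n ∈ Finset.Icc 1 N, fun m => (M.heisenberg β)^[n] A (ket m) (m + d) := by
      ext m
      rw [heisenbergMean_entry, Pi.smul_apply, Finset.sum_apply]
    rw [e, map_smul, map_sum, Pi.smul_apply, Finset.sum_apply]
    congr 1
    refine Finset.sum_congr rfl fun n _ => ?_
    rw [diagHeisenberg_entry hc hτ, Function.iterate_succ_apply']
  exact sub_eq_zero.1 (tendsto_nhds_unique (h1.sub (hg2 m)) h2)

end Maser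

/-! ### Diagonal operators: adjoints, positivity and norms -/

theorem adjoint_diagOp (f : ℕ → ℝ) (hf : ∃ C : ℝ, ∀ n, ‖(f n : ℂ)‖ ≤ C) :
    ContinuousLinearMap.adjoint (diagOp (fun n => (f n : ℂ)) hf) =
      diagOp (fun n => (f n : ℂ)) hf := by
  refine clm_ext_entry fun m n => ?_
  rw [adjoint_apply_ket, diagOp_apply, diagOp_apply, map_mul, Complex.conj_ofReal, ket_apply,
    ket_apply]
  by_cases h : m = n
  · subst h; simp
  · simp [h, Ne.symm h]

theorem isPositive_diagOp (f : ℕ → ℝ) (hf : ∃ C : ℝ, ∀ n, ‖(f n : ℂ)‖ ≤ C)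
    (h0 : ∀ n, 0 ≤ f n) : (diagOp (fun n => (f n : ℂ)) hf).IsPositive := by
  have hs : ∃ C : ℝ, ∀ n, ‖((√(f n) : ℝ) : ℂ)‖ ≤ C := by
    obtain ⟨C, hC⟩ := hf
    refine ⟨√C, fun n => ?_⟩
    rw [Complex.norm_real, Real.norm_eq_abs, abs_of_nonneg (Real.sqrt_nonneg _)]
    refine Real.sqrt_le_sqrt ((le_abs_self _).trans ?_)
    simpa using hC n
  have h := ContinuousLinearMap.isPositive_adjoint_comp_self
    (diagOp (fun n => ((√(f n) : ℝ) : ℂ)) hs)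
  rw [adjoint_diagOp] at h
  convert h using 1
  ext x n
  rw [ContinuousLinearMap.comp_apply, diagOp_apply, diagOp_apply, diagOp_apply, ← mul_assoc,
    ← Complex.ofReal_mul, Real.mul_self_sqrt (h0 n)]

theorem norm_diagOp_le (f : ℕ → ℂ) (hf : ∃ C : ℝ, ∀ n, ‖f n‖ ≤ C) {C : ℝ} (hC : 0 ≤ C)
    (h : ∀ n, ‖f n‖ ≤ C) : ‖diagOp f hf‖ ≤ C := by
  refine ContinuousLinearMap.opNorm_le_bound _ hC fun x => ?_
  have h1 : ‖(C : ℂ) • x‖ = C * ‖x‖ := by rw [norm_smul, Complex.norm_real, Real.norm_of_nonneg hC]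
  rw [← h1]
  refine lp.norm_mono (by norm_num) (fun n => ?_)
  change ‖f n * x n‖ ≤ ‖(C : ℂ) * x n‖
  rw [norm_mul, norm_mul, Complex.norm_real, Real.norm_of_nonneg hC]
  exact mul_le_mul_of_nonneg_right (h n) (norm_nonneg _)

namespace Maser

variable {M : Maser}

/-! ### Gibbs states -/

variable (M) in
/-- The normalized Boltzmann weights. -/
def gibbsWeight (b : ℝ) (I : Set ℕ) (n : ℕ) : ℝ := M.boltzmann b I n / ∑' m, M.boltzmann b I m

theorem gibbs_ket (b : ℝ) (I : Set ℕ) (n : ℕ) :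
    M.gibbs b I (ket n) = (M.gibbsWeight b I n : ℂ) • ket n :=
  diagOp_ket _ _ n

theorem gibbs_entry (b : ℝ) (I : Set ℕ) (m n : ℕ) :
    M.gibbs b I (ket n) m = if m = n then (M.gibbsWeight b I n : ℂ) else 0 := by
  rw [gibbs_ket]
  change (M.gibbsWeight b I n : ℂ) * (ket n : Field) m = _
  rw [ket_apply, mul_ite, mul_one, mul_zero]

theorem gibbsWeight_nonneg (b : ℝ) (I : Set ℕ) (n : ℕ) : 0 ≤ M.gibbsWeight b I n :=
  div_nonneg (M.boltzmann_nonneg b I n) (tsum_nonneg (M.boltzmann_nonneg b I))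

theorem gibbsWeight_of_notMem (b : ℝ) {I : Set ℕ} {n : ℕ} (h : n ∉ I) :
    M.gibbsWeight b I n = 0 := by
  simp [gibbsWeight, boltzmann, h]

theorem tsum_boltzmann_pos {b : ℝ} {I : Set ℕ} (hs : Summable (M.boltzmann b I))
    (hI : I.Nonempty) : 0 < ∑' m, M.boltzmann b I m := by
  obtain ⟨i, hi⟩ := hI
  exact hs.tsum_pos (M.boltzmann_nonneg b I) i (by simp [boltzmann, hi, Real.exp_pos])

theorem gibbsWeight_pos {b : ℝ} {I : Set ℕ} (hs : Summable (M.boltzmann b I)) {n : ℕ}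
    (hn : n ∈ I) : 0 < M.gibbsWeight b I n :=
  div_pos (by simp [boltzmann, hn, Real.exp_pos]) (tsum_boltzmann_pos hs ⟨n, hn⟩)

theorem hasSum_gibbsWeight {b : ℝ} {I : Set ℕ} (hs : Summable (M.boltzmann b I))
    (hI : I.Nonempty) : HasSum (M.gibbsWeight b I) 1 := by
  have := hs.hasSum.div_const (∑' m, M.boltzmann b I m)
  rwa [div_self (tsum_boltzmann_pos hs hI).ne'] at this

theorem isState_gibbs {b : ℝ} {I : Set ℕ} (hs : Summable (M.boltzmann b I))
    (hI : I.Nonempty) : IsState (M.gibbs b I) := by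
  refine ⟨isPositive_diagOp _ (M.gibbs_bounded b I) (M.gibbsWeight_nonneg b I), ?_⟩
  have h1 : HasSum (fun n => (M.gibbsWeight b I n : ℂ)) ((1 : ℝ) : ℂ) :=
    Complex.hasSum_ofReal.2 (hasSum_gibbsWeight hs hI)
  rw [Complex.ofReal_one] at h1
  refine h1.congr_fun fun n => ?_
  rw [inner_ket_left, gibbs_entry, if_pos rfl]

theorem gibbsWeight_le_one (b : ℝ) (I : Set ℕ) (n : ℕ) : M.gibbsWeight b I n ≤ 1 := by
  by_cases hs : Summable (M.boltzmann b I)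
  · exact div_le_one_of_le₀ (hs.le_tsum n (fun m _ => M.boltzmann_nonneg b I m))
      (tsum_nonneg (M.boltzmann_nonneg b I))
  · simp [gibbsWeight, tsum_eq_zero_of_not_summable hs]

theorem norm_gibbs_le_one (b : ℝ) (I : Set ℕ) : ‖M.gibbs b I‖ ≤ 1 := by
  refine norm_diagOp_le _ (M.gibbs_bounded b I) zero_le_one fun n => ?_
  rw [Complex.norm_real]
  exact (Real.norm_of_nonneg (M.gibbsWeight_nonneg b I n)).trans_le (M.gibbsWeight_le_one b I n)

theorem population_gibbs (b : ℝ) (I : Set ℕ) (n : ℕ) :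
    population (M.gibbs b I) n = M.gibbsWeight b I n := by
  rw [population, gibbs_entry, if_pos rfl, Complex.ofReal_re]

theorem expect_gibbs (b : ℝ) (I : Set ℕ) (A : Field →L[ℂ] Field) :
    expect (M.gibbs b I) A = ∑' n, (M.gibbsWeight b I n : ℂ) * A (ket n) n := by
  unfold expect
  refine tsum_congr fun n => ?_
  rw [inner_ket_left]
  rfl

theorem boltzmann_betaStar (hE : 0 < M.E) (β : ℝ) (I : Set ℕ) (n : ℕ) :
    M.boltzmann (M.betaStar β) I n = I.indicator (fun n => M.atomRatio β ^ n) n := by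
  unfold boltzmann
  congr 1
  ext n
  rw [atomRatio, ← Real.exp_nat_mul]
  congr 1
  have := hE.ne'
  unfold betaStar
  field_simp

theorem rabiIndices_succ (k : ℕ) : M.rabiIndices (k + 1) = M.sectorIndex ⁻¹' {k} := by
  ext n
  rw [mem_rabiIndices]
  simp

variable (M) in
/-- The trace of `exp(-β* h_S) P_k` is finite. -/
def IsNormalizable (β : ℝ) (k : ℕ) : Prop :=
  Summable (M.boltzmann (M.betaStar β) (M.rabiIndices k))

theorem isNormalizable_of_finite {β : ℝ} {k : ℕ} (h : (M.rabiIndices k).Finite) :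
    M.IsNormalizable β k :=
  summable_of_hasFiniteSupport (h.subset (Set.support_indicator_subset))

theorem isNormalizable_of_pos (hE : 0 < M.E) (hE₀ : 0 < M.E₀) {β : ℝ} (hβ : 0 < β) (k : ℕ) :
    M.IsNormalizable β k := by
  have h1 : M.atomRatio β < 1 := by
    rw [atomRatio, Real.exp_lt_one_iff]
    nlinarith
  refine Summable.of_nonneg_of_le (M.boltzmann_nonneg _ _) (fun n => ?_)
    (summable_geometric_of_lt_one (M.atomRatio_pos β).le h1)
  rw [boltzmann_betaStar hE]
  exact Set.indicator_le_self' (fun _ _ => pow_nonneg (M.atomRatio_pos β).le _) n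

/-- Gibbs states restricted to a Rabi sector are invariant. -/
theorem rdm_rabiGibbs (hE : 0 < M.E) (hc : M.coupling ≠ 0) (hτ : 0 < M.τ) (β : ℝ) (k : ℕ) :
    M.rdm β (M.rabiGibbs β k) = M.rabiGibbs β k := by
  set w := M.gibbsWeight (M.betaStar β) (M.rabiIndices k) with hw
  have he : ∀ m n, M.rabiGibbs β k (ket n) m = if m = n then (w n : ℂ) else 0 :=
    fun m n => gibbs_entry _ _ m n
  -- Detailed balance across a link: inside the sector the weights have ratio `γ`, and at its ends
  -- the link is broken.
  have hbal : ∀ m, M.exchangeAmp (m + 1) * starRingEnd ℂ (M.exchangeAmp (m + 1)) *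
      (M.atomPopulation β 0 * w (m + 1) - M.atomPopulation β 1 * w m) = 0 := by
    intro m
    by_cases h : M.exchangeAmp (m + 1) = 0
    · simp [h]
    · rw [exchangeAmp_eq_zero_iff hc hτ] at h
      push Not at h
      have h1 : m + 1 ∈ M.rabiIndices k ↔ m ∈ M.rabiIndices k := by
        rw [mem_rabiIndices, mem_rabiIndices, sectorIndex_succ_of_notMem h.2]
      have h2 : M.atomPopulation β 0 * w (m + 1) = M.atomPopulation β 1 * w m := by
        rw [hw, gibbsWeight, gibbsWeight, boltzmann_betaStar hE, boltzmann_betaStar hE,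
          atomPopulation_one]
        by_cases h3 : m ∈ M.rabiIndices k
        · rw [Set.indicator_of_mem h3, Set.indicator_of_mem (h1.2 h3)]
          ring
        · rw [Set.indicator_of_notMem h3, Set.indicator_of_notMem (fun h => h3 (h1.1 h))]
          ring
      have h3 : (M.atomPopulation β 0 : ℂ) * w (m + 1) = M.atomPopulation β 1 * w m := by
        exact_mod_cast h2
      rw [h3, sub_self, mul_zero]
  refine clm_ext_entry fun m n => ?_
  rw [rdm_entry hc hτ]
  simp only [he]
  by_cases hmn : m = n
  · subst hmn
    simp only [if_true]
    have h3 : (M.atomPopulation β 0 : ℂ) + M.atomPopulation β 1 = 1 := by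
      exact_mod_cast M.atomPopulation_sum β
    have h4 : M.exchangeAmp m * starRingEnd ℂ (M.exchangeAmp m) *
        (M.atomPopulation β 0 * w m - M.atomPopulation β 1 * w (m - 1)) = 0 := by
      rcases m with _ | m
      · simp [exchangeAmp_zero]
      · exact hbal m
    linear_combination hbal m - h4 + w m * ((M.atomPopulation β 0 : ℂ) *
      mul_conj_add_mul_conj hc hτ m + (M.atomPopulation β 1 : ℂ) * M.mul_conj_add_mul_conj' m + h3)
  · have h1 : ¬ m + 1 = n + 1 := by omega
    simp only [hmn, h1, if_false, mul_zero, zero_add]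
    rcases m with _ | m
    · simp [exchangeAmp_zero]
    rcases n with _ | n
    · simp [exchangeAmp_zero]
    have h2 : ¬ m = n := by omega
    simp [h2]

theorem rdm_iterate_rabiGibbs (hE : 0 < M.E) (hc : M.coupling ≠ 0) (hτ : 0 < M.τ) (β : ℝ)
    (k n : ℕ) : (M.rdm β)^[n] (M.rabiGibbs β k) = M.rabiGibbs β k :=
  Function.iterate_fixed (rdm_rabiGibbs hE hc hτ β k) n

theorem nonempty_rabiIndices (n : ℕ) : (M.rabiIndices (M.sectorIndex n + 1)).Nonempty := ⟨n, rfl⟩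

theorem expect_rabiGibbs_heisenbergMean (hE : 0 < M.E) (hc : M.coupling ≠ 0) (hτ : 0 < M.τ)
    {β : ℝ} {k : ℕ} (h : IsState (M.rabiGibbs β k)) (A : Field →L[ℂ] Field) {N : ℕ} (hN : 0 < N) :
    expect (M.rabiGibbs β k) (M.heisenbergMean β A N) = expect (M.rabiGibbs β k) A := by
  rw [← cesaroMean_eq hc hτ β h, cesaroMean]
  simp only [rdm_iterate_rabiGibbs hE hc hτ, Finset.sum_const, Nat.card_Icc, Nat.add_sub_cancel,
    nsmul_eq_mul]
  have : (N : ℂ) ≠ 0 := by exact_mod_cast hN.ne'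
  field_simp

/-! ### Convergence of the entries of the Cesàro means -/

theorem norm_entry_le (T : Field →L[ℂ] Field) (i j : ℕ) : ‖T (ket i) j‖ ≤ ‖T‖ := by
  rw [← inner_ket_left]
  refine (norm_inner_le_norm _ _).trans ?_
  have := T.le_opNorm (ket i)
  rw [norm_ket, mul_one] at this
  rwa [norm_ket, one_mul]

/-- Any limit point of the diagonal entries is constant on the sector of `i`. The constant is found
by averaging over the sector Gibbs state, under which the Cesàro means keep the same expectation;
this is where normalizability is needed. -/
theorem tendsto_heisenbergMean_self (hE : 0 < M.E) (hc : M.coupling ≠ 0) (hτ : 0 < M.τ) {β : ℝ}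
    {i : ℕ} (hi : M.IsNormalizable β (M.sectorIndex i + 1)) (A : Field →L[ℂ] Field) :
    Tendsto (fun N => M.heisenbergMean β A N (ket i) i) atTop
      (𝓝 (expect (M.rabiGibbs β (M.sectorIndex i + 1)) A)) := by
  rw [tendsto_iff_ultrafilter]
  intro U hU
  obtain ⟨g, hg, hfix, -⟩ := exists_stationary_limit hc hτ β 0 A hU
  simp only [add_zero] at hg
  set w := M.gibbsWeight (M.betaStar β) (M.rabiIndices (M.sectorIndex i + 1)) with hw
  have hI := M.nonempty_rabiIndices i
  have hstate : IsState (M.rabiGibbs β (M.sectorIndex i + 1)) := isState_gibbs hi hI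
  have hsum := hasSum_gibbsWeight hi hI
  -- The Gibbs weights are summable and the entries are bounded by `‖A‖`, so dominated convergence
  -- moves the limit inside.
  have h1 : Tendsto (fun N => ∑' n, (w n : ℂ) * M.heisenbergMean β A N (ket n) n) U
      (𝓝 (∑' n, (w n : ℂ) * g n)) := by
    refine tendsto_tsum_of_dominated_convergence (hsum.summable.mul_right ‖A‖)
      (fun n => (hg n).const_mul _) (Eventually.of_forall fun N n => ?_)
    rw [norm_mul, Complex.norm_real, Real.norm_of_nonneg (M.gibbsWeight_nonneg _ _ n)]
    exact mul_le_mul_of_nonneg_left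
      ((norm_entry_le _ n n).trans (norm_heisenbergMean_le hc hτ β A N))
      (M.gibbsWeight_nonneg _ _ n)
  have h2 : ∑' n, (w n : ℂ) * g n = g i := by
    have h3 : HasSum (fun n => (w n : ℂ)) ((1 : ℝ) : ℂ) := Complex.hasSum_ofReal.2 hsum
    have h4 := h3.mul_right (g i)
    rw [Complex.ofReal_one, one_mul] at h4
    rw [← h4.tsum_eq]
    refine tsum_congr fun n => ?_
    by_cases hn : n ∈ M.rabiIndices (M.sectorIndex i + 1)
    · rw [mem_rabiIndices] at hn
      rw [eq_of_sectorIndex_eq hc hτ hfix (by omega : M.sectorIndex n = M.sectorIndex i)]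
    · rw [hw, gibbsWeight_of_notMem _ hn]
      simp
  have h5 : Tendsto (fun N => ∑' n, (w n : ℂ) * M.heisenbergMean β A N (ket n) n) U
      (𝓝 (expect (M.rabiGibbs β (M.sectorIndex i + 1)) A)) := by
    refine tendsto_const_nhds.congr' ?_
    filter_upwards [hU (eventually_gt_atTop 0)] with N hN
    rw [← expect_rabiGibbs_heisenbergMean hE hc hτ hstate A hN]
    exact expect_gibbs _ _ _
  rw [← tendsto_nhds_unique h1 h5, h2]
  exact hg i

/-- In a normalizable sector the weights `γ ^ m` are summable, which supplies the decay that the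
peripheral eigenvector argument requires, even where `γ ≥ 1`. -/
theorem tendsto_pow_mul_indicator (hE : 0 < M.E) {β : ℝ} {i : ℕ}
    (hi : M.IsNormalizable β (M.sectorIndex i + 1)) (d b : ℕ) {g : ℕ → ℂ} {C : ℝ}
    (hg : ∀ m, ‖g m‖ ≤ C) :
    Tendsto (fun m => (M.atomRatio β : ℂ) ^ m *
      {m | M.sectorIndex m = M.sectorIndex i ∧ M.sectorIndex (m + d) = b}.indicator g m)
      atTop (𝓝 0) := by
  have h1 := (hi.tendsto_atTop_zero).mul_const C
  rw [zero_mul] at h1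
  have hC : 0 ≤ C := (norm_nonneg _).trans (hg 0)
  refine squeeze_zero_norm (fun m => ?_) h1
  rw [boltzmann_betaStar hE, norm_mul, norm_pow, Complex.norm_real,
    Real.norm_of_nonneg (M.atomRatio_pos β).le]
  by_cases hm : m ∈ {m | M.sectorIndex m = M.sectorIndex i ∧ M.sectorIndex (m + d) = b}
  · have hm' : m ∈ M.rabiIndices (M.sectorIndex i + 1) := by
      rw [mem_rabiIndices, hm.1]
    rw [Set.indicator_of_mem hm, Set.indicator_of_mem hm']
    exact mul_le_mul_of_nonneg_left (hg m) (pow_nonneg (M.atomRatio_pos β).le _)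
  · rw [Set.indicator_of_notMem hm, norm_zero, mul_zero]
    exact mul_nonneg (Set.indicator_nonneg (fun _ _ => pow_nonneg (M.atomRatio_pos β).le _) _) hC

theorem tendsto_heisenbergMean_add (hE : 0 < M.E) (hc : M.coupling ≠ 0) (hτ : 0 < M.τ) {β : ℝ}
    {i d : ℕ} (hd : 0 < d) (hi : M.IsNormalizable β (M.sectorIndex i + 1))
    (h : M.sectorIndex i = M.sectorIndex (i + d) ∨ ¬ M.IsDegenerate) (A : Field →L[ℂ] Field) :
    Tendsto (fun N => M.heisenbergMean β A N (ket i) (i + d)) atTop (𝓝 0) := by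
  rw [tendsto_iff_ultrafilter]
  intro U hU
  obtain ⟨g, hg, hfix, hbd⟩ := exists_stationary_limit hc hτ β d A hU
  -- Restricting to one pair of sectors commutes with the dynamics and discards levels outside the
  -- normalizable sector of `i`, where the weights may fail to decay.
  set S := {m | M.sectorIndex m = M.sectorIndex i ∧ M.sectorIndex (m + d) = M.sectorIndex (i + d)}
    with hS
  have hfix' : M.diagHeisenberg β d (S.indicator g) = S.indicator g := by
    rw [hS, diagHeisenberg_indicator hc hτ, hfix]
  have hlim := tendsto_pow_mul_indicator hE hi d (M.sectorIndex (i + d)) hbd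
  have h0 : S.indicator g = 0 := by
    rcases h with h | h
    · refine eq_zero_of_same_sector hc hτ hd (z := 1) (by simp) (by rwa [one_smul]) hlim ?_
      intro m hm
      have hmS : m ∈ S := Set.mem_of_indicator_ne_zero hm
      rw [hmS.1, hmS.2, h]
    · exact eq_zero_of_not_isDegenerate hc hτ h hd hfix' hlim
  have hi0 : g i = 0 := by
    have := congrFun h0 i
    rwa [Set.indicator_of_mem (show i ∈ S from ⟨rfl, rfl⟩)] at this
  rw [← hi0]
  exact hg i

theorem heisenberg_iterate_adjoint (hc : M.coupling ≠ 0) (hτ : 0 < M.τ) (β : ℝ)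
    (A : Field →L[ℂ] Field) (n : ℕ) :
    (M.heisenberg β)^[n] (ContinuousLinearMap.adjoint A) =
      ContinuousLinearMap.adjoint ((M.heisenberg β)^[n] A) := by
  induction n with
  | zero => rfl
  | succ n ih => rw [Function.iterate_succ_apply', ih, heisenberg_adjoint hc hτ,
      Function.iterate_succ_apply']

theorem heisenbergMean_adjoint_entry (hc : M.coupling ≠ 0) (hτ : 0 < M.τ) (β : ℝ)
    (A : Field →L[ℂ] Field) (N i j : ℕ) :
    M.heisenbergMean β A N (ket i) j =
      starRingEnd ℂ (M.heisenbergMean β (ContinuousLinearMap.adjoint A) N (ket j) i) := by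
  rw [heisenbergMean_entry, heisenbergMean_entry]
  simp [heisenberg_iterate_adjoint hc hτ, adjoint_apply_ket]

/-- Convergence of the Cesàro means for states that live on normalizable sectors without
stationary coherences. -/
theorem tendsto_cesaroMean (hE : 0 < M.E) (hc : M.coupling ≠ 0) (hτ : 0 < M.τ) {β : ℝ}
    {J : Set ℕ} (hJ : ∀ i ∈ J, M.IsNormalizable β (M.sectorIndex i + 1))
    (hJ' : ∀ i ∈ J, ∀ j ∈ J, M.sectorIndex i = M.sectorIndex j ∨ ¬ M.IsDegenerate)
    {ρ : Field →L[ℂ] Field} (hρ : IsState ρ) (hρJ : ∀ i ∉ J, population ρ i = 0)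
    (A : Field →L[ℂ] Field) :
    Tendsto (cesaroMean (M.rdm β) ρ A) atTop
      (𝓝 (∑' n, population ρ n * expect (M.rabiGibbs β (M.sectorIndex n + 1)) A)) := by
  set t : ℕ → ℂ := J.indicator fun n => expect (M.rabiGibbs β (M.sectorIndex n + 1)) A with ht
  have hlt : ∀ i ∈ J, ∀ j ∈ J, i < j → ∀ A,
      Tendsto (fun N => M.heisenbergMean β A N (ket i) j) atTop (𝓝 0) := by
    intro i hi j hj hij A
    obtain ⟨d, rfl⟩ : ∃ d, j = i + d := ⟨j - i, by omega⟩
    exact tendsto_heisenbergMean_add hE hc hτ (by omega) (hJ i hi) (hJ' i hi _ hj) A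
  have h := tendsto_expect (norm_heisenbergMean_le hc hτ β A) (J := J) (t := t)
    ⟨‖A‖, fun n => ?_⟩ (fun i hi => ?_) (fun i hi j hj hij => ?_) hρ hρJ
  · have e : ∑' n, population ρ n * expect (M.rabiGibbs β (M.sectorIndex n + 1)) A =
        ∑' n, population ρ n * t n := by
      refine tsum_congr fun n => ?_
      by_cases hn : n ∈ J
      · rw [ht, Set.indicator_of_mem hn]
      · rw [hρJ n hn]; simp
    rw [e]
    exact h.congr fun N => (cesaroMean_eq hc hτ β hρ A N).symm
  · by_cases hn : n ∈ J
    · rw [ht, Set.indicator_of_mem hn]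
      exact norm_expect_le (isState_gibbs (hJ n hn) (M.nonempty_rabiIndices n)) A
    · rw [ht, Set.indicator_of_notMem hn, norm_zero]
      exact norm_nonneg _
  · rw [ht, Set.indicator_of_mem hi]
    exact tendsto_heisenbergMean_self hE hc hτ (hJ i hi) A
  · rcases lt_or_gt_of_ne hij with h | h
    · exact hlt i hi j hj h A
    · have := (hlt j hj i hi h (ContinuousLinearMap.adjoint A)).star
      rw [star_zero] at this
      exact this.congr fun N => (heisenbergMean_adjoint_entry hc hτ β A N i j).symm

/-! ### Ergodicity of the sector Gibbs states -/

theorem apply_eq_zero_of_mem_closure_range {b : ℝ} {I : Set ℕ} {n : ℕ} (hn : n ∉ I) {x : Field}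
    (hx : x ∈ (LinearMap.range (M.gibbs b I).toLinearMap).topologicalClosure) : x n = 0 := by
  have hle : (LinearMap.range (M.gibbs b I).toLinearMap).topologicalClosure ≤
      LinearMap.ker (innerSL ℂ (ket n : Field)).toLinearMap := by
    refine Submodule.topologicalClosure_minimal _ ?_ (ContinuousLinearMap.isClosed_ker _)
    rintro _ ⟨y, rfl⟩
    change ⟪(ket n : Field), M.gibbs b I y⟫_ℂ = 0
    rw [inner_ket_left]
    change (M.gibbsWeight b I n : ℂ) * y n = 0
    rw [gibbsWeight_of_notMem b hn]
    simp
  have := hle hx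
  rw [← inner_ket_left]
  exact this

theorem population_eq_zero_of_supportProj_le {b : ℝ} {I : Set ℕ} {μ : Field →L[ℂ] Field}
    (h : supportProj μ ≤ supportProj (M.gibbs b I)) {n : ℕ} (hn : n ∉ I) :
    population μ n = 0 := by
  unfold supportProj at h
  rw [Submodule.starProjection_le_starProjection_iff] at h
  have h1 : μ (ket n) ∈ (LinearMap.range μ.toLinearMap).topologicalClosure :=
    Submodule.le_topologicalClosure _ ⟨ket n, rfl⟩
  rw [population, apply_eq_zero_of_mem_closure_range hn (h h1), Complex.zero_re]

/-- The support condition confines `μ` to one sector, and coherences inside a sector die out whether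
or not the system is degenerate. -/
theorem isErgodicState_rabiGibbs (hE : 0 < M.E) (hc : M.coupling ≠ 0) (hτ : 0 < M.τ) {β : ℝ}
    {k : ℕ} (hs : M.IsNormalizable β k) (hI : (M.rabiIndices k).Nonempty) :
    IsErgodicState (M.rdm β) (M.rabiGibbs β k) := by
  refine ⟨isState_gibbs hs hI, fun μ hμ hsupp A => ?_⟩
  have hpop : ∀ i ∉ M.rabiIndices k, population μ i = 0 := fun i hi =>
    population_eq_zero_of_supportProj_le hsupp hi
  have h := tendsto_cesaroMean hE hc hτ (J := M.rabiIndices k)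
    (fun i hi => by rw [mem_rabiIndices] at hi; rwa [hi])
    (fun i hi j hj => by rw [mem_rabiIndices] at hi hj; left; omega) hμ hpop A
  convert h using 2
  have h1 : HasSum (fun n => (population μ n : ℂ)) ((1 : ℝ) : ℂ) :=
    Complex.hasSum_ofReal.2 hμ.hasSum_population
  have h2 := h1.mul_right (expect (M.rabiGibbs β k) A)
  rw [Complex.ofReal_one, one_mul] at h2
  rw [← h2.tsum_eq]
  refine tsum_congr fun n => ?_
  by_cases hn : n ∈ M.rabiIndices k
  · rw [mem_rabiIndices] at hn
    rw [hn]
  · rw [hpop n hn]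
    simp

/-! ### Invariant states -/

/-- The factor `γ ^ m` cancels in the weighted diagonal, so the decay condition reduces to the
vanishing at infinity of the entries of a density matrix. No sign of `β` is involved. -/
theorem entry_eq_zero_of_invariant (hc : M.coupling ≠ 0) (hτ : 0 < M.τ) (hM : ¬ M.IsDegenerate)
    {β : ℝ} {ρ : Field →L[ℂ] Field} (hρ : IsInvariantState (M.rdm β) ρ) {m n : ℕ} (hmn : m ≠ n) :
    ρ (ket n) m = 0 := by
  have hγ : (M.atomRatio β : ℂ) ≠ 0 := by exact_mod_cast (M.atomRatio_pos β).ne'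
  have hlt : ∀ m n, m < n → ρ (ket n) m = 0 := by
    intro m n hmn
    obtain ⟨d, rfl⟩ : ∃ d, n = m + d := ⟨n - m, by omega⟩
    have h := congrFun (eq_zero_of_not_isDegenerate hc hτ hM (d := d) (by omega)
      (diagHeisenberg_of_invariant hc hτ hρ.2 d) (by
        simp only [mul_inv_cancel_left₀ (pow_ne_zero _ hγ)]
        exact hρ.1.tendsto_entry d)) m
    exact (mul_eq_zero.1 h).resolve_left (inv_ne_zero (pow_ne_zero _ hγ))
  rcases lt_or_gt_of_ne hmn with h | h
  · exact hlt m n h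
  · rw [hρ.1.entry_conj, hlt n m h, map_zero]

theorem population_of_invariant (hc : M.coupling ≠ 0) (hτ : 0 < M.τ)
    {β : ℝ} {ρ : Field →L[ℂ] Field} (hρ : IsInvariantState (M.rdm β) ρ) {m n : ℕ}
    (h : M.sectorIndex m = M.sectorIndex n) :
    population ρ m = M.atomRatio β ^ m * ((M.atomRatio β ^ n)⁻¹ * population ρ n) := by
  have hγ : (M.atomRatio β : ℂ) ≠ 0 := by exact_mod_cast (M.atomRatio_pos β).ne'
  have h1 := eq_of_sectorIndex_eq hc hτ (diagHeisenberg_of_invariant hc hτ hρ.2 0) h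
  simp only [add_zero, hρ.1.entry_self] at h1
  rw [inv_mul_eq_iff_eq_mul₀ (pow_ne_zero _ hγ)] at h1
  exact_mod_cast h1

/-- The weight `ρ(P_{k+1})` of the sector with index `k` in a state. -/
def sectorWeight (M : Maser) (ρ : Field →L[ℂ] Field) (k : ℕ) : ℝ :=
  ∑' n : M.sectorIndex ⁻¹' {k}, population ρ n

theorem hasSum_sectorWeight {ρ : Field →L[ℂ] Field} (hρ : IsState ρ) :
    HasSum (M.sectorWeight ρ) 1 :=
  hρ.hasSum_population.tsum_fiberwise M.sectorIndex

theorem sectorWeight_nonneg {ρ : Field →L[ℂ] Field} (hρ : IsState ρ) (k : ℕ) :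
    0 ≤ M.sectorWeight ρ k :=
  tsum_nonneg fun n => hρ.population_nonneg n

theorem sectorWeight_eq (hE : 0 < M.E) (hc : M.coupling ≠ 0) (hτ : 0 < M.τ)
    {β : ℝ} {ρ : Field →L[ℂ] Field} (hρ : IsInvariantState (M.rdm β) ρ) (n : ℕ) :
    M.sectorWeight ρ (M.sectorIndex n) = ((M.atomRatio β ^ n)⁻¹ * population ρ n) *
      ∑' m, M.boltzmann (M.betaStar β) (M.rabiIndices (M.sectorIndex n + 1)) m := by
  rw [sectorWeight, tsum_subtype, ← tsum_mul_left]
  refine tsum_congr fun m => ?_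
  rw [boltzmann_betaStar hE, rabiIndices_succ]
  by_cases hm : m ∈ M.sectorIndex ⁻¹' {M.sectorIndex n}
  · rw [Set.indicator_of_mem hm, Set.indicator_of_mem hm, population_of_invariant hc hτ hρ hm]
    ring
  · rw [Set.indicator_of_notMem hm, Set.indicator_of_notMem hm, mul_zero]

/-- On a sector the populations of an invariant state are proportional to `γ ^ m`; since they are
summable, a non-zero factor makes the Boltzmann weights summable. -/
theorem isNormalizable_of_population_ne_zero (hE : 0 < M.E) (hc : M.coupling ≠ 0) (hτ : 0 < M.τ)
    {β : ℝ} {ρ : Field →L[ℂ] Field} (hρ : IsInvariantState (M.rdm β) ρ) {n : ℕ}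
    (hn : population ρ n ≠ 0) : M.IsNormalizable β (M.sectorIndex n + 1) := by
  have h0 : (M.atomRatio β ^ n)⁻¹ * population ρ n ≠ 0 :=
    mul_ne_zero (inv_ne_zero (pow_ne_zero _ (M.atomRatio_pos β).ne')) hn
  have h1 := (hρ.1.hasSum_population.summable.indicator
    (M.rabiIndices (M.sectorIndex n + 1))).mul_left ((M.atomRatio β ^ n)⁻¹ * population ρ n)⁻¹
  refine h1.congr fun m => ?_
  rw [boltzmann_betaStar hE]
  by_cases hm : m ∈ M.rabiIndices (M.sectorIndex n + 1)
  · rw [Set.indicator_of_mem hm, Set.indicator_of_mem hm]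
    rw [mem_rabiIndices] at hm
    rw [population_of_invariant hc hτ hρ (by omega : M.sectorIndex m = M.sectorIndex n),
      mul_comm, mul_assoc, mul_inv_cancel₀ h0, mul_one]
  · rw [Set.indicator_of_notMem hm, Set.indicator_of_notMem hm, mul_zero]

theorem population_eq_sectorWeight_mul (hE : 0 < M.E) (hc : M.coupling ≠ 0) (hτ : 0 < M.τ)
    {β : ℝ} {ρ : Field →L[ℂ] Field} (hρ : IsInvariantState (M.rdm β) ρ) (n : ℕ) :
    population ρ n = M.sectorWeight ρ (M.sectorIndex n) *
      M.gibbsWeight (M.betaStar β) (M.rabiIndices (M.sectorIndex n + 1)) n := by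
  rw [sectorWeight_eq hE hc hτ hρ]
  by_cases hn : population ρ n = 0
  · simp [hn]
  have h1 := tsum_boltzmann_pos (isNormalizable_of_population_ne_zero hE hc hτ hρ hn)
    (M.nonempty_rabiIndices n)
  have h2 := pow_ne_zero n (M.atomRatio_pos β).ne'
  rw [gibbsWeight, boltzmann_betaStar hE (n := n), Set.indicator_of_mem (mem_rabiIndices.2 rfl)]
  field_simp

theorem exists_of_sectorWeight_ne_zero (hE : 0 < M.E) (hc : M.coupling ≠ 0) (hτ : 0 < M.τ)
    {β : ℝ} {ρ : Field →L[ℂ] Field} (hρ : IsInvariantState (M.rdm β) ρ) {k : ℕ}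
    (hk : M.sectorWeight ρ k ≠ 0) :
    M.IsNormalizable β (k + 1) ∧ (M.rabiIndices (k + 1)).Nonempty := by
  have h : ∃ n : M.sectorIndex ⁻¹' {k}, population ρ n ≠ 0 := by
    by_contra! h
    exact hk ((tsum_congr h).trans tsum_zero)
  obtain ⟨⟨n, hn⟩, h⟩ := h
  have h1 := isNormalizable_of_population_ne_zero hE hc hτ hρ h
  have hn' : M.sectorIndex n = k := hn
  rw [hn'] at h1
  exact ⟨h1, n, by rw [mem_rabiIndices, hn']⟩

/-- The series converges absolutely in operator norm, because the sector weights sum to 1 and the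
operators have norm at most 1 (a sector without Gibbs state contributes 0). The sum can then be
identified entry by entry. -/
theorem hasSum_smul_rabiGibbs (hE : 0 < M.E) (hc : M.coupling ≠ 0) (hτ : 0 < M.τ)
    (hM : ¬ M.IsDegenerate) {β : ℝ} {ρ : Field →L[ℂ] Field}
    (hρ : IsInvariantState (M.rdm β) ρ) :
    HasSum (fun k => (M.sectorWeight ρ k : ℂ) • M.rabiGibbs β (k + 1)) ρ := by
  have hs : Summable fun k => (M.sectorWeight ρ k : ℂ) • M.rabiGibbs β (k + 1) := by
    refine Summable.of_norm_bounded (hasSum_sectorWeight (M := M) hρ.1).summable fun k => ?_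
    rw [norm_smul, Complex.norm_real, Real.norm_of_nonneg (sectorWeight_nonneg hρ.1 k)]
    exact mul_le_of_le_one_right (sectorWeight_nonneg hρ.1 k) (norm_gibbs_le_one _ _)
  have key : ∑' k, (M.sectorWeight ρ k : ℂ) • M.rabiGibbs β (k + 1) = ρ := by
    refine clm_ext_entry fun m n => ?_
    have h1 := (hs.hasSum.mapL (ContinuousLinearMap.apply ℂ Field (ket n))).mapL
      (innerSL ℂ (ket m : Field))
    have h2 : ∀ T : Field →L[ℂ] Field, innerSL ℂ (ket m : Field)
        (ContinuousLinearMap.apply ℂ Field (ket n) T) = T (ket n) m := fun T =>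
      inner_ket_left m (T (ket n))
    simp only [h2] at h1
    refine h1.unique ?_
    have h3 : ∀ k, ((M.sectorWeight ρ k : ℂ) • M.rabiGibbs β (k + 1)) (ket n) m =
        if m = n then (M.sectorWeight ρ k : ℂ) *
          M.gibbsWeight (M.betaStar β) (M.rabiIndices (k + 1)) n else 0 := by
      intro k
      change (M.sectorWeight ρ k : ℂ) * M.rabiGibbs β (k + 1) (ket n) m = _
      rw [rabiGibbs, gibbs_entry, mul_ite, mul_zero]
    simp only [h3]
    by_cases hmn : m = n
    · subst hmn
      simp only [if_true]
      rw [hρ.1.entry_self, population_eq_sectorWeight_mul hE hc hτ hρ m, Complex.ofReal_mul]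
      refine hasSum_single (f := fun k => (M.sectorWeight ρ k : ℂ) *
          M.gibbsWeight (M.betaStar β) (M.rabiIndices (k + 1)) m) (M.sectorIndex m) fun k hk => ?_
      rw [gibbsWeight_of_notMem, Complex.ofReal_zero, mul_zero]
      rw [mem_rabiIndices]
      omega
    · simp only [hmn, if_false]
      rw [entry_eq_zero_of_invariant hc hτ hM hρ hmn]
      exact hasSum_zero
  have h := hs.hasSum
  rwa [key] at h

/-! ### Ergodic states -/

/-- Apply ergodicity to the state itself: the Cesàro means of `A` and of its Heisenberg image have
the same limit by telescoping. -/
theorem isInvariantState_of_isErgodicState (hc : M.coupling ≠ 0) (hτ : 0 < M.τ) {β : ℝ}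
    {ρ : Field →L[ℂ] Field} (hρ : IsErgodicState (M.rdm β) ρ) :
    IsInvariantState (M.rdm β) ρ := by
  refine ⟨hρ.1, eq_of_expect_eq fun A => ?_⟩
  rw [expect_rdm hρ.1]
  have h1 := hρ.2 ρ hρ.1 le_rfl A
  have h2 := hρ.2 ρ hρ.1 le_rfl (M.heisenberg β A)
  have h3 := tendsto_mean_succ_sub (f := fun n => expect ρ ((M.heisenberg β)^[n] A)) (C := ‖A‖)
    fun n => (norm_expect_le hρ.1 _).trans (norm_heisenberg_iterate_le hc hτ β A n)
  have h4 := h2.sub h1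
  refine sub_eq_zero.1 (tendsto_nhds_unique h4 (h3.congr fun N => ?_))
  simp only [cesaroMean, expect_rdm_iterate hc hτ β hρ.1, smul_eq_mul,
    Function.iterate_succ_apply]

/-- The Cesàro means of the invariant Gibbs state are constant, whereas ergodicity drives them to
the expectation in `ρ`. -/
theorem eq_of_isErgodicState (hE : 0 < M.E) (hc : M.coupling ≠ 0) (hτ : 0 < M.τ) {β : ℝ}
    {ρ : Field →L[ℂ] Field} (hρ : IsErgodicState (M.rdm β) ρ) {k : ℕ}
    (hk : IsState (M.rabiGibbs β k)) (h : supportProj (M.rabiGibbs β k) ≤ supportProj ρ) :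
    ρ = M.rabiGibbs β k := by
  refine eq_of_expect_eq fun A => tendsto_nhds_unique (hρ.2 _ hk h A) ?_
  refine tendsto_const_nhds.congr' ?_
  filter_upwards [eventually_gt_atTop 0] with N hN
  rw [cesaroMean_eq hc hτ β hk, expect_rabiGibbs_heisenbergMean hE hc hτ hk A hN]

theorem supportProj_gibbs_le {b : ℝ} {I : Set ℕ} {ρ : Field →L[ℂ] Field} {c : ℕ → ℂ}
    (hρ : ∀ n, ρ (ket n) = c n • ket n) (hc : ∀ n ∈ I, c n ≠ 0) :
    supportProj (M.gibbs b I) ≤ supportProj ρ := by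
  unfold supportProj
  rw [Submodule.starProjection_le_starProjection_iff]
  refine Submodule.topologicalClosure_minimal _ ?_ (Submodule.isClosed_topologicalClosure _)
  rintro _ ⟨x, rfl⟩
  change M.gibbs b I x ∈ (LinearMap.range ρ.toLinearMap).topologicalClosure
  refine (Submodule.isClosed_topologicalClosure _).mem_of_tendsto
    (hasSum_smul_ket (M.gibbs b I x)) (Eventually.of_forall fun s => ?_)
  refine Submodule.sum_mem _ fun n _ => ?_
  by_cases hn : n ∈ I
  · refine Submodule.smul_mem _ _ (Submodule.le_topologicalClosure _ ⟨(c n)⁻¹ • ket n, ?_⟩)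
    change ρ ((c n)⁻¹ • ket n) = _
    rw [map_smul, hρ, smul_smul, inv_mul_cancel₀ (hc n hn), one_smul]
  · have : M.gibbs b I x n = 0 := by
      change (M.gibbsWeight b I n : ℂ) * x n = 0
      rw [gibbsWeight_of_notMem b hn]
      simp
    rw [this, zero_smul]
    exact Submodule.zero_mem _

theorem apply_ket_of_invariant (hc : M.coupling ≠ 0) (hτ : 0 < M.τ) (hM : ¬ M.IsDegenerate)
    {β : ℝ} {ρ : Field →L[ℂ] Field} (hρ : IsInvariantState (M.rdm β) ρ) (n : ℕ) :
    ρ (ket n) = (population ρ n : ℂ) • ket n := by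
  ext m
  change _ = (population ρ n : ℂ) * (ket n : Field) m
  rw [ket_apply]
  by_cases h : m = n
  · subst h; rw [if_pos rfl, mul_one, hρ.1.entry_self]
  · rw [if_neg h, mul_zero, entry_eq_zero_of_invariant hc hτ hM hρ h]

/-- The ergodic states of a non-degenerate system. -/
theorem exists_eq_rabiGibbs_of_isErgodicState (hE : 0 < M.E) (hc : M.coupling ≠ 0) (hτ : 0 < M.τ)
    (hM : ¬ M.IsDegenerate) {β : ℝ} {ρ : Field →L[ℂ] Field} (hρ : IsErgodicState (M.rdm β) ρ) :
    ∃ k, M.IsNormalizable β (k + 1) ∧ (M.rabiIndices (k + 1)).Nonempty ∧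
      ρ = M.rabiGibbs β (k + 1) := by
  have hinv := isInvariantState_of_isErgodicState hc hτ hρ
  have h : ∃ k, M.sectorWeight ρ k ≠ 0 := by
    by_contra! h
    have h1 : HasSum (M.sectorWeight ρ) 0 := by
      rw [funext h]; exact hasSum_zero
    exact zero_ne_one (h1.unique (hasSum_sectorWeight hρ.1))
  obtain ⟨k, hk⟩ := h
  obtain ⟨h1, h2⟩ := exists_of_sectorWeight_ne_zero hE hc hτ hinv hk
  -- An invariant state is diagonal and positive on every level of a sector to which it gives
  -- weight, so it dominates that sector's Gibbs state.
  refine ⟨k, h1, h2, eq_of_isErgodicState hE hc hτ hρ (isState_gibbs h1 h2) ?_⟩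
  refine supportProj_gibbs_le (apply_ket_of_invariant hc hτ hM hinv) fun n hn => ?_
  have h3 := gibbsWeight_pos h1 hn
  rw [mem_rabiIndices] at hn
  rw [population_eq_sectorWeight_mul hE hc hτ hinv, hn]
  have hn' : M.sectorIndex n = k := by omega
  rw [hn']
  exact_mod_cast mul_ne_zero hk h3.ne'

theorem rabiGibbs_ne {β : ℝ} {k l : ℕ} (hs : M.IsNormalizable β k)
    (hI : (M.rabiIndices k).Nonempty) (hkl : k ≠ l) : M.rabiGibbs β k ≠ M.rabiGibbs β l := by
  obtain ⟨n, hn⟩ := hI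
  intro h
  have h1 := congrArg (fun T => population T n) h
  have h2 : n ∉ M.rabiIndices l := fun hn' => by
    rw [mem_rabiIndices] at hn hn'
    omega
  simp only [rabiGibbs, population_gibbs] at h1
  rw [gibbsWeight_of_notMem _ h2] at h1
  exact (gibbsWeight_pos hs hn).ne' h1

theorem expect_proj {ρ : Field →L[ℂ] Field} (hρ : IsState ρ) (I : Set ℕ) :
    expect ρ (proj I) = ∑' n : I, (population ρ n : ℂ) := by
  rw [tsum_subtype I fun n => (population ρ n : ℂ), proj, ← (hρ.hasSum_expect_diagOp _ _).tsum_eq]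
  refine tsum_congr fun n => ?_
  by_cases h : n ∈ I <;> simp [h]

/-- The sum over levels is regrouped by sectors; absolute summability comes from the bound `‖A‖` on
the Gibbs expectations. -/
theorem hasSum_expect_rabiProj_mul {β : ℝ} (hs : ∀ n, M.IsNormalizable β (M.sectorIndex n + 1))
    {ρ : Field →L[ℂ] Field} (hρ : IsState ρ) (A : Field →L[ℂ] Field) :
    HasSum (fun k : ℕ => expect ρ (M.rabiProj (k + 1)) * expect (M.rabiGibbs β (k + 1)) A)
      (∑' n, population ρ n * expect (M.rabiGibbs β (M.sectorIndex n + 1)) A) := by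
  have h1 : Summable fun n =>
      (population ρ n : ℂ) * expect (M.rabiGibbs β (M.sectorIndex n + 1)) A := by
    refine Summable.of_norm_bounded (hρ.hasSum_population.summable.mul_right ‖A‖) fun n => ?_
    rw [norm_mul, Complex.norm_real, Real.norm_of_nonneg (hρ.population_nonneg n)]
    exact mul_le_mul_of_nonneg_left (norm_expect_le
      (isState_gibbs (hs n) (M.nonempty_rabiIndices n)) A) (hρ.population_nonneg n)
  refine (h1.hasSum.tsum_fiberwise M.sectorIndex).congr_fun fun k => ?_
  rw [rabiProj, expect_proj hρ, rabiIndices_succ, ← tsum_mul_right]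
  refine tsum_congr fun n => ?_
  have : M.sectorIndex n = k := n.2
  rw [this]

/-! ### Classification by resonances -/

theorem not_isDegenerate_of_finite (h : M.resonances.Finite) : ¬ M.IsDegenerate :=
  fun h' => h'.1 h

theorem sectorIndex_of_isNonResonant (h : M.IsNonResonant) (n : ℕ) : M.sectorIndex n = 0 := by
  rw [← M.sectorIndex_zero]
  refine (sectorIndex_eq_of_forall (Nat.zero_le n) fun p _ _ hp => ?_).symm
  rw [h] at hp
  exact hp

theorem sectorIndex_of_lt {r : ℕ} (h : M.resonances = {r}) {n : ℕ} (hn : n < r) :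
    M.sectorIndex n = 0 := by
  rw [← M.sectorIndex_zero]
  refine (sectorIndex_eq_of_forall (Nat.zero_le n) fun p _ h2 hp => ?_).symm
  rw [h, Set.mem_singleton_iff] at hp
  omega

theorem sectorIndex_of_ge {r : ℕ} (h : M.resonances = {r}) {n : ℕ} (hn : r ≤ n) :
    M.sectorIndex n = 1 := by
  have hr : r ∈ M.resonances := by rw [h]; rfl
  obtain ⟨q, rfl⟩ : ∃ q, r = q + 1 := ⟨r - 1, by have := hr.1; omega⟩
  rw [← sectorIndex_eq_of_forall hn fun p h1 _ hp => ?_, sectorIndex_succ_of_mem hr,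
    sectorIndex_of_lt h (by omega)]
  rw [h, Set.mem_singleton_iff] at hp
  omega

/-- For `β ≤ 0` the weights are at least 1 on a sector that contains all large levels. -/
theorem not_isNormalizable (hE : 0 < M.E) (hE₀ : 0 < M.E₀) {β : ℝ} (hβ : β ≤ 0) {k r : ℕ}
    (hr : ∀ n, r ≤ n → n ∈ M.rabiIndices k) : ¬ M.IsNormalizable β k := by
  intro h
  have h1 : (1 : ℝ) ≤ M.atomRatio β := by
    rw [atomRatio, Real.one_le_exp_iff]
    nlinarith
  refine absurd (ge_of_tendsto h.tendsto_atTop_zero (b := 1) ?_) (by norm_num)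
  filter_upwards [eventually_ge_atTop r] with n hn
  rw [boltzmann_betaStar hE, Set.indicator_of_mem (hr n hn)]
  exact one_le_pow₀ h1

theorem exists_sectorIndex_eq (h : M.IsFullyResonant) (k : ℕ) : ∃ n, M.sectorIndex n = k := by
  induction k with
  | zero => exact ⟨0, M.sectorIndex_zero⟩
  | succ k ih =>
    classical
    obtain ⟨n, hn⟩ := ih
    have hex : ∃ p, p ∈ M.resonances ∧ n < p := h.exists_gt n
    obtain ⟨hp, hnp⟩ := Nat.find_spec hex
    obtain ⟨q, hq⟩ : ∃ q, Nat.find hex = q + 1 := ⟨Nat.find hex - 1, by omega⟩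
    rw [hq] at hp hnp
    refine ⟨q + 1, ?_⟩
    rw [sectorIndex_succ_of_mem hp, ← hn, ← sectorIndex_eq_of_forall (i := n) (j := q) (by omega)]
    exact fun p h1 h2 hp' => Nat.find_min hex (by omega) ⟨hp', h1⟩

theorem finite_rabiIndices (h : M.IsFullyResonant) (k : ℕ) : (M.rabiIndices k).Finite := by
  obtain ⟨N, hN⟩ := exists_sectorIndex_eq h (k + 1)
  refine (Set.finite_Iio N).subset fun n hn => ?_
  by_contra hlt
  have := M.sectorIndex_mono (not_lt.1 hlt)
  rw [mem_rabiIndices] at hn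
  omega

theorem nonempty_rabiIndices_of_isFullyResonant (h : M.IsFullyResonant) {k : ℕ} (hk : 1 ≤ k) :
    (M.rabiIndices k).Nonempty := by
  obtain ⟨n, hn⟩ := exists_sectorIndex_eq h (k - 1)
  exact ⟨n, by rw [mem_rabiIndices]; omega⟩

end Maser

/-! ### Exponential mixing -/

/-- Exponential decay of the iterates of a local operator on a finite invariant set. -/
theorem exists_norm_iterate_le {S : Set ℕ} (hS : S.Finite) (H : (ℕ → ℂ) →ₗ[ℂ] (ℕ → ℂ))
    (hH : ∀ f, H (S.indicator f) = S.indicator (H f))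
    (hz : ∀ z : ℂ, 1 ≤ ‖z‖ → ∀ f : ℕ → ℂ, (∀ m ∉ S, f m = 0) → H f = z • f → f = 0) :
    ∃ r : ℝ, 0 < r ∧ r < 1 ∧ ∀ f : ℕ → ℂ, ∃ C : ℝ, ∀ n : ℕ, ∀ m ∈ S,
      ‖H^[n] f m‖ ≤ C * r ^ n := by
  classical
  have := hS.fintype
  set ext : (S → ℂ) →ₗ[ℂ] (ℕ → ℂ) :=
    { toFun := fun v m => if h : m ∈ S then v ⟨m, h⟩ else 0
      map_add' := fun v w => by ext m; by_cases h : m ∈ S <;> simp [h]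
      map_smul' := fun c v => by ext m; by_cases h : m ∈ S <;> simp [h] } with hext
  set res : (ℕ → ℂ) →ₗ[ℂ] (S → ℂ) :=
    { toFun := fun f m => f m
      map_add' := fun _ _ => rfl
      map_smul' := fun _ _ => rfl } with hres
  have hext_apply : ∀ v m, ext v m = if h : m ∈ S then v ⟨m, h⟩ else 0 := fun _ _ => rfl
  have hext_res : ∀ f, ext (res f) = S.indicator f := by
    intro f
    ext m
    rw [hext_apply, Set.indicator_apply]
    rfl
  have hres_ext : ∀ v, res (ext v) = v := by
    intro v
    ext m
    change ext v m = v m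
    rw [hext_apply, dif_pos m.2]
  have hind_ext : ∀ v, S.indicator (ext v) = ext v := fun v => by
    rw [← hext_res, hres_ext]
  -- The compression of `H` to `S`. As `H` commutes with restriction to `S`, extension by zero
  -- intertwines `T` with `H`, so the eigenvectors of `T` are those of `H` supported on `S`.
  set T : Module.End ℂ (S → ℂ) := res ∘ₗ H ∘ₗ ext with hT
  have hextT : ∀ v, ext (T v) = H (ext v) := by
    intro v
    change ext (res (H (ext v))) = _
    rw [hext_res, ← hH, hind_ext]
  obtain ⟨r, h0, h1, h⟩ := exists_norm_pow_le T fun z hz1 v hv => by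
    have h2 : H (ext v) = z • ext v := by rw [← hextT, hv, map_smul]
    have h3 := hz z hz1 (ext v) (fun m hm => by rw [hext_apply, dif_neg hm]) h2
    rw [← hres_ext v, h3, map_zero]
  refine ⟨r, h0, h1, fun f => ?_⟩
  obtain ⟨C, hC⟩ := h (res f)
  refine ⟨C, fun n m hm => ?_⟩
  have hpow : ∀ n : ℕ, S.indicator (H^[n] f) = ext ((T ^ n) (res f)) := by
    intro n
    induction n with
    | zero => exact (hext_res f).symm
    | succ n ih =>
      rw [Function.iterate_succ_apply', ← hH, ih, ← hextT, pow_succ', Module.End.mul_apply]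
  have h2 : H^[n] f m = (T ^ n) (res f) ⟨m, hm⟩ := by
    have := congrFun (hpow n) m
    rwa [Set.indicator_of_mem hm, hext_apply, dif_pos hm] at this
  rw [h2]
  exact (norm_le_pi_norm _ _).trans (hC n)

/-- In a state that is supported by finitely many levels, expectations are controlled by finitely
many entries. -/
theorem norm_expect_le_sum {ρ : Field →L[ℂ] Field} (h : IsState ρ) (F : Finset ℕ)
    (hF : ∀ i ∉ F, population ρ i = 0) (D : Field →L[ℂ] Field) :
    ‖expect ρ D‖ ≤ ∑ i ∈ F, ∑ j ∈ F, ‖D (ket i) j‖ := by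
  obtain ⟨S, hS, hSS, hs⟩ := h.exists_sqrt
  have h1 := hs.mul_left (∑ i ∈ F, ∑ j ∈ F, ‖D (ket i) j‖)
  rw [mul_one] at h1
  rw [← (hasSum_expect_of_sqrt hS hSS hs.summable D).tsum_eq]
  refine tsum_of_norm_bounded h1 fun m => ?_
  set x : Field := S (ket m) with hx
  have hx0 : ∀ i ∉ F, x i = 0 := fun i hi => sqrt_ket_eq_zero hS hSS (hF i hi) m
  have hsum : ∑ i ∈ F, x i • (ket i : Field) = x := by
    refine HasSum.unique (hasSum_sum_of_ne_finset_zero fun i hi => ?_) (hasSum_smul_ket x)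
    rw [hx0 i hi, zero_smul]
  have hxi : ∀ i, ‖x i‖ ≤ ‖x‖ := fun i => by
    rw [← inner_ket_left]
    refine (norm_inner_le_norm _ _).trans ?_
    rw [norm_ket, one_mul]
  have e : ⟪x, D x⟫_ℂ = ∑ i ∈ F, ∑ j ∈ F, x i * (starRingEnd ℂ (x j) * D (ket i) j) := by
    conv_lhs => rw [← hsum]
    rw [map_sum, inner_sum]
    refine Finset.sum_congr rfl fun i _ => ?_
    rw [map_smul, inner_smul_right, sum_inner, Finset.mul_sum]
    refine Finset.sum_congr rfl fun j _ => ?_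
    rw [inner_smul_left, inner_ket_left]
  rw [e, Finset.sum_mul]
  refine (norm_sum_le _ _).trans (Finset.sum_le_sum fun i _ => ?_)
  rw [Finset.sum_mul]
  refine (norm_sum_le _ _).trans (Finset.sum_le_sum fun j _ => ?_)
  rw [norm_mul, norm_mul, RCLike.norm_conj]
  have h2 : ‖x i‖ * ‖x j‖ ≤ ‖x‖ * ‖x‖ :=
    mul_le_mul (hxi i) (hxi j) (norm_nonneg _) (norm_nonneg _)
  nlinarith [norm_nonneg (D (ket i) j)]

namespace Maser

variable {M : Maser}

theorem tendsto_of_finite_support {f g : ℕ → ℂ} {S : Set ℕ} (hS : S.Finite)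
    (hf : ∀ m ∉ S, f m = 0) : Tendsto (fun m => g m * f m) atTop (𝓝 0) := by
  refine tendsto_const_nhds.congr' ?_
  obtain ⟨B, hB⟩ := hS.bddAbove
  filter_upwards [eventually_gt_atTop B] with m hm
  rw [hf m fun h => by have := hB h; omega, mul_zero]

/-- Off the main diagonal a finite sector has no eigenvector with eigenvalue outside the open unit
disk; the decay condition is trivial for finite support. -/
theorem exists_decay_add (hc : M.coupling ≠ 0) (hτ : 0 < M.τ) (β : ℝ) {k : ℕ}
    (hk : (M.rabiIndices (k + 1)).Finite) {d : ℕ} (hd : 0 < d) :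
    ∃ r : ℝ, 0 < r ∧ r < 1 ∧ ∀ A : Field →L[ℂ] Field, ∃ C : ℝ, ∀ n : ℕ, ∀ i,
      M.sectorIndex i = k ∧ M.sectorIndex (i + d) = k →
      ‖(M.heisenberg β)^[n] A (ket i) (i + d)‖ ≤ C * r ^ n := by
  have hS : {m | M.sectorIndex m = k ∧ M.sectorIndex (m + d) = k}.Finite :=
    hk.subset fun m hm => by rw [mem_rabiIndices, hm.1]
  obtain ⟨r, h0, h1, h⟩ := exists_norm_iterate_le hS (M.diagHeisenberg β d)
    (diagHeisenberg_indicator hc hτ β d k k) fun z hz f hf hfz =>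
      eq_zero_of_same_sector hc hτ hd hz hfz (tendsto_of_finite_support hS hf) fun m hm => by
        by_contra hne
        exact hm (hf m fun hmS => hne (by rw [hmS.1, hmS.2]))
  refine ⟨r, h0, h1, fun A => ?_⟩
  obtain ⟨C, hC⟩ := h fun m => A (ket m) (m + d)
  refine ⟨C, fun n i hi => ?_⟩
  have := hC n i hi
  rwa [diagHeisenberg_iterate hc hτ] at this

theorem expect_rabiGibbs_heisenberg (hE : 0 < M.E) (hc : M.coupling ≠ 0) (hτ : 0 < M.τ) {β : ℝ}
    {k : ℕ} (h : IsState (M.rabiGibbs β k)) (A : Field →L[ℂ] Field) :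
    expect (M.rabiGibbs β k) (M.heisenberg β A) = expect (M.rabiGibbs β k) A := by
  rw [← expect_rdm h, rdm_rabiGibbs hE hc hτ]

/-- The constants are stationary, so the rank-one operator formed from the Gibbs functional `ω` and
the constant function is subtracted. This leaves the orbit of an observable of zero Gibbs
expectation unchanged and removes the eigenvalue 1. -/
theorem exists_decay_self (hE : 0 < M.E) (hc : M.coupling ≠ 0) (hτ : 0 < M.τ) (β : ℝ) {k : ℕ}
    (hk : (M.rabiIndices (k + 1)).Finite) (hstate : IsState (M.rabiGibbs β (k + 1)))
    (hI : (M.rabiIndices (k + 1)).Nonempty) :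
    ∃ r : ℝ, 0 < r ∧ r < 1 ∧ ∀ A : Field →L[ℂ] Field, expect (M.rabiGibbs β (k + 1)) A = 0 →
      ∃ C : ℝ, ∀ n : ℕ, ∀ i, M.sectorIndex i = k →
      ‖(M.heisenberg β)^[n] A (ket i) i‖ ≤ C * r ^ n := by
  classical
  set I := M.rabiIndices (k + 1) with hIdef
  have hmem : ∀ m, m ∈ I ↔ M.sectorIndex m = k := fun m => by
    rw [hIdef, rabiIndices_succ]; rfl
  have hIset : I = {m | M.sectorIndex m = k ∧ M.sectorIndex (m + 0) = k} := by
    ext m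
    rw [hmem]
    simp
  set w := M.gibbsWeight (M.betaStar β) I with hw
  have hw0 : ∀ m ∉ I, w m = 0 := fun m hm => gibbsWeight_of_notMem _ hm
  set ω : (ℕ → ℂ) →ₗ[ℂ] ℂ := ∑ m ∈ hk.toFinset, (w m : ℂ) • LinearMap.proj m with hω
  have hω_apply : ∀ f, ω f = ∑ m ∈ hk.toFinset, (w m : ℂ) * f m := fun f => by
    rw [hω, LinearMap.sum_apply]; rfl
  have hω_expect : ∀ A : Field →L[ℂ] Field,
      ω (fun m => A (ket m) (m + 0)) = expect (M.rabiGibbs β (k + 1)) A := by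
    intro A
    rw [hω_apply, rabiGibbs, expect_gibbs, tsum_eq_sum (s := hk.toFinset)]
    · rfl
    · intro m hm
      rw [Set.Finite.mem_toFinset] at hm
      rw [gibbsWeight_of_notMem _ hm, Complex.ofReal_zero, zero_mul]
  have hω_ind : ∀ f, ω (I.indicator f) = ω f := by
    intro f
    rw [hω_apply, hω_apply]
    refine Finset.sum_congr rfl fun m hm => ?_
    rw [Set.indicator_of_mem (hk.mem_toFinset.1 hm)]
  have hω_one : ω (I.indicator 1) = 1 := by
    have h := (hasSum_gibbsWeight (isNormalizable_of_finite (β := β) hk) hI).tsum_eq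
    rw [hω_ind, hω_apply]
    rw [tsum_eq_sum (s := hk.toFinset) (fun m hm => hw0 m (by simpa using hm))] at h
    simp only [Pi.one_apply, mul_one]
    exact_mod_cast h
  have hω_dyn : ∀ f : ℕ → ℂ, (∀ m ∉ I, f m = 0) → ω (M.diagHeisenberg β 0 f) = ω f := by
    intro f hf
    have hb : ∃ C : ℝ, ∀ n, ‖f n‖ ≤ C := by
      refine ⟨∑ m ∈ hk.toFinset, ‖f m‖, fun n => ?_⟩
      by_cases hn : n ∈ I
      · exact Finset.single_le_sum (f := fun m => ‖f m‖) (fun _ _ => norm_nonneg _)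
          (hk.mem_toFinset.2 hn)
      · rw [hf n hn, norm_zero]
        exact Finset.sum_nonneg fun _ _ => norm_nonneg _
    have e : f = fun m => diagOp f hb (ket m) (m + 0) := by
      ext m
      rw [diagOp_apply, ket_apply, if_pos (add_zero m), mul_one, add_zero]
    rw [e, diagHeisenberg_entry hc hτ, hω_expect, hω_expect,
      expect_rabiGibbs_heisenberg hE hc hτ hstate]
  set H : (ℕ → ℂ) →ₗ[ℂ] (ℕ → ℂ) := M.diagHeisenberg β 0 - ω.smulRight (I.indicator 1) with hH
  have hH_apply : ∀ f, H f = M.diagHeisenberg β 0 f - ω f • I.indicator 1 := fun f => rfl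
  have hind : ∀ f, M.diagHeisenberg β 0 (I.indicator f) =
      I.indicator (M.diagHeisenberg β 0 f) := by
    rw [hIset]
    exact diagHeisenberg_indicator hc hτ β 0 k k
  obtain ⟨r, h0, h1, h⟩ := exists_norm_iterate_le hk H
    (fun f => by
      rw [hH_apply, hH_apply, hω_ind, hind]
      ext m
      by_cases hm : m ∈ I <;> simp [hm])
    fun z hz f hf hfz => by
      have hz0 : z ≠ 0 := by rintro rfl; simp at hz; linarith
      rw [hH_apply] at hfz
      -- Applying `ω` to the eigenvalue equation gives `z * ω f = ω f - ω f = 0`, since `ω` is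
      -- invariant and normalized.
      have hωf : ω f = 0 := by
        have h2 := congrArg ω hfz
        rw [map_sub, map_smul, map_smul, hω_one, hω_dyn f hf, smul_eq_mul, smul_eq_mul, mul_one,
          sub_self, eq_comm, mul_eq_zero] at h2
        exact h2.resolve_left hz0
      rw [hωf, zero_smul, sub_zero] at hfz
      have hlim : Tendsto (fun m => (M.atomRatio β : ℂ) ^ m * f m) atTop (𝓝 0) :=
        tendsto_of_finite_support hk hf
      by_contra hne
      obtain ⟨m, hm⟩ := Function.ne_iff.1 hne
      obtain ⟨m₀, -, g1, g2, -⟩ :=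
        exists_bottom hc hτ (fun m hm => (peripheralAt hc hτ hz hfz hlim hm).down) hm
      have g3 := (peripheralAt hc hτ hz hfz hlim g1).phase_ground
      -- At the bottom of the sector the ground amplitude has modulus 1, which forces `z = 1`. Then
      -- `f` is constant on the sector, and `ω f = 0` makes the constant vanish.
      have g4 := mul_conj_add_mul_conj hc hτ m₀
      rw [g2, zero_mul, add_zero] at g4
      rw [add_zero, g4, norm_one, Complex.ofReal_one, one_mul] at g3
      rw [← g3, one_smul] at hfz
      have hmI : m ∈ I := by
        by_contra hmI
        exact hm (hf m hmI)
      have hconst : f = f m • I.indicator 1 := by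
        ext j
        by_cases hj : j ∈ I
        · rw [Pi.smul_apply, Set.indicator_of_mem hj, Pi.one_apply, smul_eq_mul, mul_one]
          exact eq_of_sectorIndex_eq hc hτ hfz (((hmem j).1 hj).trans ((hmem m).1 hmI).symm)
        · rw [Pi.smul_apply, Set.indicator_of_notMem hj, smul_zero, hf j hj]
      rw [hconst, map_smul, hω_one, smul_eq_mul, mul_one] at hωf
      exact hm hωf
  refine ⟨r, h0, h1, fun A hA => ?_⟩
  obtain ⟨C, hC⟩ := h fun m => A (ket m) (m + 0)
  refine ⟨C, fun n i hi => ?_⟩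
  have hzero : ∀ n, expect (M.rabiGibbs β (k + 1)) ((M.heisenberg β)^[n] A) = 0 := by
    intro n
    rw [← expect_rdm_iterate hc hτ β hstate, rdm_iterate_rabiGibbs hE hc hτ, hA]
  have hiter : ∀ n, H^[n] (fun m => A (ket m) (m + 0)) =
      fun m => (M.heisenberg β)^[n] A (ket m) (m + 0) := by
    intro n
    induction n with
    | zero => rfl
    | succ n ih =>
      rw [Function.iterate_succ_apply', ih, hH_apply, hω_expect, hzero, zero_smul, sub_zero,
        diagHeisenberg_entry hc hτ, Function.iterate_succ_apply']
  have := hC n i ((hmem i).2 hi)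
  rw [hiter] at this
  exact this

theorem exists_decay (hE : 0 < M.E) (hc : M.coupling ≠ 0) (hτ : 0 < M.τ) (β : ℝ) {k : ℕ}
    (hk : (M.rabiIndices (k + 1)).Finite) (hstate : IsState (M.rabiGibbs β (k + 1)))
    (hI : (M.rabiIndices (k + 1)).Nonempty) :
    ∃ r : ℝ, 0 < r ∧ r < 1 ∧ ∀ A : Field →L[ℂ] Field, expect (M.rabiGibbs β (k + 1)) A = 0 →
      ∀ i j, i ∈ M.rabiIndices (k + 1) → j ∈ M.rabiIndices (k + 1) →
      ∃ C : ℝ, ∀ n : ℕ, ‖(M.heisenberg β)^[n] A (ket i) j‖ ≤ C * r ^ n := by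
  have key : ∀ d, ∃ r : ℝ, 0 < r ∧ r < 1 ∧ ∀ A : Field →L[ℂ] Field,
      (d = 0 → expect (M.rabiGibbs β (k + 1)) A = 0) → ∃ C : ℝ, ∀ n : ℕ, ∀ i,
      M.sectorIndex i = k ∧ M.sectorIndex (i + d) = k →
      ‖(M.heisenberg β)^[n] A (ket i) (i + d)‖ ≤ C * r ^ n := by
    intro d
    rcases Nat.eq_zero_or_pos d with rfl | hd
    · obtain ⟨r, h0, h1, h⟩ := exists_decay_self hE hc hτ β hk hstate hI
      refine ⟨r, h0, h1, fun A hA => ?_⟩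
      obtain ⟨C, hC⟩ := h A (hA rfl)
      exact ⟨C, fun n i hi => hC n i hi.1⟩
    · obtain ⟨r, h0, h1, h⟩ := exists_decay_add hc hτ β hk hd
      exact ⟨r, h0, h1, fun A _ => h A⟩
  choose r h0 h1 h using key
  obtain ⟨B, hB⟩ := hk.bddAbove
  -- Only finitely many diagonals meet the sector, so the slowest of their rates serves for all
  -- entries.
  obtain ⟨d₀, -, hd₀⟩ := (Finset.range (B + 1)).exists_max_image r ⟨0, by simp⟩
  have hmem : ∀ m, m ∈ M.rabiIndices (k + 1) ↔ M.sectorIndex m = k := fun m => by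
    rw [rabiIndices_succ]; rfl
  have hle : ∀ A : Field →L[ℂ] Field, ∀ i d,
      (d = 0 → expect (M.rabiGibbs β (k + 1)) A = 0) → i ∈ M.rabiIndices (k + 1) →
      i + d ∈ M.rabiIndices (k + 1) →
      ∃ C : ℝ, ∀ n : ℕ, ‖(M.heisenberg β)^[n] A (ket i) (i + d)‖ ≤ C * r d₀ ^ n := by
    intro A i d hA hi hj
    obtain ⟨C, hC⟩ := h d A hA
    have hdB : d ≤ B := by have := hB hj; omega
    refine ⟨|C|, fun n => (hC n i ⟨(hmem _).1 hi, (hmem _).1 hj⟩).trans ?_⟩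
    have h2 := hd₀ d (by simp; omega)
    have h3 := (h0 d).le
    gcongr
    exact le_abs_self C
  refine ⟨r d₀, h0 d₀, h1 d₀, fun A hA i j hi hj => ?_⟩
  rcases le_total i j with hij | hij
  · obtain ⟨d, rfl⟩ := Nat.exists_eq_add_of_le hij
    exact hle A i d (fun _ => hA) hi hj
  · obtain ⟨d, rfl⟩ := Nat.exists_eq_add_of_le hij
    rcases Nat.eq_zero_or_pos d with rfl | hd
    · exact hle A j 0 (fun _ => hA) hj hi
    · obtain ⟨C, hC⟩ := hle (ContinuousLinearMap.adjoint A) j d (fun h => by omega) hj hi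
      refine ⟨C, fun n => (hC n).trans' (le_of_eq ?_)⟩
      rw [heisenberg_iterate_adjoint hc hτ, adjoint_apply_ket, RCLike.norm_conj]

theorem isExpMixingState_rabiGibbs (hE : 0 < M.E) (hc : M.coupling ≠ 0) (hτ : 0 < M.τ) (β : ℝ)
    {k : ℕ} (hk : (M.rabiIndices (k + 1)).Finite) (hI : (M.rabiIndices (k + 1)).Nonempty) :
    IsExpMixingState (M.rdm β) (M.rabiGibbs β (k + 1)) := by
  have hstate : IsState (M.rabiGibbs β (k + 1)) := isState_gibbs (isNormalizable_of_finite hk) hI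
  obtain ⟨r, h0, h1, h⟩ := exists_decay hE hc hτ β hk hstate hI
  refine ⟨hstate, -Real.log r, by have := Real.log_neg h0 h1; linarith, fun μ hμ hsupp A => ?_⟩
  set c := expect (M.rabiGibbs β (k + 1)) A with hcdef
  -- Subtracting the Gibbs expectation makes `exists_decay` applicable; as states have trace 1, the
  -- expectations of `A'` are exactly the deviations to be estimated.
  set A' : Field →L[ℂ] Field := A - c • 1 with hA'
  have hexp : ∀ ν, IsState ν → expect ν A' = expect ν A - c := fun ν hν => by
    rw [hA', hν.expect_sub, expect_smul, expect_one hν, mul_one]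
  have hA0 : expect (M.rabiGibbs β (k + 1)) A' = 0 := by rw [hexp _ hstate, sub_self]
  have hpop : ∀ i ∉ hk.toFinset, population μ i = 0 := fun i hi =>
    population_eq_zero_of_supportProj_le hsupp (by simpa using hi)
  have h2 : ∀ i j, ∃ C : ℝ, i ∈ hk.toFinset → j ∈ hk.toFinset →
      ∀ n : ℕ, ‖(M.heisenberg β)^[n] A' (ket i) j‖ ≤ C * r ^ n := by
    intro i j
    by_cases hij : i ∈ hk.toFinset ∧ j ∈ hk.toFinset
    · obtain ⟨C, hC⟩ := h A' hA0 i j (hk.mem_toFinset.1 hij.1) (hk.mem_toFinset.1 hij.2)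
      exact ⟨C, fun _ _ => hC⟩
    · exact ⟨0, fun hi hj => absurd ⟨hi, hj⟩ hij⟩
  choose C hC using h2
  refine ⟨∑ i ∈ hk.toFinset, ∑ j ∈ hk.toFinset, C i j, fun n => ?_⟩
  have h3 : Real.exp (- -Real.log r * n) = r ^ n := by
    rw [neg_neg, mul_comm, Real.exp_nat_mul, Real.exp_log h0]
  rw [h3, ← hexp _ (isState_rdm_iterate hc hτ β hμ n), expect_rdm_iterate hc hτ β hμ,
    Finset.sum_mul]
  refine (norm_expect_le_sum hμ hk.toFinset hpop _).trans (Finset.sum_le_sum fun i hi => ?_)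
  rw [Finset.sum_mul]
  exact Finset.sum_le_sum fun j hj => hC i j hi hj n

theorem rabiProj_ket {n k : ℕ} (h : n ∈ M.rabiIndices k) : M.rabiProj k (ket n) = ket n := by
  rw [rabiProj, proj, diagOp_ket, Set.indicator_of_mem h, one_smul]

theorem finite_rabiIndices_of_finiteDimensional {k : ℕ}
    (h : FiniteDimensional ℂ (M.rabiSector k)) : (M.rabiIndices k).Finite := by
  have h1 : LinearIndependent ℂ fun n : M.rabiIndices k =>
      (⟨ket n, ket n, rabiProj_ket n.2⟩ : M.rabiSector k) := by
    refine LinearIndependent.of_comp (M.rabiSector k).subtype ?_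
    exact (orthonormal_ket.linearIndependent).comp _ Subtype.val_injective
  have := h1.finite
  exact Set.toFinite _

theorem nonempty_of_isState_rabiGibbs {β : ℝ} {k : ℕ} (h : IsState (M.rabiGibbs β k)) :
    (M.rabiIndices k).Nonempty := by
  by_contra hne
  rw [Set.not_nonempty_iff_eq_empty] at hne
  have h1 := h.hasSum_population
  have h2 : population (M.rabiGibbs β k) = fun _ => 0 := by
    ext n
    rw [rabiGibbs, population_gibbs, gibbsWeight_of_notMem _ (by rw [hne]; exact Set.notMem_empty n)]
  rw [h2] at h1
  exact zero_ne_one (hasSum_zero.unique h1)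

/-! ### The theorem by resonance type -/

theorem tendsto_cesaroMean_of_not_isDegenerate (hE : 0 < M.E) (hc : M.coupling ≠ 0)
    (hτ : 0 < M.τ) (hM : ¬ M.IsDegenerate) {β : ℝ}
    (hs : ∀ n, M.IsNormalizable β (M.sectorIndex n + 1)) {ρ : Field →L[ℂ] Field}
    (hρ : IsState ρ) (A : Field →L[ℂ] Field) :
    Tendsto (cesaroMean (M.rdm β) ρ A) atTop
      (𝓝 (∑' n, population ρ n * expect (M.rabiGibbs β (M.sectorIndex n + 1)) A)) :=
  tendsto_cesaroMean hE hc hτ (J := Set.univ) (fun i _ => hs i) (fun _ _ _ _ => Or.inr hM) hρ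
    (fun i hi => absurd (Set.mem_univ i) hi) A

theorem rabiIndices_one_of_isNonResonant (h : M.IsNonResonant) : M.rabiIndices 1 = Set.univ := by
  ext n
  simp [mem_rabiIndices, sectorIndex_of_isNonResonant h]

theorem not_exists_isInvariantState (hE : 0 < M.E) (hE₀ : 0 < M.E₀) (hc : M.coupling ≠ 0)
    (hτ : 0 < M.τ) (h : M.IsNonResonant) {β : ℝ} (hβ : β ≤ 0) :
    ¬ ∃ ρ, IsInvariantState (M.rdm β) ρ := by
  rintro ⟨ρ, hρ⟩
  have h1 : ∃ n, population ρ n ≠ 0 := by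
    by_contra! h0
    have h2 := hρ.1.hasSum_population
    rw [funext h0] at h2
    exact zero_ne_one (hasSum_zero.unique h2)
  obtain ⟨n, hn⟩ := h1
  have h2 := isNormalizable_of_population_ne_zero hE hc hτ hρ hn
  rw [sectorIndex_of_isNonResonant h, zero_add] at h2
  refine not_isNormalizable hE hE₀ hβ (r := 0) (fun n _ => ?_) h2
  rw [rabiIndices_one_of_isNonResonant h]
  exact Set.mem_univ n

theorem nonResonant_of_pos (hE : 0 < M.E) (hE₀ : 0 < M.E₀) (hc : M.coupling ≠ 0)
    (hτ : 0 < M.τ) (h : M.IsNonResonant) {β : ℝ} (hβ : 0 < β) :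
    (∀ ρ, IsErgodicState (M.rdm β) ρ ↔ ρ = M.gibbs (M.betaStar β) Set.univ) ∧
    ∀ ρ, IsState ρ → ∀ A : Field →L[ℂ] Field,
      Tendsto (cesaroMean (M.rdm β) ρ A) atTop
        (𝓝 (expect (M.gibbs (M.betaStar β) Set.univ) A)) := by
  have hM : ¬ M.IsDegenerate := not_isDegenerate_of_finite (by rw [h]; exact Set.finite_empty)
  have hs := isNormalizable_of_pos hE hE₀ hβ
  have hg : M.gibbs (M.betaStar β) Set.univ = M.rabiGibbs β 1 := by
    rw [rabiGibbs, rabiIndices_one_of_isNonResonant h]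
  have hI : (M.rabiIndices 1).Nonempty := by
    rw [rabiIndices_one_of_isNonResonant h]; exact Set.univ_nonempty
  rw [hg]
  refine ⟨fun ρ => ⟨fun hρ => ?_, fun hρ => ?_⟩, fun ρ hρ A => ?_⟩
  · obtain ⟨k, -, ⟨n, hn⟩, rfl⟩ := exists_eq_rabiGibbs_of_isErgodicState hE hc hτ hM hρ
    rw [mem_rabiIndices, sectorIndex_of_isNonResonant h] at hn
    rw [← hn]
  · rw [hρ]
    exact isErgodicState_rabiGibbs hE hc hτ (hs 1) hI
  · have h1 := tendsto_cesaroMean_of_not_isDegenerate hE hc hτ hM (fun n => hs _) hρ A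
    simp only [sectorIndex_of_isNonResonant h, zero_add] at h1
    have h2 : HasSum (fun n => (population ρ n : ℂ)) ((1 : ℝ) : ℂ) :=
      Complex.hasSum_ofReal.2 hρ.hasSum_population
    have h3 := h2.mul_right (expect (M.rabiGibbs β 1) A)
    rw [Complex.ofReal_one, one_mul] at h3
    rwa [h3.tsum_eq] at h1

theorem simplyResonant_sectors {r : ℕ} (h : M.resonances = {r}) :
    (M.rabiIndices 1).Finite ∧ (M.rabiIndices 1).Nonempty ∧ (∀ n, r ≤ n → n ∈ M.rabiIndices 2) ∧
      ∀ k, (M.rabiIndices (k + 1)).Nonempty → k = 0 ∨ k = 1 := by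
  refine ⟨(Set.finite_Iio r).subset fun n hn => ?_, ⟨0, ?_⟩, fun n hn => ?_, ?_⟩
  · by_contra hlt
    rw [mem_rabiIndices, sectorIndex_of_ge h (not_lt.1 hlt)] at hn
    omega
  · rw [mem_rabiIndices, sectorIndex_zero]
  · rw [mem_rabiIndices, sectorIndex_of_ge h hn]
  · rintro k ⟨n, hn⟩
    rw [mem_rabiIndices] at hn
    rcases lt_or_ge n r with h1 | h1
    · rw [sectorIndex_of_lt h h1] at hn
      omega
    · rw [sectorIndex_of_ge h h1] at hn
      omega

theorem simplyResonant_of_nonpos (hE : 0 < M.E) (hE₀ : 0 < M.E₀) (hc : M.coupling ≠ 0)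
    (hτ : 0 < M.τ) (h : M.IsSimplyResonant) {β : ℝ} (hβ : β ≤ 0) (ρ : Field →L[ℂ] Field) :
    IsErgodicState (M.rdm β) ρ ↔ ρ = M.rabiGibbs β 1 := by
  obtain ⟨r, hr⟩ := h
  have hM : ¬ M.IsDegenerate := not_isDegenerate_of_finite (by rw [hr]; exact Set.finite_singleton r)
  obtain ⟨h1, h2, h3, h4⟩ := simplyResonant_sectors hr
  refine ⟨fun hρ => ?_, fun hρ => ?_⟩
  · obtain ⟨k, hs, hk, rfl⟩ := exists_eq_rabiGibbs_of_isErgodicState hE hc hτ hM hρ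
    rcases h4 k hk with rfl | rfl
    · rfl
    · exact absurd hs (not_isNormalizable hE hE₀ hβ h3)
  · rw [hρ]
    exact isErgodicState_rabiGibbs hE hc hτ (isNormalizable_of_finite h1) h2

theorem simplyResonant_of_pos (hE : 0 < M.E) (hE₀ : 0 < M.E₀) (hc : M.coupling ≠ 0)
    (hτ : 0 < M.τ) (h : M.IsSimplyResonant) {β : ℝ} (hβ : 0 < β) :
    (∀ ρ, IsErgodicState (M.rdm β) ρ ↔ (ρ = M.rabiGibbs β 1 ∨ ρ = M.rabiGibbs β 2)) ∧
    M.rabiGibbs β 1 ≠ M.rabiGibbs β 2 ∧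
    ∀ ρ, IsState ρ → ∀ A : Field →L[ℂ] Field,
      Tendsto (cesaroMean (M.rdm β) ρ A) atTop
        (𝓝 (expect ρ (M.rabiProj 1) * expect (M.rabiGibbs β 1) A +
          expect ρ (M.rabiProj 2) * expect (M.rabiGibbs β 2) A)) := by
  obtain ⟨r, hr⟩ := h
  have hM : ¬ M.IsDegenerate := not_isDegenerate_of_finite (by rw [hr]; exact Set.finite_singleton r)
  obtain ⟨h1, h2, h3, h4⟩ := simplyResonant_sectors hr
  have hs := isNormalizable_of_pos hE hE₀ hβ
  refine ⟨fun ρ => ⟨fun hρ => ?_, ?_⟩, rabiGibbs_ne (hs 1) h2 (by norm_num), fun ρ hρ A => ?_⟩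
  · obtain ⟨k, -, hk, rfl⟩ := exists_eq_rabiGibbs_of_isErgodicState hE hc hτ hM hρ
    rcases h4 k hk with rfl | rfl
    · exact Or.inl rfl
    · exact Or.inr rfl
  · rintro (rfl | rfl)
    · exact isErgodicState_rabiGibbs hE hc hτ (hs 1) h2
    · exact isErgodicState_rabiGibbs hE hc hτ (hs 2) ⟨r, h3 r le_rfl⟩
  · have h5 := hasSum_expect_rabiProj_mul (fun n => hs _) hρ A
    -- Only the sectors 1 and 2 are non-empty, so the remaining projections have expectation zero.
    have h6 : HasSum (fun k : ℕ => expect ρ (M.rabiProj (k + 1)) *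
        expect (M.rabiGibbs β (k + 1)) A) (∑ k ∈ Finset.range 2,
        expect ρ (M.rabiProj (k + 1)) * expect (M.rabiGibbs β (k + 1)) A) := by
      refine hasSum_sum_of_ne_finset_zero fun k hk => ?_
      have hempty : M.rabiIndices (k + 1) = ∅ := by
        by_contra hne
        rw [← Ne, ← Set.nonempty_iff_ne_empty] at hne
        have := h4 k hne
        rw [Finset.mem_range] at hk
        omega
      rw [rabiProj, expect_proj hρ, hempty, tsum_empty, zero_mul]
    rw [Finset.sum_range_succ, Finset.sum_range_one] at h6
    rw [← h6.unique h5 |>.symm]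
    exact tendsto_cesaroMean_of_not_isDegenerate hE hc hτ hM (fun n => hs _) hρ A

end Maser

end OneAtomMaser

end

/-! ### The theorem -/

theorem mainTheorem7 (M : OneAtomMaser.Maser) (hE : 0 < M.E) (hE₀ : 0 < M.E₀)
    (hcoupling : M.coupling ≠ 0) (hτ : 0 < M.τ) (β : ℝ) :
    -- 1. non-resonant systems
    (M.IsNonResonant →
      (β ≤ 0 → ¬ ∃ ρ, OneAtomMaser.IsInvariantState (M.rdm β) ρ) ∧
      (0 < β →
        (∀ ρ, OneAtomMaser.IsErgodicState (M.rdm β) ρ ↔ ρ = M.gibbs (M.betaStar β) Set.univ) ∧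
        ∀ ρ, OneAtomMaser.IsState ρ → ∀ A : OneAtomMaser.Field →L[ℂ] OneAtomMaser.Field,
          Filter.Tendsto (OneAtomMaser.cesaroMean (M.rdm β) ρ A) Filter.atTop
            (nhds (OneAtomMaser.expect (M.gibbs (M.betaStar β) Set.univ) A)))) ∧
    -- 2. simply resonant systems
    (M.IsSimplyResonant →
      (β ≤ 0 → ∀ ρ, OneAtomMaser.IsErgodicState (M.rdm β) ρ ↔ ρ = M.rabiGibbs β 1) ∧
      (0 < β →
        (∀ ρ, OneAtomMaser.IsErgodicState (M.rdm β) ρ ↔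
          (ρ = M.rabiGibbs β 1 ∨ ρ = M.rabiGibbs β 2)) ∧
        M.rabiGibbs β 1 ≠ M.rabiGibbs β 2 ∧
        ∀ ρ, OneAtomMaser.IsState ρ → ∀ A : OneAtomMaser.Field →L[ℂ] OneAtomMaser.Field,
          Filter.Tendsto (OneAtomMaser.cesaroMean (M.rdm β) ρ A) Filter.atTop
            (nhds (OneAtomMaser.expect ρ (M.rabiProj 1) * OneAtomMaser.expect (M.rabiGibbs β 1) A +
              OneAtomMaser.expect ρ (M.rabiProj 2) *
                OneAtomMaser.expect (M.rabiGibbs β 2) A)))) ∧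
    -- 3. fully resonant systems
    (M.IsFullyResonant →
      (∀ k, 1 ≤ k → OneAtomMaser.IsErgodicState (M.rdm β) (M.rabiGibbs β k)) ∧
      (∀ k l, 1 ≤ k → 1 ≤ l → k ≠ l → M.rabiGibbs β k ≠ M.rabiGibbs β l) ∧
      (¬ M.IsDegenerate →
        ∀ ρ, OneAtomMaser.IsState ρ → ∀ A : OneAtomMaser.Field →L[ℂ] OneAtomMaser.Field,
          ∃ ℓ : ℂ,
            HasSum (fun k : ℕ => OneAtomMaser.expect ρ (M.rabiProj (k + 1)) *
              OneAtomMaser.expect (M.rabiGibbs β (k + 1)) A) ℓ ∧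
            Filter.Tendsto (OneAtomMaser.cesaroMean (M.rdm β) ρ A) Filter.atTop (nhds ℓ))) ∧
    -- 4. invariant states of non-degenerate systems
    (¬ M.IsDegenerate → ∀ ρ, OneAtomMaser.IsInvariantState (M.rdm β) ρ →
      OneAtomMaser.IsDiagonal ρ ∧
      ∃ c : ℕ → ℝ, (∀ k, 0 ≤ c k) ∧ HasSum c 1 ∧
        (∀ k, c k ≠ 0 → OneAtomMaser.IsErgodicState (M.rdm β) (M.rabiGibbs β (k + 1))) ∧
        HasSum (fun k => (c k : ℂ) • M.rabiGibbs β (k + 1)) ρ) ∧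
    -- 5. exponential mixing in finite-dimensional sectors
    (∀ k, 1 ≤ k → OneAtomMaser.IsErgodicState (M.rdm β) (M.rabiGibbs β k) →
      FiniteDimensional ℂ (M.rabiSector k) →
      OneAtomMaser.IsExpMixingState (M.rdm β) (M.rabiGibbs β k)) := by
  open OneAtomMaser OneAtomMaser.Maser in
  refine ⟨fun h => ⟨fun hβ => not_exists_isInvariantState hE hE₀ hcoupling hτ h hβ,
      fun hβ => nonResonant_of_pos hE hE₀ hcoupling hτ h hβ⟩,
    fun h => ⟨fun hβ => simplyResonant_of_nonpos hE hE₀ hcoupling hτ h hβ,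
      fun hβ => simplyResonant_of_pos hE hE₀ hcoupling hτ h hβ⟩,
    -- With infinitely many resonances every sector is finite, so all traces are finite whatever the
    -- sign of `β`.
    fun h => ⟨fun k hk => isErgodicState_rabiGibbs hE hcoupling hτ
        (isNormalizable_of_finite (finite_rabiIndices h k))
        (nonempty_rabiIndices_of_isFullyResonant h hk),
      fun k l hk _ hkl => rabiGibbs_ne (isNormalizable_of_finite (finite_rabiIndices h k))
        (nonempty_rabiIndices_of_isFullyResonant h hk) hkl,
      fun hM ρ hρ A => ⟨_, hasSum_expect_rabiProj_mul
          (fun n => isNormalizable_of_finite (finite_rabiIndices h _)) hρ A,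
        tendsto_cesaroMean_of_not_isDegenerate hE hcoupling hτ hM
          (fun n => isNormalizable_of_finite (finite_rabiIndices h _)) hρ A⟩⟩,
    fun hM ρ hρ => ⟨fun m n hmn => ?_, M.sectorWeight ρ, sectorWeight_nonneg hρ.1,
      hasSum_sectorWeight hρ.1, fun k hk => ?_, hasSum_smul_rabiGibbs hE hcoupling hτ hM hρ⟩,
    fun k hk hρ hfin => ?_⟩
  · rw [OneAtomMaser.inner_ket_left,
      OneAtomMaser.Maser.entry_eq_zero_of_invariant hcoupling hτ hM hρ hmn]
  · obtain ⟨h1, h2⟩ :=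
      OneAtomMaser.Maser.exists_of_sectorWeight_ne_zero hE hcoupling hτ hρ hk
    exact OneAtomMaser.Maser.isErgodicState_rabiGibbs hE hcoupling hτ h1 h2
  · obtain ⟨k, rfl⟩ := Nat.exists_eq_add_of_le' hk
    exact OneAtomMaser.Maser.isExpMixingState_rabiGibbs hE hcoupling hτ β
      (OneAtomMaser.Maser.finite_rabiIndices_of_finiteDimensional hfin)
      (OneAtomMaser.Maser.nonempty_of_isState_rabiGibbs hρ.1)
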